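/- **Online submodular cover.** Let $N$ be a finite ground set with $|N|=n$ and let $c:N\to\mathbb R_{\ge 0}$ be a cost function, with $c(S)=\sum_{j\in S}c(j)$. Functions $f^{(1)},f^{(2)},\dots:2^N\to\mathbb R_{\ge 0}$ arrive one at a time. Each is monotone and submodular, i.e. $f(A\cap B)+f(A\cup B)\le f(A)+f(B)$ for all $A,B\subseteq N$, and the sequence is time-monotone: $f^{(t+1)}(S)=f^{(t+1)}(N)$ implies $f^{(t)}(S)=f^{(t)}(N)$. At time $t$, knowing only $n$, $c$ and (through value oracles) the functions that have arrived so far, an online algorithm outputs a cover $S_t\subseteq N$, i.e. $f^{(t)}(S_t)=f^{(t)}(N)$, such that $S_{t-1}\subseteq S_t$, where $S_0=\emptyset$. A set function $f$ is 3-increasing (of class $\mathcal D_3^+$) if $\sum_{B\subseteq A}(-1)^{|B|}f((S\cup A)\setminus B)\ge 0$ for all $S,A\subseteq N$ with $|A|=3$. For $T\ge 1$ let $f_{\max}$ and $f_{\min}$ be the largest and the smallest nonzero value among the marginals $f^{(t)}(S\cup\{j\})-f^{(t)}(S)$ with $1\le t\le T$, $j\in N$, $S\subseteq N$ (if all these marginals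 vanish, the logarithms below are read as $0$). **Theorem 1.2.** There are a randomized online algorithm, a constant $C$ and a polynomial $p$ such that on every such instance (fixed in advance) in which all $f^{(t)}$ are 3-increasing, the algorithm always maintains covers $S_1\subseteq S_2\subseteq\cdots$ as above, and for each $T\ge 1$ $$\mathbb E[c(S_T)]\;\le\; C\,(1+\ln n)\,\Bigl(1+\ln\frac{T f_{\max}}{f_{\min}}\Bigr)\cdot\min\{c(S): S\subseteq N,\ f^{(T)}(S)=f^{(T)}(N)\}$$ (with $\ln 0:=0$ if $n=0$). In particular the ratio is $O(\ln n\cdot\ln(T f_{\max}/f_{\min}))$ for $n\ge2$ and $T f_{\max}/f_{\min}\ge 2$. The algorithm is efficient: it is a single finite program for a randomized real RAM (fair coin flips, unit-cost arithmetic and comparisons on reals, additive integer arithmetic and indirect addressing, value queries to the current $f^{(t)}$), and at every time $T$ it halts after at most $p\bigl(n,\,T,\,\ln(f_{\max}/f_{\min})\bigr)$ steps, whatever the outcomes of the coins. -/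

import Mathlib

open scoped BigOperators

namespace OnlineCover

/-! ### Submodular cover -/

section Cover

variable {n : ℕ}

/-- The marginal value `f(j ∣ S) = f(S ∪ {j}) - f(S)`. -/
def marginal (f : Finset (Fin n) → ℝ) (j : Fin n) (S : Finset (Fin n)) : ℝ :=
  f (S ∪ {j}) - f S

/-- `f(A ∩ B) + f(A ∪ B) ≤ f(A) + f(B)` for all `A`, `B`. -/
def IsSubmodular (f : Finset (Fin n) → ℝ) : Prop :=
  ∀ A B : Finset (Fin n), f (A ∩ B) + f (A ∪ B) ≤ f A + f B

/-- The derivative of a set function `f` with respect to the set `A`, evaluated at `S`: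
`∑_{B ⊆ A} (-1)^|B| f((S ∪ A) \ B)`. -/
def setDeriv (f : Finset (Fin n) → ℝ) (A S : Finset (Fin n)) : ℝ :=
  ∑ B ∈ A.powerset, (-1 : ℝ) ^ B.card * f ((S ∪ A) \ B)

/-- `f` is `m`-increasing: all its derivatives of order `m` are nonnegative. -/
def IsIncreasing (m : ℕ) (f : Finset (Fin n) → ℝ) : Prop :=
  ∀ A : Finset (Fin n), A.card = m → ∀ S : Finset (Fin n), 0 ≤ setDeriv f A S

/-- `S` is a submodular cover for `f`: `f(S) = f(N)`. -/
def IsCover (f : Finset (Fin n) → ℝ) (S : Finset (Fin n)) : Prop :=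
  f S = f Finset.univ

/-- The cost `c(S)` of a set. -/
def cost (c : Fin n → ℝ) (S : Finset (Fin n)) : ℝ := ∑ j ∈ S, c j

/-- The minimum cost of a submodular cover for `f`. (The set is finite, and nonempty since the
whole ground set is a cover.) -/
noncomputable def optCost (c : Fin n → ℝ) (f : Finset (Fin n) → ℝ) : ℝ :=
  sInf (cost c '' {S | IsCover f S})

/-- The largest marginal of `f^(1), …, f^(T)`. -/
noncomputable def fmax (f : ℕ → Finset (Fin n) → ℝ) (T : ℕ) : ℝ :=
  sSup {x | ∃ t, 1 ≤ t ∧ t ≤ T ∧ ∃ j S, x = marginal (f t) j S}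

/-- The smallest nonzero marginal of `f^(1), …, f^(T)`. (It is `0` by convention if all marginals
vanish.) -/
noncomputable def fmin (f : ℕ → Finset (Fin n) → ℝ) (T : ℕ) : ℝ :=
  sInf {x | x ≠ 0 ∧ ∃ t, 1 ≤ t ∧ t ≤ T ∧ ∃ j S, x = marginal (f t) j S}

/-- An instance of online submodular cover with ground set `N = Fin n` and horizon `T`: nonnegative
costs, and a time-monotone sequence `f^(1), …, f^(T)` of nonnegative monotone submodular
functions. The values `f t` with `t = 0` or `T < t` play no role. -/
structure IsInstance (c : Fin n → ℝ) (f : ℕ → Finset (Fin n) → ℝ) (T : ℕ) : Prop where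
  cost_nonneg : ∀ j, 0 ≤ c j
  nonneg : ∀ t, 1 ≤ t → t ≤ T → ∀ S, 0 ≤ f t S
  mono : ∀ t, 1 ≤ t → t ≤ T → Monotone (f t)
  submodular : ∀ t, 1 ≤ t → t ≤ T → IsSubmodular (f t)
  timeMonotone : ∀ t, 1 ≤ t → t + 1 ≤ T → ∀ S, IsCover (f (t + 1)) S → IsCover (f t) S

end Cover

/-! ### The machine model

A randomized real RAM with a value oracle. Programs are finite, and independent of the size of the
input. The memory consists of integer and real variables and of (unbounded) integer and real
arrays; variables and arrays are named by natural numbers. Every execution step performs one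
command, which evaluates expressions of a size that is fixed by the program. On integers there are
only additions, truncated subtractions and comparisons; on reals there are the four field
operations and comparisons (division by zero returns zero), but no rounding. The only source of
randomness are fair coins. -/

/-- Integer expressions. -/
inductive IExp where
  | const (k : ℕ)
  | var (x : ℕ)
  | get (a : ℕ) (i : IExp)
  | add (u v : IExp)
  | sub (u v : IExp)

/-- Real expressions. -/
inductive RExp where
  | ofInt (u : IExp)
  | var (x : ℕ)
  | get (a : ℕ) (i : IExp)
  | add (u v : RExp)
  | sub (u v : RExp)
  | mul (u v : RExp)
  | div (u v : RExp)

/-- Tests: comparison of two integers or of two reals. -/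
inductive Test where
  | ilt (u v : IExp)
  | rlt (u v : RExp)

/-- Programs. -/
inductive Cmd where
  /-- do nothing -/
  | skip
  /-- integer variable `x := u` -/
  | iset (x : ℕ) (u : IExp)
  /-- integer array `a[i] := u` -/
  | iput (a : ℕ) (i u : IExp)
  /-- real variable `x := u` -/
  | rset (x : ℕ) (u : RExp)
  /-- real array `a[i] := u` -/
  | rput (a : ℕ) (i : IExp) (u : RExp)
  /-- integer variable `x :=` a fair random bit -/
  | flip (x : ℕ)
  /-- real variable `x :=` the value of the current function at the set whose indicator is stored
  in the integer array `a` -/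
  | query (x a : ℕ)
  | seq (p q : Cmd)
  | ite (b : Test) (p q : Cmd)
  | while (b : Test) (p : Cmd)

/-- The contents of the memory. -/
structure Store where
  ivar : ℕ → ℕ
  rvar : ℕ → ℝ
  iarr : ℕ → ℕ → ℕ
  rarr : ℕ → ℕ → ℝ

/-- Value of an integer expression. -/
def IExp.eval (σ : Store) : IExp → ℕ
  | const k => k
  | var x => σ.ivar x
  | get a i => σ.iarr a (i.eval σ)
  | add u v => u.eval σ + v.eval σ
  | sub u v => u.eval σ - v.eval σ

/-- Value of a real expression. -/
noncomputable def RExp.eval (σ : Store) : RExp → ℝ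
  | ofInt u => (u.eval σ : ℝ)
  | var x => σ.rvar x
  | get a i => σ.rarr a (i.eval σ)
  | add u v => u.eval σ + v.eval σ
  | sub u v => u.eval σ - v.eval σ
  | mul u v => u.eval σ * v.eval σ
  | div u v => u.eval σ / v.eval σ

/-- Truth of a test. -/
def Test.Holds (σ : Store) : Test → Prop
  | ilt u v => u.eval σ < v.eval σ
  | rlt u v => u.eval σ < v.eval σ

namespace Store

/-- Assign to an integer variable. -/
def setI (σ : Store) (x v : ℕ) : Store :=
  { σ with ivar := Function.update σ.ivar x v }

/-- Assign to a real variable. -/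
noncomputable def setR (σ : Store) (x : ℕ) (v : ℝ) : Store :=
  { σ with rvar := Function.update σ.rvar x v }

/-- Assign to a cell of an integer array. -/
def putI (σ : Store) (a i v : ℕ) : Store :=
  { σ with iarr := Function.update σ.iarr a (Function.update (σ.iarr a) i v) }

/-- Assign to a cell of a real array. -/
noncomputable def putR (σ : Store) (a i : ℕ) (v : ℝ) : Store :=
  { σ with rarr := Function.update σ.rarr a (Function.update (σ.rarr a) i v) }

/-- The subset of the ground set whose indicator is stored in the integer array `a`. -/
def set (n : ℕ) (σ : Store) (a : ℕ) : Finset (Fin n) :=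
  Finset.univ.filter fun j => σ.iarr a j ≠ 0

/-- The solution held by the machine is stored in the integer array `0`. -/
def sol (n : ℕ) (σ : Store) : Finset (Fin n) := σ.set n 0

/-- The initial memory: the integer variable `0` holds the size `n` of the ground set, the real
array `0` holds the costs, everything else is zero. -/
noncomputable def init {n : ℕ} (c : Fin n → ℝ) : Store where
  ivar := fun x => if x = 0 then n else 0
  rvar := fun _ => 0
  iarr := fun _ _ => 0
  rarr := fun a i => if h : a = 0 ∧ i < n then c ⟨i, h.2⟩ else 0

end Store

/-- A configuration: the commands that remain to be executed, and the memory. The machine has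
halted when no command remains. -/
abbrev Config := List Cmd × Store

section Semantics

variable {n : ℕ}

open Classical in
/-- One step of the machine with the value oracle `f`. -/
noncomputable def step (f : Finset (Fin n) → ℝ) : Config → PMF Config
  | ([], σ) => PMF.pure ([], σ)
  | (Cmd.skip :: K, σ) => PMF.pure (K, σ)
  | (Cmd.iset x u :: K, σ) => PMF.pure (K, σ.setI x (u.eval σ))
  | (Cmd.iput a i u :: K, σ) => PMF.pure (K, σ.putI a (i.eval σ) (u.eval σ))
  | (Cmd.rset x u :: K, σ) => PMF.pure (K, σ.setR x (u.eval σ))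
  | (Cmd.rput a i u :: K, σ) => PMF.pure (K, σ.putR a (i.eval σ) (u.eval σ))
  | (Cmd.flip x :: K, σ) =>
      (PMF.uniformOfFintype Bool).map fun b => (K, σ.setI x (if b then 1 else 0))
  | (Cmd.query x a :: K, σ) => PMF.pure (K, σ.setR x (f (σ.set n a)))
  | (Cmd.seq p q :: K, σ) => PMF.pure (p :: q :: K, σ)
  | (Cmd.ite b p q :: K, σ) => PMF.pure (if b.Holds σ then (p :: K, σ) else (q :: K, σ))
  | (Cmd.while b p :: K, σ) =>
      PMF.pure (if b.Holds σ then (p :: Cmd.while b p :: K, σ) else (K, σ))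

/-- The distribution of the configuration after `k` steps. -/
noncomputable def steps (f : Finset (Fin n) → ℝ) : ℕ → Config → PMF Config
  | 0, x => PMF.pure x
  | k + 1, x => (step f x).bind (steps f k)

/-- Started on the memory `σ` with oracle `f`, the program `P` halts within `k` steps, whatever the
outcomes of the coins. -/
def HaltsWithin (f : Finset (Fin n) → ℝ) (P : Cmd) (σ : Store) (k : ℕ) : Prop :=
  ∀ x ∈ (steps f k ([P], σ)).support, x.1 = []

open Classical in
/-- The distribution of the memory when `P`, started on `σ` with oracle `f`, has halted. (The
convention in the last line concerns only programs that do not halt in bounded time.) -/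
noncomputable def runToEnd (f : Finset (Fin n) → ℝ) (P : Cmd) (σ : Store) : PMF Store :=
  if h : ∃ k, HaltsWithin f P σ k then (steps f (Nat.find h) ([P], σ)).map Prod.snd
  else PMF.pure σ

/-- The online execution of `P`: at each time `t = 1, 2, …` the program is run once, with value
oracle `f^(t)`, on the memory that it left behind at time `t - 1`. This is the distribution of the
memory after time `t`. -/
noncomputable def onlineRun (P : Cmd) (c : Fin n → ℝ) (f : ℕ → Finset (Fin n) → ℝ) :
    ℕ → PMF Store
  | 0 => PMF.pure (Store.init c)
  | t + 1 => (onlineRun P c f t).bind (runToEnd (f (t + 1)) P)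

/-- The expected cost of the solution `S_T` after time `T`. -/
noncomputable def expectedCost (P : Cmd) (c : Fin n → ℝ) (f : ℕ → Finset (Fin n) → ℝ) (T : ℕ) :
    ℝ :=
  ∑ S : Finset (Fin n), (((onlineRun P c f T).map (Store.sol n)) S).toReal * cost c S

end Semantics

end OnlineCover

open OnlineCover

/-!
The theorem rests on a potential function, the *residual cost* `resid f c S`: complete `S` to a cover
by going through the ground set by increasing cost, and charge each element its cost times its
marginal. It vanishes on covers and is antitone because `f` is monotone and submodular. Since `f` is
3-increasing, the marginals of `f` are supermodular, and hence so is the residual cost: the gain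
`resid f c S - resid f c (S ∪ {j})` of an element `j` is antitone in `S` (`resid_diff_antitone`). So
the elements of a cover, added separately to a set `S`, gain at least the whole residual cost of `S`
in total (`resid_le_sum_cover`). In other words, every cover satisfies the linear constraints
`∑ j, gain S j * x j ≥ resid S`, one for each set `S`. At the empty set, exchanging an element of the
cover with the cheaper elements gives `resid f c ∅ ≤ maxSingle f * cost c O` for every cover `O`
(`resid_empty_le`).

*Fractional solution.* The algorithm maintains a fractional `x`. Whenever it meets a set `S` whose
constraint fails even with the right hand side halved, it raises `x` multiplicatively (`bump`): every
`x j + 1 / D` grows by a factor between `1` and `2`, in proportion to the gain per cost, and one of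
them doubles. Here `D` is a power of two between `4 * n` and `8 * n + 4`. By the constraint of an
optimal cover `O`, each update is paid for by the increase of `∑ j ∈ O, c j * log (x j + 1 / D)`
(`progress_bump`). Hence `x` costs at most `2 * log (4 * D)` times the optimum
(`fractional_cost_le`), and there are at most `n * (log₂ D + 2)` updates (`updates_le`).

*Rounding.* There are `M = D ^ 3` paths of random layers `(j, u)`, with `j` and `u` uniform below
`D`. A layer adds `j` to the rounded set if `u + 1 ≤ D * x j`, so `j` is added with probability
roughly `x j / D`, and the elements with `x j ≥ 1` are always added. A pass along a path checks the
constraint of the rounded set before each layer, and updates `x` if it is violated. If it is not, a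
fresh random layer lowers the expected residual cost by the factor `1 - 1 / (4 * D)`, so a stage of
`D` layers lowers it by the factor `4 / 5`. At time `t`, a path with `s` stages gets another stage if
completing its rounded set meets a positive marginal below `maxSingle f * t ^ 2 * (9 / 10) ^ s`. As
marginals are at least `fmin`, there are at most `1 + 20 * log (T * fmax / fmin)` stages
(`stageBound`). The algorithm sweeps over all paths until nothing changes, which happens because each
sweep but the last increases the number of updates or of stages (`effort_lt`). One path, chosen
uniformly at random in advance, is the secret one: its rounded set is bought, and completed to a
cover by the elements that have a positive marginal when the ground set is gone through by cost
(`fill`).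

*Expected cost.* The obstacle is that `x` depends on the random layers that are used to round it. But
there are far more paths than updates, so that the secret path rarely causes an update; when it does,
a crude bound on the cost suffices. As long as it causes none, the fractional solution does not
depend on its layers at all (`run_sameExcept`): rerunning the algorithm with other layers that cause
no update gives the same `x`. So those layers are as good as fresh. The rounded set costs at most
about the number of stages times the cost of `x` (`sum_cost_layers_le`). Completing it after `s`
stages costs at most its residual cost divided by the threshold, on average
`(4 / 5) ^ s * resid ∅ / threshold`, which is at most `(8 / 9) ^ s / t ^ 2` times the optimum; this
is summable over all `s` and `t` (`sum_quietCost_update_le`). Altogether the expected cost is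
`O(log n * log (T * fmax / fmin))` times the optimum (`sum_cost_solution_le`).

*Program.* The algorithm is written out as a program for the given machine. A random execution is
turned into a deterministic one on a stream of coins (`onlineRun_eq_coins`), programs are verified
against postconditions together with step bounds (`Ends`) and with the part of the memory that they
leave unchanged (`Frame`), and the program is shown to follow the algorithm step by step
(`coverProgram_spec`) within a polynomial number of steps (`coverTime_le`). The coins are finally
decoded into the independent uniform paths and the secret path of the analysis
(`coinAvg_cost_solution_le`).
-/

namespace OnlineCover

/-! ### Deterministic execution on a stream of coins -/

/-- A memory, together with the infinite stream of the coins that have not been used yet. -/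
abbrev CState := Store × (ℕ → Bool)

/-- The stream without its first coin. -/
def tailCoins (ω : ℕ → Bool) : ℕ → Bool := fun i => ω (i + 1)

/-- The stream `ω` preceded by the coin `b`. -/
def consCoins (b : Bool) (ω : ℕ → Bool) : ℕ → Bool
  | 0 => b
  | i + 1 => ω i

@[simp] theorem consCoins_zero (b : Bool) (ω : ℕ → Bool) : consCoins b ω 0 = b := rfl

@[simp] theorem tailCoins_consCoins (b : Bool) (ω : ℕ → Bool) :
    tailCoins (consCoins b ω) = ω := rfl

theorem consCoins_tailCoins (ω : ℕ → Bool) : consCoins (ω 0) (tailCoins ω) = ω := by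
  funext i; cases i <;> rfl

section Det

variable {n : ℕ}

open Classical in
/-- One step of the machine, with the coins taken from the stream. -/
noncomputable def stepD (f : Finset (Fin n) → ℝ) : List Cmd × CState → List Cmd × CState
  | ([], s) => ([], s)
  | (Cmd.skip :: K, s) => (K, s)
  | (Cmd.iset x u :: K, (σ, ω)) => (K, (σ.setI x (u.eval σ), ω))
  | (Cmd.iput a i u :: K, (σ, ω)) => (K, (σ.putI a (i.eval σ) (u.eval σ), ω))
  | (Cmd.rset x u :: K, (σ, ω)) => (K, (σ.setR x (u.eval σ), ω))
  | (Cmd.rput a i u :: K, (σ, ω)) => (K, (σ.putR a (i.eval σ) (u.eval σ), ω))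
  | (Cmd.flip x :: K, (σ, ω)) => (K, (σ.setI x (if ω 0 then 1 else 0), tailCoins ω))
  | (Cmd.query x a :: K, (σ, ω)) => (K, (σ.setR x (f (σ.set n a)), ω))
  | (Cmd.seq p q :: K, s) => (p :: q :: K, s)
  | (Cmd.ite b p q :: K, (σ, ω)) => if b.Holds σ then (p :: K, (σ, ω)) else (q :: K, (σ, ω))
  | (Cmd.while b p :: K, (σ, ω)) =>
      if b.Holds σ then (p :: Cmd.while b p :: K, (σ, ω)) else (K, (σ, ω))

variable (f : Finset (Fin n) → ℝ)

theorem stepD_nil_iterate (k : ℕ) (s : CState) : (stepD f)^[k] ([], s) = ([], s) := by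
  induction k with
  | zero => rfl
  | succ k ih => rw [Function.iterate_succ_apply]; exact ih

/-- A step either uses no coin, or exactly one. -/
theorem step_cases (x : Config) :
    (∃ y : Config, step f x = PMF.pure y ∧ ∀ ω, stepD f (x.1, (x.2, ω)) = (y.1, (y.2, ω))) ∨
    (∃ y : Bool → Config, step f x = (PMF.uniformOfFintype Bool).map y ∧
      ∀ ω, stepD f (x.1, (x.2, ω)) = ((y (ω 0)).1, ((y (ω 0)).2, tailCoins ω))) := by
  obtain ⟨K, σ⟩ := x
  cases K with
  | nil => exact Or.inl ⟨([], σ), by simp [step], fun ω => rfl⟩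
  | cons P K =>
    cases P with
    | skip => exact Or.inl ⟨_, by rw [step], fun ω => rfl⟩
    | iset x u => exact Or.inl ⟨_, by rw [step], fun ω => rfl⟩
    | iput a i u => exact Or.inl ⟨_, by rw [step], fun ω => rfl⟩
    | rset x u => exact Or.inl ⟨_, by rw [step], fun ω => rfl⟩
    | rput a i u => exact Or.inl ⟨_, by rw [step], fun ω => rfl⟩
    | flip x =>
      refine Or.inr ⟨fun b => (K, σ.setI x (if b then 1 else 0)), by rw [step], fun ω => rfl⟩
    | query x a => exact Or.inl ⟨_, by rw [step], fun ω => rfl⟩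
    | seq p q => exact Or.inl ⟨_, by rw [step], fun ω => rfl⟩
    | ite b p q =>
      refine Or.inl ⟨_, by rw [step], fun ω => ?_⟩
      by_cases h : b.Holds σ <;> simp [stepD, h]
    | _ b p =>
      refine Or.inl ⟨_, by rw [step], fun ω => ?_⟩
      by_cases h : b.Holds σ <;> simp [stepD, h]

end Det

/-- A stream whose first `L` coins are fair and independent, and whose other coins are `false`. -/
noncomputable def coins : ℕ → PMF (ℕ → Bool)
  | 0 => PMF.pure fun _ => false
  | L + 1 => (PMF.uniformOfFintype Bool).bind fun b => (coins L).map (consCoins b)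

theorem coins_succ_map {β : Type*} (L : ℕ) (F : (ℕ → Bool) → β) :
    (coins (L + 1)).map F =
      (PMF.uniformOfFintype Bool).bind fun b => (coins L).map fun ω => F (consCoins b ω) := by
  simp only [coins, PMF.map_bind, PMF.map_comp]
  rfl

section Link

variable {n : ℕ} (f : Finset (Fin n) → ℝ)

/-- The random execution of `k` steps, followed by a random continuation `Kf` that can be simulated
on coin streams by `F`, can be simulated on coin streams. -/
theorem steps_bind_eq_coins {β : Type*} (Kf : Config → PMF β)
    (F : Config → (ℕ → Bool) → β) (B : ℕ) :
    ∀ (k L : ℕ) (x : Config), k + B ≤ L →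
      (∀ y ∈ (steps f k x).support, ∀ L, B ≤ L → Kf y = (coins L).map (F y)) →
      (steps f k x).bind Kf = (coins L).map fun ω =>
        F (((stepD f)^[k] (x.1, (x.2, ω))).1, ((stepD f)^[k] (x.1, (x.2, ω))).2.1)
          ((stepD f)^[k] (x.1, (x.2, ω))).2.2 := by
  intro k
  induction k with
  | zero =>
    intro L x hL h
    simp only [steps, PMF.pure_bind, Function.iterate_zero, id]
    exact h x (by simp [steps]) L (by omega)
  | succ k ih =>
    intro L x hL h
    rcases step_cases f x with ⟨y, hy, hD⟩ | ⟨y, hy, hD⟩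
    · have hs : steps f (k + 1) x = steps f k y := by simp [steps, hy]
      rw [hs] at h ⊢
      rw [ih L y (by omega) h]
      simp only [Function.iterate_succ_apply, hD]
    · obtain ⟨L, rfl⟩ : ∃ L', L = L' + 1 := ⟨L - 1, by omega⟩
      have hs : steps f (k + 1) x =
          (PMF.uniformOfFintype Bool).bind fun b => steps f k (y b) := by
        simp only [steps, hy, PMF.bind_map]
        rfl
      rw [coins_succ_map, hs, PMF.bind_bind]
      congr 1
      funext b
      rw [ih L (y b) (by omega) (fun z hz => h z (by
        rw [hs, PMF.mem_support_bind_iff]; exact ⟨b, by simp, hz⟩))]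
      simp only [Function.iterate_succ_apply, hD, consCoins_zero, tailCoins_consCoins]

theorem steps_eq_coins (k L : ℕ) (x : Config) (hL : k ≤ L) :
    steps f k x = (coins L).map fun ω =>
      (((stepD f)^[k] (x.1, (x.2, ω))).1, ((stepD f)^[k] (x.1, (x.2, ω))).2.1) := by
  have := steps_bind_eq_coins f PMF.pure (fun y _ => y) 0 k L x (by omega)
    (fun y _ L _ => (PMF.map_const (coins L) y).symm)
  rw [PMF.bind_pure] at this
  exact this

theorem steps_nil (k : ℕ) (σ : Store) : steps f k ([], σ) = PMF.pure ([], σ) := by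
  induction k with
  | zero => rfl
  | succ k ih => simp [steps, step, ih]

theorem steps_add (a b : ℕ) (x : Config) :
    steps f (a + b) x = (steps f a x).bind (steps f b) := by
  induction a generalizing x with
  | zero => simp [steps]
  | succ a ih =>
    rw [Nat.succ_add]
    simp only [steps, PMF.bind_bind]
    congr 1
    funext y
    exact ih y

theorem steps_map_snd_eq {P : Cmd} {σ : Store} {k k' : ℕ} (h : HaltsWithin f P σ k)
    (hk : k ≤ k') : steps f k' ([P], σ) = steps f k ([P], σ) := by
  obtain ⟨d, rfl⟩ := Nat.exists_eq_add_of_le hk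
  rw [steps_add]
  conv_rhs => rw [← PMF.bind_pure (steps f k ([P], σ))]
  ext z
  simp only [PMF.bind_apply]
  refine tsum_congr fun y => ?_
  by_cases hy : y ∈ (steps f k ([P], σ)).support
  · obtain ⟨y1, y2⟩ := y
    have : y1 = [] := h _ hy
    subst this
    rw [steps_nil]
  · rw [PMF.mem_support_iff, not_not] at hy
    simp [hy]

theorem runToEnd_eq {P : Cmd} {σ : Store} {k : ℕ} (h : HaltsWithin f P σ k) :
    runToEnd f P σ = (steps f k ([P], σ)).map Prod.snd := by
  classical
  have he : ∃ k, HaltsWithin f P σ k := ⟨k, h⟩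
  rw [runToEnd, dif_pos he]
  have hle := Nat.find_min' he h
  rw [steps_map_snd_eq f (Nat.find_spec he) hle]

/-- An execution depends only on the coins that it uses. -/
theorem stepD_iterate_prefix (k : ℕ) (K : List Cmd) (σ : Store) (ω : ℕ → Bool) :
    ∃ l : List Bool, ω = l.foldr consCoins ((stepD f)^[k] (K, (σ, ω))).2.2 ∧
      ∀ ω', (stepD f)^[k] (K, (σ, l.foldr consCoins ω')) =
        (((stepD f)^[k] (K, (σ, ω))).1, (((stepD f)^[k] (K, (σ, ω))).2.1, ω')) := by
  induction k generalizing K σ ω with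
  | zero => exact ⟨[], rfl, fun ω' => rfl⟩
  | succ k ih =>
    rcases step_cases f (K, σ) with ⟨y, hy, hD⟩ | ⟨y, hy, hD⟩
    · obtain ⟨l, h1, h2⟩ := ih y.1 y.2 ω
      refine ⟨l, ?_, fun ω' => ?_⟩
      · rw [Function.iterate_succ_apply, hD]; exact h1
      · rw [Function.iterate_succ_apply, hD, h2, Function.iterate_succ_apply, hD]
    · obtain ⟨l, h1, h2⟩ := ih (y (ω 0)).1 (y (ω 0)).2 (tailCoins ω)
      refine ⟨ω 0 :: l, ?_, fun ω' => ?_⟩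
      · rw [Function.iterate_succ_apply, hD, List.foldr_cons, ← h1, consCoins_tailCoins]
      · rw [Function.iterate_succ_apply, hD, Function.iterate_succ_apply, hD]
        exact h2 ω'

end Link

/-! ### Bounded execution of programs -/

section Ends

variable {n : ℕ} (f : Finset (Fin n) → ℝ)

/-- Started on `s`, the program `P` halts after at most `k` steps, in a state that satisfies
`Q`. -/
def Ends (P : Cmd) (k : ℕ) (s : CState) (Q : CState → Prop) : Prop :=
  ∃ s', Q s' ∧ ∃ k' ≤ k, ∀ K, (stepD f)^[k'] (P :: K, s) = (K, s')

variable {f}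

theorem Ends.mono {P : Cmd} {k k' : ℕ} {s : CState} {Q Q' : CState → Prop}
    (h : Ends f P k s Q) (hk : k ≤ k') (hQ : ∀ s', Q s' → Q' s') : Ends f P k' s Q' := by
  obtain ⟨s', h1, j, hj, h2⟩ := h
  exact ⟨s', hQ _ h1, j, hj.trans hk, h2⟩

/-- The parts of the memory that a program can change. -/
inductive Loc where
  | iv (x : ℕ)
  | ia (a : ℕ)
  | rv (x : ℕ)
  | ra (a : ℕ)
  | coin
  deriving DecidableEq

/-- Whether the command may change the given part of the memory. -/
def Cmd.writes : Cmd → Loc → Bool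
  | .skip, _ => false
  | .iset x _, l => decide (l = .iv x)
  | .iput a _ _, l => decide (l = .ia a)
  | .rset x _, l => decide (l = .rv x)
  | .rput a _ _, l => decide (l = .ra a)
  | .flip x, l => decide (l = .iv x) || decide (l = .coin)
  | .query x _, l => decide (l = .rv x)
  | .seq p q, l => p.writes l || q.writes l
  | .ite _ p q, l => p.writes l || q.writes l
  | .while _ p, l => p.writes l

/-- The states agree on the given part of the memory. -/
def Agree (s s' : CState) : Loc → Prop
  | .iv x => s'.1.ivar x = s.1.ivar x
  | .ia a => s'.1.iarr a = s.1.iarr a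
  | .rv x => s'.1.rvar x = s.1.rvar x
  | .ra a => s'.1.rarr a = s.1.rarr a
  | .coin => s'.2 = s.2

theorem Agree.refl (s : CState) (l : Loc) : Agree s s l := by cases l <;> rfl

theorem Agree.trans {s s' s'' : CState} {l : Loc} (h : Agree s s' l) (h' : Agree s' s'' l) :
    Agree s s'' l := by
  cases l <;> exact Eq.trans h' h

/-- `s'` differs from `s` only in places that `P` may change. -/
def Frame (P : Cmd) (s s' : CState) : Prop := ∀ l, P.writes l = false → Agree s s' l

/-- A step preserves a part of the memory that no pending command may change, and adds no command
that may change it. -/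
theorem stepD_agree (l : Loc) (K : List Cmd) (s : CState)
    (h : ∀ P ∈ K, P.writes l = false) :
    Agree s (stepD f (K, s)).2 l ∧ ∀ P ∈ (stepD f (K, s)).1, P.writes l = false := by
  obtain ⟨σ, ω⟩ := s
  cases K with
  | nil => exact ⟨Agree.refl _ _, by simp [stepD]⟩
  | cons P K =>
    have hP := h P (by simp)
    have hK : ∀ P ∈ K, P.writes l = false := fun Q hQ => h Q (by simp [hQ])
    cases P with
    | skip => exact ⟨Agree.refl _ _, hK⟩
    | iset x u =>
      refine ⟨?_, hK⟩
      cases l <;> simp_all [Cmd.writes, Agree, stepD, Store.setI, Function.update]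
    | iput a i u =>
      refine ⟨?_, hK⟩
      cases l <;> simp_all [Cmd.writes, Agree, stepD, Store.putI, Function.update]
    | rset x u =>
      refine ⟨?_, hK⟩
      cases l <;> simp_all [Cmd.writes, Agree, stepD, Store.setR, Function.update]
    | rput a i u =>
      refine ⟨?_, hK⟩
      cases l <;> simp_all [Cmd.writes, Agree, stepD, Store.putR, Function.update]
    | flip x =>
      refine ⟨?_, hK⟩
      cases l <;> simp_all [Cmd.writes, Agree, stepD, Store.setI, Function.update]
    | query x a =>
      refine ⟨?_, hK⟩
      cases l <;> simp_all [Cmd.writes, Agree, stepD, Store.setR, Function.update]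
    | seq p q =>
      refine ⟨Agree.refl _ _, ?_⟩
      simp only [Cmd.writes, Bool.or_eq_false_iff] at hP
      simpa [stepD, hP] using hK
    | ite b p q =>
      simp only [Cmd.writes, Bool.or_eq_false_iff] at hP
      by_cases hb : b.Holds σ <;> simp only [stepD, hb, if_true, if_false] <;>
        exact ⟨Agree.refl _ _, by simpa [hP] using hK⟩
    | _ b p =>
      by_cases hb : b.Holds σ <;> simp only [stepD, hb, if_true, if_false] <;>
        refine ⟨Agree.refl _ _, ?_⟩
      · simp only [Cmd.writes] at hP
        simpa [hP, Cmd.writes] using hK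
      · exact hK

theorem stepD_iterate_agree (l : Loc) (k : ℕ) (K : List Cmd) (s : CState)
    (h : ∀ P ∈ K, P.writes l = false) : Agree s ((stepD f)^[k] (K, s)).2 l := by
  induction k generalizing K s with
  | zero => exact Agree.refl _ _
  | succ k ih =>
    rw [Function.iterate_succ_apply]
    have := stepD_agree (f := f) l K s h
    exact this.1.trans (ih _ _ this.2)

/-- The frame rule: a halting program changes only what it may change. -/
theorem Ends.frame {P : Cmd} {k : ℕ} {s : CState} {Q : CState → Prop} (h : Ends f P k s Q) :
    Ends f P k s fun s' => Q s' ∧ Frame P s s' := by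
  obtain ⟨s', h1, j, hj, h2⟩ := h
  refine ⟨s', ⟨h1, fun l hl => ?_⟩, j, hj, h2⟩
  have := stepD_iterate_agree (f := f) l j [P] s (by simpa using hl)
  rwa [h2 []] at this

theorem Ends.seq {P P' : Cmd} {k k' : ℕ} {s : CState} {Q Q' : CState → Prop}
    (h : Ends f P k s Q) (h' : ∀ s', Q s' → Frame P s s' → Ends f P' k' s' Q') :
    Ends f (.seq P P') (k + k' + 1) s Q' := by
  obtain ⟨s', ⟨h1, hF⟩, j, hj, h2⟩ := h.frame
  obtain ⟨s'', h1', j', hj', h2'⟩ := h' s' h1 hF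
  refine ⟨s'', h1', j' + j + 1, by omega, fun K => ?_⟩
  rw [Function.iterate_succ_apply]
  change (stepD f)^[j' + j] (P :: P' :: K, s) = _
  rw [Function.iterate_add_apply, h2, h2']

open Classical in
/-- The effect of a program without loops. (The value is irrelevant for loops.) -/
noncomputable def exec (f : Finset (Fin n) → ℝ) : Cmd → CState → CState
  | .skip, s => s
  | .iset x u, s => (s.1.setI x (u.eval s.1), s.2)
  | .iput a i u, s => (s.1.putI a (i.eval s.1) (u.eval s.1), s.2)
  | .rset x u, s => (s.1.setR x (u.eval s.1), s.2)
  | .rput a i u, s => (s.1.putR a (i.eval s.1) (u.eval s.1), s.2)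
  | .flip x, s => (s.1.setI x (if s.2 0 then 1 else 0), tailCoins s.2)
  | .query x a, s => (s.1.setR x (f (s.1.set n a)), s.2)
  | .seq p q, s => exec f q (exec f p s)
  | .ite b p q, s => if b.Holds s.1 then exec f p s else exec f q s
  | .while _ _, s => s

/-- A bound for the number of steps of a program without loops. -/
def Cmd.size : Cmd → ℕ
  | .seq p q => p.size + q.size + 1
  | .ite _ p q => p.size + q.size + 1
  | _ => 1

/-- Whether the program has no loops. -/
def Cmd.loopFree : Cmd → Bool
  | .seq p q => p.loopFree && q.loopFree
  | .ite _ p q => p.loopFree && q.loopFree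
  | .while _ _ => false
  | _ => true

/-- A program without loops does what `exec` says, whatever commands follow it. -/
theorem exec_spec (P : Cmd) (hP : P.loopFree = true) (s : CState) :
    ∃ k' ≤ P.size, ∀ K, (stepD f)^[k'] (P :: K, s) = (K, exec f P s) := by
  induction P generalizing s with
  | skip => exact ⟨1, le_rfl, fun K => rfl⟩
  | iset x u => exact ⟨1, le_rfl, fun K => rfl⟩
  | iput a i u => exact ⟨1, le_rfl, fun K => rfl⟩
  | rset x u => exact ⟨1, le_rfl, fun K => rfl⟩
  | rput a i u => exact ⟨1, le_rfl, fun K => rfl⟩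
  | flip x => exact ⟨1, le_rfl, fun K => rfl⟩
  | query x a => exact ⟨1, le_rfl, fun K => rfl⟩
  | seq p q ihp ihq =>
    simp only [Cmd.loopFree, Bool.and_eq_true] at hP
    obtain ⟨j, hj, h⟩ := ihp hP.1 s
    obtain ⟨j', hj', h'⟩ := ihq hP.2 (exec f p s)
    refine ⟨j' + j + 1, by simp only [Cmd.size]; omega, fun K => ?_⟩
    rw [Function.iterate_succ_apply]
    change (stepD f)^[j' + j] (p :: q :: K, s) = _
    rw [Function.iterate_add_apply, h, h', exec]
  | ite b p q ihp ihq =>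
    simp only [Cmd.loopFree, Bool.and_eq_true] at hP
    by_cases hb : b.Holds s.1
    · obtain ⟨j, hj, h⟩ := ihp hP.1 s
      refine ⟨j + 1, by simp only [Cmd.size]; omega, fun K => ?_⟩
      rw [Function.iterate_succ_apply]
      have : stepD f (Cmd.ite b p q :: K, s) = (p :: K, s) := by
        obtain ⟨σ, ω⟩ := s
        exact if_pos hb
      rw [this, h, exec, if_pos hb]
    · obtain ⟨j, hj, h⟩ := ihq hP.2 s
      refine ⟨j + 1, by simp only [Cmd.size]; omega, fun K => ?_⟩
      rw [Function.iterate_succ_apply]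
      have : stepD f (Cmd.ite b p q :: K, s) = (q :: K, s) := by
        obtain ⟨σ, ω⟩ := s
        exact if_neg hb
      rw [this, h, exec, if_neg hb]
  | _ => simp [Cmd.loopFree] at hP

theorem Ends.of_exec {P : Cmd} {s : CState} {Q : CState → Prop} (hP : P.loopFree = true)
    (h : Q (exec f P s)) : Ends f P P.size s Q := by
  obtain ⟨k, hk, h'⟩ := exec_spec (f := f) P hP s
  exact ⟨_, h, k, hk, h'⟩

theorem Ends.ite {b : Test} {P P' : Cmd} {k : ℕ} {s : CState} {Q : CState → Prop}
    (h : b.Holds s.1 → Ends f P k s Q) (h' : ¬ b.Holds s.1 → Ends f P' k s Q) :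
    Ends f (.ite b P P') (k + 1) s Q := by
  by_cases hb : b.Holds s.1
  · obtain ⟨s', h1, j, hj, h2⟩ := h hb
    refine ⟨s', h1, j + 1, by omega, fun K => ?_⟩
    rw [Function.iterate_succ_apply]
    have : stepD f (Cmd.ite b P P' :: K, s) = (P :: K, s) := by
      obtain ⟨σ, ω⟩ := s
      exact if_pos hb
    rw [this, h2]
  · obtain ⟨s', h1, j, hj, h2⟩ := h' hb
    refine ⟨s', h1, j + 1, by omega, fun K => ?_⟩
    rw [Function.iterate_succ_apply]
    have : stepD f (Cmd.ite b P P' :: K, s) = (P' :: K, s) := by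
      obtain ⟨σ, ω⟩ := s
      exact if_neg hb
    rw [this, h2]

/-- A loop that ends after at most `m` rounds: `Inv i` holds when `i` rounds may remain. -/
theorem Ends.while {b : Test} {P : Cmd} {k : ℕ} (Inv : ℕ → CState → Prop)
    (hb : ∀ s, Inv 0 s → ¬ b.Holds s.1)
    (hstep : ∀ i s, Inv (i + 1) s → b.Holds s.1 → Ends f P k s fun s' => ∃ j ≤ i, Inv j s') :
    ∀ m s, Inv m s → Ends f (.while b P) (m * (k + 1) + 1) s fun s' =>
      (∃ j, Inv j s') ∧ ¬ b.Holds s'.1 := by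
  have hexit : ∀ (s : CState) K, ¬ b.Holds s.1 → stepD f (Cmd.while b P :: K, s) = (K, s) := by
    intro s K h
    obtain ⟨σ, ω⟩ := s
    exact if_neg h
  have hgo : ∀ (s : CState) K, b.Holds s.1 →
      stepD f (Cmd.while b P :: K, s) = (P :: Cmd.while b P :: K, s) := by
    intro s K h
    obtain ⟨σ, ω⟩ := s
    exact if_pos h
  intro m
  induction m using Nat.strong_induction_on with
  | _ m ih =>
    intro s hs
    by_cases h : b.Holds s.1
    · cases m with
      | zero => exact absurd h (hb s hs)
      | succ i =>
        obtain ⟨s', ⟨j, hj, hI⟩, p, hp, h2⟩ := hstep i s hs h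
        obtain ⟨s'', hQ, p', hp', h2'⟩ := ih j (by omega) s' hI
        refine ⟨s'', hQ, p' + p + 1, ?_, fun K => ?_⟩
        · have : j * (k + 1) ≤ i * (k + 1) := Nat.mul_le_mul_right _ hj
          rw [Nat.succ_mul]
          omega
        · rw [Function.iterate_succ_apply, hgo _ _ h, Function.iterate_add_apply, h2, h2']
    · exact ⟨s, ⟨⟨m, hs⟩, h⟩, 1, by omega, fun K => hexit s K h⟩

/-- `for v = 0, …, N - 1 do P`, where `P` does not change `v` or the value of `N`. -/
def Cmd.for (v : ℕ) (N : IExp) (P : Cmd) : Cmd :=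
  .seq (.iset v (.const 0))
    (.while (.ilt (.var v) N) (.seq P (.iset v (.add (.var v) (.const 1)))))

/-- The rule for counting loops. The invariant `Inv i` describes the state after `i` rounds,
except for the value of the loop variable. -/
theorem Ends.for {v : ℕ} {N : IExp} {P : Cmd} {k : ℕ} {s₀ : CState} (m : ℕ)
    (Inv : ℕ → CState → Prop)
    (hv : P.writes (.iv v) = false)
    (hstab : ∀ i (s : CState) z, Inv i s → Inv i (s.1.setI v z, s.2))
    (h0 : Inv 0 s₀)
    (hN : ∀ s, Frame (Cmd.for v N P) s₀ s → N.eval s.1 = m)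
    (hstep : ∀ i s, i < m → Inv i s → s.1.ivar v = i → Frame (Cmd.for v N P) s₀ s →
      Ends f P k s (Inv (i + 1))) :
    Ends f (Cmd.for v N P) (m * (k + 3) + 3) s₀ (Inv m) := by
  have hw : ∀ l, (Cmd.for v N P).writes l = (decide (l = .iv v) || P.writes l) := by
    intro l
    simp only [Cmd.for, Cmd.writes]
    cases decide (l = Loc.iv v) <;> simp
  have hstart : Ends f (.iset v (.const 0)) 1 s₀ fun s =>
      Inv 0 s ∧ s.1.ivar v = 0 ∧ Frame (Cmd.for v N P) s₀ s := by
    have := Ends.of_exec (f := f) (P := .iset v (.const 0)) (s := s₀)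
      (Q := fun s => Inv 0 s ∧ s.1.ivar v = 0) rfl
      ⟨hstab 0 s₀ _ h0, by simp [exec, Store.setI, IExp.eval]⟩
    refine this.frame.mono le_rfl fun s hs => ⟨hs.1.1, hs.1.2, fun l hl => hs.2 l ?_⟩
    rw [hw, Bool.or_eq_false_iff] at hl
    exact hl.1
  let J : ℕ → CState → Prop := fun r s => ∃ i, i + r = m ∧ Inv i s ∧ s.1.ivar v = i ∧
    Frame (Cmd.for v N P) s₀ s
  have hloop := Ends.while (f := f) (b := .ilt (.var v) N)
    (P := .seq P (.iset v (.add (.var v) (.const 1)))) (k := k + 1 + 1) J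
    (by
      rintro s ⟨i, hi, hI, hvi, hF⟩ hlt
      simp only [Test.Holds, IExp.eval, hN s hF, hvi] at hlt
      omega)
    (by
      rintro r s ⟨i, hi, hI, hvi, hF⟩ hlt
      refine (Ends.seq (hstep i s (by omega) hI hvi hF) fun s' hI' hF' =>
        Ends.of_exec (Q := J r) rfl ?_).mono le_rfl fun s' hs => ⟨r, le_rfl, hs⟩
      have hv' : s'.1.ivar v = i := Eq.trans (hF' (.iv v) hv) hvi
      refine ⟨i + 1, by omega, hstab _ _ _ hI', by simp [exec, Store.setI, IExp.eval, hv'], ?_⟩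
      intro l hl
      have hl' := hl
      rw [hw, Bool.or_eq_false_iff] at hl'
      refine (hF l hl).trans ((hF' l hl'.2).trans ?_)
      have hne := of_decide_eq_false hl'.1
      cases l <;> simp_all [Agree, exec, Store.setI, Function.update])
  refine (Ends.seq hstart fun s hs _ => hloop m s ⟨0, by omega, hs⟩).mono ?_ ?_
  · ring_nf
    omega
  · rintro s ⟨⟨r, i, hi, hI, hvi, hF⟩, hlt⟩
    simp only [Test.Holds, IExp.eval, hN s hF, hvi] at hlt
    obtain rfl : i = m := by omega
    exact hI

end Ends

/-! ### Online execution on a stream of coins -/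

section Online

variable {n : ℕ} (P : Cmd) (c : Fin n → ℝ) (f : ℕ → Finset (Fin n) → ℝ) (B : ℕ → ℕ)

/-- The state after time `t` of the online execution on a stream of coins, if `B t` bounds the
number of steps at time `t + 1`. -/
noncomputable def detOnline : ℕ → (ℕ → Bool) → CState
  | 0, ω => (Store.init c, ω)
  | t + 1, ω => ((stepD (f (t + 1)))^[B t] ([P], detOnline t ω)).2

variable {P c f B}

theorem Ends.iterate {f : Finset (Fin n) → ℝ} {k : ℕ} {s : CState} {Q : CState → Prop}
    (h : Ends f P k s Q) :
    ((stepD f)^[k] ([P], s)).1 = [] ∧ Q ((stepD f)^[k] ([P], s)).2 := by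
  obtain ⟨s', hQ, j, hj, h⟩ := h
  obtain ⟨d, rfl⟩ := Nat.exists_eq_add_of_le' hj
  rw [Function.iterate_add_apply, h [], stepD_nil_iterate]
  exact ⟨rfl, hQ⟩

theorem Ends.haltsWithin {f : Finset (Fin n) → ℝ} {k : ℕ} {σ : Store}
    (h : ∀ ω, Ends f P k (σ, ω) fun _ => True) : HaltsWithin f P σ k := by
  intro x hx
  rw [steps_eq_coins f k k _ le_rfl, PMF.support_map] at hx
  obtain ⟨ω, -, rfl⟩ := hx
  exact (h ω).iterate.1

theorem detOnline_prefix (t : ℕ) (ω : ℕ → Bool) :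
    ∃ l : List Bool, ω = l.foldr consCoins (detOnline P c f B t ω).2 ∧
      ∀ ω', detOnline P c f B t (l.foldr consCoins ω') = ((detOnline P c f B t ω).1, ω') := by
  induction t with
  | zero => exact ⟨[], rfl, fun ω' => rfl⟩
  | succ t ih =>
    obtain ⟨l, h1, h2⟩ := ih
    obtain ⟨l', h1', h2'⟩ := stepD_iterate_prefix (f (t + 1)) (B t) [P]
      (detOnline P c f B t ω).1 (detOnline P c f B t ω).2
    refine ⟨l ++ l', ?_, fun ω' => ?_⟩
    · rw [List.foldr_append, detOnline, ← h1', ← h1]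
    · rw [List.foldr_append, detOnline, h2, h2', detOnline]

/-- If the execution on coin streams respects the step bounds, then so does the random execution,
and it has the same distribution as the execution on a long stream of random coins. -/
theorem onlineRun_bind_eq_coins {T : ℕ}
    (hB : ∀ t < T, ∀ ω, Ends (f (t + 1)) P (B t) (detOnline P c f B t ω) fun _ => True) :
    ∀ t ≤ T, ∀ {β : Type} (Kf : Store → PMF β) (F : Store → (ℕ → Bool) → β) (B' : ℕ),
      (∀ σ ∈ (onlineRun P c f t).support, ∀ L, B' ≤ L → Kf σ = (coins L).map (F σ)) →
      ∀ L, (∑ i ∈ Finset.range t, B i) + B' ≤ L →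
        (onlineRun P c f t).bind Kf = (coins L).map fun ω =>
          F (detOnline P c f B t ω).1 (detOnline P c f B t ω).2 := by
  intro t
  induction t with
  | zero =>
    intro _ β Kf F B' h L hL
    simp only [onlineRun, PMF.pure_bind]
    exact h _ (by simp [onlineRun]) L (by simpa using hL)
  | succ t ih =>
    intro ht β Kf F B' h L hL
    have hdist := ih (by omega) PMF.pure (fun σ _ => σ) 0
      (fun y _ L _ => (PMF.map_const (coins L) y).symm) _ le_rfl
    rw [PMF.bind_pure] at hdist
    have hhalt : ∀ σ ∈ (onlineRun P c f t).support, HaltsWithin (f (t + 1)) P σ (B t) := by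
      intro σ hσ
      rw [hdist, PMF.support_map] at hσ
      obtain ⟨ω, -, rfl⟩ := hσ
      obtain ⟨l, h1, h2⟩ := detOnline_prefix (P := P) (c := c) (f := f) (B := B) t ω
      refine Ends.haltsWithin fun ω' => ?_
      have := hB t (by omega) (l.foldr consCoins ω')
      rwa [h2] at this
    have hsupp : ∀ σ ∈ (onlineRun P c f t).support,
        ∀ y ∈ (steps (f (t + 1)) (B t) ([P], σ)).support,
        y.2 ∈ (onlineRun P c f (t + 1)).support := by
      intro σ hσ y hy
      rw [onlineRun, PMF.mem_support_bind_iff]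
      refine ⟨σ, hσ, ?_⟩
      rw [runToEnd_eq _ (hhalt σ hσ), PMF.support_map]
      exact ⟨y, hy, rfl⟩
    rw [onlineRun, PMF.bind_bind]
    rw [Finset.sum_range_succ, add_assoc] at hL
    refine ih (by omega) _ (fun σ ω => F ((stepD (f (t + 1)))^[B t] ([P], (σ, ω))).2.1
      ((stepD (f (t + 1)))^[B t] ([P], (σ, ω))).2.2) (B t + B') ?_ L hL
    intro σ hσ L hL
    rw [runToEnd_eq _ (hhalt σ hσ), PMF.bind_map]
    rw [steps_bind_eq_coins (f (t + 1)) (Kf ∘ Prod.snd) (fun y ω => F y.2 ω) B' (B t) L _ hL]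
    intro y hy L hL
    exact h _ (hsupp σ hσ y hy) L hL

theorem onlineRun_eq_coins {T : ℕ}
    (hB : ∀ t < T, ∀ ω, Ends (f (t + 1)) P (B t) (detOnline P c f B t ω) fun _ => True)
    {t : ℕ} (ht : t ≤ T) {L : ℕ} (hL : ∑ i ∈ Finset.range t, B i ≤ L) :
    onlineRun P c f t = (coins L).map fun ω => (detOnline P c f B t ω).1 := by
  have hdist := onlineRun_bind_eq_coins hB t ht PMF.pure (fun σ _ => σ) 0
      (fun y _ L _ => (PMF.map_const (coins L) y).symm) L hL
  rwa [PMF.bind_pure] at hdist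

/-- Everything that may happen at time `t + 1` of the random execution happens on some stream. -/
theorem support_onlineRun {T : ℕ}
    (hB : ∀ t < T, ∀ ω, Ends (f (t + 1)) P (B t) (detOnline P c f B t ω) fun _ => True)
    {t : ℕ} (ht : t < T) {σ : Store} (hσ : σ ∈ (onlineRun P c f t).support) :
    HaltsWithin (f (t + 1)) P σ (B t) ∧ ∀ σ' ∈ (runToEnd (f (t + 1)) P σ).support,
      ∃ ω, (detOnline P c f B t ω).1 = σ ∧ (detOnline P c f B (t + 1) ω).1 = σ' := by
  rw [onlineRun_eq_coins hB ht.le le_rfl, PMF.support_map] at hσ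
  obtain ⟨ω, -, rfl⟩ := hσ
  obtain ⟨l, h1, h2⟩ := detOnline_prefix (P := P) (c := c) (f := f) (B := B) t ω
  have hh : HaltsWithin (f (t + 1)) P (detOnline P c f B t ω).1 (B t) := by
    refine Ends.haltsWithin fun ω' => ?_
    have := hB t (by omega) (l.foldr consCoins ω')
    rwa [h2] at this
  refine ⟨hh, fun σ' hσ' => ?_⟩
  rw [runToEnd_eq _ hh, PMF.support_map, steps_eq_coins _ _ _ _ le_rfl, PMF.support_map] at hσ'
  obtain ⟨_, ⟨ω', -, rfl⟩, rfl⟩ := hσ'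
  refine ⟨l.foldr consCoins ω', by rw [h2], ?_⟩
  rw [detOnline, h2]

end Online

/-! ### Averages over coins -/

/-- The average of `F` over streams whose first `L` coins are fair, and whose other coins are
`false`. -/
noncomputable def coinAvg : ℕ → ((ℕ → Bool) → ℝ) → ℝ
  | 0, F => F fun _ => false
  | L + 1, F => (coinAvg L (fun ω => F (consCoins false ω)) +
      coinAvg L fun ω => F (consCoins true ω)) / 2

theorem coins_map_apply_succ {β : Type*} (L : ℕ) (F : (ℕ → Bool) → β) (S : β) :
    (((coins (L + 1)).map F) S).toReal =
      ((((coins L).map fun ω => F (consCoins false ω)) S).toReal +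
        (((coins L).map fun ω => F (consCoins true ω)) S).toReal) / 2 := by
  rw [coins_succ_map, PMF.bind_apply, tsum_bool, PMF.uniformOfFintype_apply,
    PMF.uniformOfFintype_apply, ENNReal.toReal_add, ENNReal.toReal_mul, ENNReal.toReal_mul]
  · simp
    ring
  · exact ENNReal.mul_ne_top (by simp) (PMF.apply_ne_top _ _)
  · exact ENNReal.mul_ne_top (by simp) (PMF.apply_ne_top _ _)

theorem sum_coins_map {β : Type*} [Fintype β] (g : β → ℝ) (L : ℕ) (F : (ℕ → Bool) → β) :
    ∑ S, (((coins L).map F) S).toReal * g S = coinAvg L fun ω => g (F ω) := by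
  classical
  induction L generalizing F with
  | zero =>
    simp only [coins, PMF.pure_map, coinAvg]
    rw [Finset.sum_eq_single (F fun _ => false)]
    · simp [PMF.pure_apply]
    · intro S _ hS
      simp [PMF.pure_apply, hS]
    · simp
  | succ L ih =>
    simp only [coins_map_apply_succ, coinAvg, ← ih, div_mul_eq_mul_div, add_mul]
    rw [← Finset.sum_div, Finset.sum_add_distrib]

/-- The number with binary digits `acc` followed by the first `q` coins. -/
def coinNum : ℕ → ℕ → (ℕ → Bool) → ℕ
  | 0, acc, _ => acc
  | q + 1, acc, ω => coinNum q (acc + acc + (ω 0).toNat) (tailCoins ω)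

/-- The stream without its first `q` coins. -/
def dropCoins : ℕ → (ℕ → Bool) → (ℕ → Bool)
  | 0, ω => ω
  | q + 1, ω => dropCoins q (tailCoins ω)

theorem dropCoins_add (a b : ℕ) (ω : ℕ → Bool) :
    dropCoins (a + b) ω = dropCoins b (dropCoins a ω) := by
  induction a generalizing ω with
  | zero => rw [Nat.zero_add]; rfl
  | succ a ih => rw [Nat.succ_add]; exact ih _

theorem dropCoins_succ (q : ℕ) (ω : ℕ → Bool) :
    dropCoins (q + 1) ω = tailCoins (dropCoins q ω) := dropCoins_add q 1 ω

theorem coinNum_succ (q acc : ℕ) (ω : ℕ → Bool) : coinNum (q + 1) acc ω =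
    coinNum q acc ω + coinNum q acc ω + (dropCoins q ω 0).toNat := by
  induction q generalizing acc ω with
  | zero => rfl
  | succ q ih => rw [coinNum, ih]; rfl

theorem coinNum_lt (q : ℕ) (ω : ℕ → Bool) : coinNum q 0 ω < 2 ^ q := by
  induction q with
  | zero => simp [coinNum]
  | succ q ih =>
    rw [coinNum_succ, pow_succ]
    have := Bool.toNat_lt (dropCoins q ω 0)
    omega

/-- The first `q` coins form a uniformly random number below `2 ^ q`. -/
theorem coinAvg_coinNum_aux (q b acc : ℕ) (H : ℕ → (ℕ → Bool) → ℝ) :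
    coinAvg (q + b) (fun ω => H (coinNum q acc ω) (dropCoins q ω)) =
      (∑ v ∈ Finset.range (2 ^ q), coinAvg b (H (acc * 2 ^ q + v))) / 2 ^ q := by
  induction q generalizing acc with
  | zero => simp [coinNum, dropCoins]
  | succ q ih =>
    rw [Nat.succ_add]
    simp only [coinAvg, coinNum, dropCoins, consCoins_zero, tailCoins_consCoins]
    rw [ih, ih, pow_succ, mul_two, Finset.sum_range_add]
    have h1 : ∀ v, (acc + acc + false.toNat) * 2 ^ q + v =
        acc * (2 ^ q + 2 ^ q) + v := by intro v; simp; ring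
    have h2 : ∀ v, (acc + acc + true.toNat) * 2 ^ q + v =
        acc * (2 ^ q + 2 ^ q) + (2 ^ q + v) := by intro v; simp; ring
    simp only [h1, h2]
    rw [pow_succ]
    field_simp

theorem coinAvg_coinNum (q b : ℕ) (H : ℕ → (ℕ → Bool) → ℝ) :
    coinAvg (q + b) (fun ω => H (coinNum q 0 ω) (dropCoins q ω)) =
      (∑ v ∈ Finset.range (2 ^ q), coinAvg b (H v)) / 2 ^ q := by
  rw [coinAvg_coinNum_aux]
  simp

/-- The `z`-th of a sequence of pairs of `q`-bit numbers that are read off a coin stream. -/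
def coinPair (q z : ℕ) (ω : ℕ → Bool) : ℕ × ℕ :=
  (coinNum q 0 (dropCoins (z * (q + q)) ω), coinNum q 0 (dropCoins (z * (q + q) + q) ω))

theorem coinAvg_const (L : ℕ) (a : ℝ) : coinAvg L (fun _ => a) = a := by
  induction L with
  | zero => rfl
  | succ L ih => simp only [coinAvg, ih]; ring

/-- The pairs read off a coin stream are independent and uniform. -/
theorem coinAvg_coinPair (q B b : ℕ) (H : (Fin B → Fin (2 ^ q) × Fin (2 ^ q)) → ℝ) :
    coinAvg (B * (q + q) + b)
      (fun ω => H fun z => (⟨_, coinNum_lt q (dropCoins (z * (q + q)) ω)⟩,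
        ⟨_, coinNum_lt q (dropCoins (z * (q + q) + q) ω)⟩)) =
      (∑ p, H p) / ((2 ^ q) ^ 2) ^ B := by
  induction B with
  | zero =>
    have : ∀ p : Fin 0 → Fin (2 ^ q) × Fin (2 ^ q), p = finZeroElim :=
      fun p => Subsingleton.elim _ _
    simp only [this, coinAvg_const]
    simp
  | succ B ih =>
    have hL : (B + 1) * (q + q) + b = q + (q + (B * (q + q) + b)) := by ring
    let Y := Fin (2 ^ q) × Fin (2 ^ q)
    have key : ∀ ω : ℕ → Bool,
        (fun z : Fin (B + 1) => ((⟨_, coinNum_lt q (dropCoins (z * (q + q)) ω)⟩,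
        ⟨_, coinNum_lt q (dropCoins (z * (q + q) + q) ω)⟩) : Y)) =
        Fin.cons (⟨_, coinNum_lt q ω⟩, ⟨_, coinNum_lt q (dropCoins q ω)⟩)
          (fun z : Fin B => ((⟨_, coinNum_lt q (dropCoins (z * (q + q))
            (dropCoins q (dropCoins q ω)))⟩,
        ⟨_, coinNum_lt q (dropCoins (z * (q + q) + q) (dropCoins q (dropCoins q ω)))⟩) : Y)) := by
      intro ω
      funext z
      refine Fin.cases ?_ (fun z => ?_) z
      · simp [dropCoins]
      · simp only [Fin.cons_succ, Fin.val_succ, ← dropCoins_add]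
        congr 3 <;> ring_nf
    simp only [key]
    rw [hL]
    -- functions on natural numbers, to which `coinAvg_coinNum` applies
    let H2 : ℕ → ℕ → (ℕ → Bool) → ℝ := fun v u ω =>
      if h : v < 2 ^ q ∧ u < 2 ^ q then
        H (Fin.cons ((⟨v, h.1⟩, ⟨u, h.2⟩) : Y) (fun z : Fin B =>
          ((⟨_, coinNum_lt q (dropCoins (z * (q + q)) ω)⟩,
            ⟨_, coinNum_lt q (dropCoins (z * (q + q) + q) ω)⟩) : Y))) else 0
    have e1 := coinAvg_coinNum q (q + (B * (q + q) + b))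
      (fun v ω => H2 v (coinNum q 0 ω) (dropCoins q ω))
    have e2 := fun v => coinAvg_coinNum q (B * (q + q) + b) (H2 v)
    simp only [e2] at e1
    have hH2 : ∀ ω, H2 (coinNum q 0 ω) (coinNum q 0 (dropCoins q ω))
        (dropCoins q (dropCoins q ω)) = _ :=
      fun ω => dif_pos ⟨coinNum_lt q ω, coinNum_lt q (dropCoins q ω)⟩
    simp only [hH2] at e1
    refine e1.trans ?_
    have e3 : ∀ v u : Fin (2 ^ q), coinAvg (B * (q + q) + b) (H2 v u) =
        (∑ p : Fin B → Y, H (Fin.cons (v, u) p)) / ((2 ^ q) ^ 2) ^ B := by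
      intro v u
      rw [← ih (fun p => H (Fin.cons (v, u) p))]
      congr 1
      funext ω
      exact dif_pos ⟨v.2, u.2⟩
    simp only [Finset.sum_range, e3]
    rw [← (Fin.consEquiv (fun _ : Fin (B + 1) => Y)).sum_comp, Fintype.sum_prod_type,
      Fintype.sum_prod_type]
    have e4 : ∀ x y p, (Fin.consEquiv fun _ : Fin (B + 1) => Y) ((x, y), p) =
        Fin.cons (α := fun _ => Y) (x, y) p := fun _ _ _ => rfl
    simp only [e4]
    simp only [← Finset.sum_div]
    rw [pow_succ ((2 ^ q : ℝ) ^ 2) B]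
    field_simp

/-! ### Submodular functions and the residual cost -/

section SetFun

variable {n : ℕ} {f : Finset (Fin n) → ℝ} {c : Fin n → ℝ}

/-- The elements that come before `l` when the ground set is sorted by cost, with ties broken by
the index. -/
noncomputable def prec (c : Fin n → ℝ) (l : Fin n) : Finset (Fin n) :=
  Finset.univ.filter fun h => c h < c l ∨ (c h = c l ∧ h < l)

theorem mem_prec {l h : Fin n} : h ∈ prec c l ↔ toLex (c h, h) < toLex (c l, l) := by
  simp [prec, Prod.Lex.toLex_lt_toLex]

theorem notMem_prec_self (l : Fin n) : l ∉ prec c l := by simp [mem_prec]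

theorem le_cost_of_mem_prec {l h : Fin n} (hl : h ∈ prec c l) : c h ≤ c l := by
  simp only [prec, Finset.mem_filter, Finset.mem_univ, true_and] at hl
  rcases hl with h | h
  · exact h.le
  · exact h.1.le

theorem mem_prec_trichotomy (l h : Fin n) : h ∈ prec c l ∨ h = l ∨ l ∈ prec c h := by
  rcases lt_trichotomy (toLex (c h, h)) (toLex (c l, l)) with H | H | H
  · exact Or.inl (mem_prec.2 H)
  · refine Or.inr (Or.inl ?_)
    have := congrArg (fun p => (ofLex p).2) H
    exact this
  · exact Or.inr (Or.inr (mem_prec.2 H))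

/-- Induction along the order of the ground set by cost: every initial segment is empty or arises
by adding an element to the set of its predecessors. -/
theorem initial_induction (c : Fin n → ℝ) {p : Finset (Fin n) → Prop} (h0 : p ∅)
    (h1 : ∀ l, p (prec c l) → p (insert l (prec c l))) :
    ∀ s : Finset (Fin n), (∀ l ∈ s, prec c l ⊆ s) → p s := by
  intro s
  induction s using Finset.strongInduction with
  | H s ih =>
    intro hs
    rcases s.eq_empty_or_nonempty with rfl | hne
    · exact h0
    · obtain ⟨l, hl, hmax⟩ := s.exists_max_image (fun h => toLex (c h, h)) hne
      have hseq : s = insert l (prec c l) := by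
        ext h
        rw [Finset.mem_insert]
        constructor
        · intro hh
          rcases mem_prec_trichotomy (c := c) l h with H | H | H
          · exact Or.inr H
          · exact Or.inl H
          · exact absurd (mem_prec.1 H) (not_lt.2 (hmax h hh))
        · rintro (rfl | H)
          · exact hl
          · exact hs l hl H
      have hsub : prec c l ⊂ s := by
        rw [hseq]
        exact Finset.ssubset_insert (notMem_prec_self l)
      rw [hseq]
      refine h1 l (ih _ hsub fun h hh g hg => mem_prec.2 ?_)
      exact (mem_prec.1 hg).trans (mem_prec.1 hh)

theorem prec_initial (l : Fin n) : ∀ h ∈ prec c l, prec c h ⊆ prec c l :=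
  fun _ hh _ hg => mem_prec.2 ((mem_prec.1 hg).trans (mem_prec.1 hh))

theorem sum_prec_telescope (φ : Finset (Fin n) → ℝ) (o : Fin n) :
    ∑ l ∈ prec c o, (φ (insert l (prec c l)) - φ (prec c l)) = φ (prec c o) - φ ∅ := by
  refine initial_induction c (p := fun s =>
    ∑ l ∈ s, (φ (insert l (prec c l)) - φ (prec c l)) = φ s - φ ∅) (by simp) ?_ _
    (prec_initial o)
  intro l ih
  rw [Finset.sum_insert (notMem_prec_self l), ih]
  ring

theorem marginal_nonneg (hm : Monotone f) (j : Fin n) (S : Finset (Fin n)) :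
    0 ≤ marginal f j S :=
  sub_nonneg.2 (hm Finset.subset_union_left)

theorem marginal_eq_zero_of_mem {j : Fin n} {S : Finset (Fin n)} (h : j ∈ S) :
    marginal f j S = 0 := by
  rw [marginal, Finset.union_eq_left.2 (by simpa using h), sub_self]

theorem marginal_antitone (hm : Monotone f) (hs : IsSubmodular f) (j : Fin n) :
    Antitone (marginal f j) := by
  intro S S' h
  by_cases hj : j ∈ S'
  · rw [marginal_eq_zero_of_mem hj]
    exact marginal_nonneg hm j S
  · have := hs (S ∪ {j}) S'
    have e1 : (S ∪ {j}) ∩ S' = S := by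
      rw [Finset.union_inter_distrib_right, Finset.inter_eq_left.2 h,
        Finset.singleton_inter_of_notMem hj, Finset.union_empty]
    have e2 : (S ∪ {j}) ∪ S' = S' ∪ {j} := by
      rw [Finset.union_right_comm, Finset.union_eq_right.2 h]
    rw [e1, e2] at this
    simp only [marginal]
    linarith

theorem eq_of_cover_subset (hm : Monotone f) {O S : Finset (Fin n)} (hO : IsCover f O)
    (h : O ⊆ S) : f S = f Finset.univ :=
  le_antisymm (hm (Finset.subset_univ _)) (hO ▸ hm h)

theorem marginal_eq_zero_of_cover (hm : Monotone f) {O S : Finset (Fin n)} (hO : IsCover f O)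
    (h : O ⊆ S) (j : Fin n) : marginal f j S = 0 := by
  rw [marginal, eq_of_cover_subset hm hO h,
    eq_of_cover_subset hm hO (h.trans Finset.subset_union_left), sub_self]

/-- The third difference of `f`, written out. -/
theorem setDeriv_three {a b d : Fin n} (hab : a ≠ b) (had : a ≠ d) (hbd : b ≠ d)
    {S : Finset (Fin n)} (ha : a ∉ S) (hb : b ∉ S) (hd : d ∉ S) :
    setDeriv f {a, b, d} S = f (S ∪ {a} ∪ {b} ∪ {d}) - f (S ∪ {a} ∪ {b}) - f (S ∪ {a} ∪ {d})
      - f (S ∪ {b} ∪ {d}) + f (S ∪ {a}) + f (S ∪ {b}) + f (S ∪ {d}) - f S := by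
  have p1 : a ∉ ({b, d} : Finset (Fin n)) := by simp [hab, had]
  have p2 : b ∉ ({d} : Finset (Fin n)) := by simp [hbd]
  unfold setDeriv
  rw [Finset.sum_powerset_insert p1, Finset.sum_powerset_insert p2,
    Finset.sum_powerset_insert p2, ← insert_empty_eq d,
    Finset.sum_powerset_insert (Finset.notMem_empty d),
    Finset.sum_powerset_insert (Finset.notMem_empty d),
    Finset.sum_powerset_insert (Finset.notMem_empty d),
    Finset.sum_powerset_insert (Finset.notMem_empty d)]
  simp only [Finset.powerset_empty, Finset.sum_singleton, insert_empty_eq]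
  have q0 : (S ∪ {a, b, d}) \ ∅ = S ∪ {a} ∪ {b} ∪ {d} := by
    ext z; simp
  have q1 : (S ∪ {a, b, d}) \ {d} = S ∪ {a} ∪ {b} := by
    ext z; simp only [Finset.mem_sdiff, Finset.mem_union, Finset.mem_insert,
      Finset.mem_singleton]; grind
  have q2 : (S ∪ {a, b, d}) \ {b} = S ∪ {a} ∪ {d} := by
    ext z; simp only [Finset.mem_sdiff, Finset.mem_union, Finset.mem_insert,
      Finset.mem_singleton]; grind
  have q3 : (S ∪ {a, b, d}) \ {b, d} = S ∪ {a} := by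
    ext z; simp only [Finset.mem_sdiff, Finset.mem_union, Finset.mem_insert,
      Finset.mem_singleton]; grind
  have q4 : (S ∪ {a, b, d}) \ {a} = S ∪ {b} ∪ {d} := by
    ext z; simp only [Finset.mem_sdiff, Finset.mem_union, Finset.mem_insert,
      Finset.mem_singleton]; grind
  have q5 : (S ∪ {a, b, d}) \ {a, d} = S ∪ {b} := by
    ext z; simp only [Finset.mem_sdiff, Finset.mem_union, Finset.mem_insert,
      Finset.mem_singleton]; grind
  have q6 : (S ∪ {a, b, d}) \ {a, b} = S ∪ {d} := by
    ext z; simp only [Finset.mem_sdiff, Finset.mem_union, Finset.mem_insert,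
      Finset.mem_singleton]; grind
  have q7 : (S ∪ {a, b, d}) \ {a, b, d} = S := by
    ext z; simp only [Finset.mem_sdiff, Finset.mem_union, Finset.mem_insert,
      Finset.mem_singleton]; grind
  rw [q0, q1, q2, q3, q4, q5, q6, q7]
  have r1 : ({d} : Finset (Fin n)).card = 1 := rfl
  have r2 : ({b} : Finset (Fin n)).card = 1 := rfl
  have r3 : ({a} : Finset (Fin n)).card = 1 := rfl
  rw [r1, r2, r3, Finset.card_pair hbd, Finset.card_pair had, Finset.card_pair hab,
    Finset.card_eq_three.2 ⟨a, b, d, hab, had, hbd, rfl⟩, Finset.card_empty]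
  ring

/-- For a submodular `3`-increasing function, the marginals are supermodular. -/
theorem marginal_diff_antitone (hm : Monotone f) (hs : IsSubmodular f) (h3 : IsIncreasing 3 f)
    (l a : Fin n) : Antitone fun S => marginal f l S - marginal f l (S ∪ {a}) := by
  have hnn : ∀ S, 0 ≤ marginal f l S - marginal f l (S ∪ {a}) := fun S =>
    sub_nonneg.2 (marginal_antitone hm hs l Finset.subset_union_left)
  have hzero : ∀ S : Finset (Fin n), l ∈ S ∨ a ∈ S →
      marginal f l S - marginal f l (S ∪ {a}) = 0 := by
    rintro S (h | h)
    · rw [marginal_eq_zero_of_mem h, marginal_eq_zero_of_mem (Finset.mem_union_left _ h), sub_self]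
    · rw [Finset.union_eq_left.2 (by simpa using h), sub_self]
  have hstep : ∀ (S : Finset (Fin n)) (b : Fin n), b ∉ S →
      marginal f l (insert b S) - marginal f l (insert b S ∪ {a}) ≤
        marginal f l S - marginal f l (S ∪ {a}) := by
    intro S b hb
    have hins : insert b S = S ∪ {b} := by rw [Finset.union_comm]; rfl
    rw [hins]
    by_cases h1 : l ∈ S ∪ {b} ∨ a ∈ S ∪ {b}
    · rw [hzero _ h1]
      exact hnn S
    · simp only [Finset.mem_union, Finset.mem_singleton, not_or] at h1
      obtain ⟨⟨hlS, hlb⟩, haS, hab⟩ := h1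
      by_cases hla : l = a
      · subst hla
        rw [marginal_eq_zero_of_mem (S := S ∪ {l}) (by simp),
          marginal_eq_zero_of_mem (S := S ∪ {b} ∪ {l}) (by simp)]
        rw [sub_zero, sub_zero]
        exact marginal_antitone hm hs l Finset.subset_union_left
      · have hd := h3 {l, a, b} (Finset.card_eq_three.2 ⟨l, a, b, hla, hlb, hab, rfl⟩) S
        rw [setDeriv_three hla hlb hab hlS haS hb] at hd
        simp only [marginal]
        have e1 : S ∪ {b} ∪ {a} ∪ {l} = S ∪ {l} ∪ {a} ∪ {b} := by
          rw [Finset.union_right_comm S {b}, Finset.union_right_comm (S ∪ {a}),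
            Finset.union_right_comm S {a}]
        rw [e1, Finset.union_right_comm S {b} {l}, Finset.union_right_comm S {b} {a},
          Finset.union_right_comm S {a} {l}]
        linarith
  intro S S' h
  have : ∀ U : Finset (Fin n), Disjoint S U →
      marginal f l (S ∪ U) - marginal f l (S ∪ U ∪ {a}) ≤
        marginal f l S - marginal f l (S ∪ {a}) := by
    intro U
    induction U using Finset.induction_on with
    | empty => intro _; simp
    | insert b U hb ih =>
      intro hd
      rw [Finset.disjoint_insert_right] at hd
      rw [Finset.union_insert]
      exact (hstep _ b (by simp [hd.1, hb])).trans (ih hd.2)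
  have h2 := this (S' \ S) Finset.disjoint_sdiff
  rwa [Finset.union_sdiff_of_subset h] at h2

/-- The residual cost `∑ₗ c(l) f(l ∣ S ∪ {elements before l})` of a set `S`: the integral over the
prices `θ` of the value that is missing when `S` and all elements of cost at most `θ` are bought. -/
noncomputable def resid (f : Finset (Fin n) → ℝ) (c : Fin n → ℝ) (S : Finset (Fin n)) : ℝ :=
  ∑ l, c l * marginal f l (S ∪ prec c l)

/-- The elements bought when `S` is completed to a cover by going through the ground set by
increasing cost. -/
noncomputable def fill (f : Finset (Fin n) → ℝ) (c : Fin n → ℝ) (S : Finset (Fin n)) :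
    Finset (Fin n) :=
  Finset.univ.filter fun l => 0 < marginal f l (S ∪ prec c l)

/-- The largest value of a singleton, relative to the empty set. -/
noncomputable def maxSingle (f : Finset (Fin n) → ℝ) : ℝ :=
  Finset.univ.fold max 0 fun j => marginal f j ∅

theorem marginal_le_maxSingle (hm : Monotone f) (hs : IsSubmodular f) (j : Fin n)
    (S : Finset (Fin n)) : marginal f j S ≤ maxSingle f :=
  (marginal_antitone hm hs j (Finset.empty_subset S)).trans
    ((Finset.le_fold_max _).2 (Or.inr ⟨j, Finset.mem_univ j, le_rfl⟩))

theorem maxSingle_nonneg : 0 ≤ maxSingle f := (Finset.le_fold_max _).2 (Or.inl le_rfl)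

theorem resid_nonneg (hm : Monotone f) (hc : ∀ j, 0 ≤ c j) (S : Finset (Fin n)) :
    0 ≤ resid f c S :=
  Finset.sum_nonneg fun l _ => mul_nonneg (hc l) (marginal_nonneg hm _ _)

theorem resid_antitone (hm : Monotone f) (hs : IsSubmodular f) (hc : ∀ j, 0 ≤ c j) :
    Antitone (resid f c) := fun _ _ h =>
  Finset.sum_le_sum fun l _ => mul_le_mul_of_nonneg_left
    (marginal_antitone hm hs l (Finset.union_subset_union_left h)) (hc l)

theorem resid_eq_zero (hm : Monotone f) {O S : Finset (Fin n)} (hO : IsCover f O) (h : O ⊆ S) :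
    resid f c S = 0 :=
  Finset.sum_eq_zero fun l _ => by
    rw [marginal_eq_zero_of_cover hm hO (h.trans Finset.subset_union_left), mul_zero]

theorem resid_diff_antitone (hm : Monotone f) (hs : IsSubmodular f) (h3 : IsIncreasing 3 f)
    (hc : ∀ j, 0 ≤ c j) (a : Fin n) :
    Antitone fun S => resid f c S - resid f c (S ∪ {a}) := by
  intro S S' h
  simp only [resid, ← Finset.sum_sub_distrib, ← mul_sub]
  refine Finset.sum_le_sum fun l _ => mul_le_mul_of_nonneg_left ?_ (hc l)
  have := marginal_diff_antitone hm hs h3 l a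
    (Finset.union_subset_union_left (t := prec c l) h)
  simpa only [Finset.union_right_comm _ _ {a}] using this

/-- Telescoping over the elements of `O`, since the residual cost is supermodular. -/
theorem resid_sub_union_le (hm : Monotone f) (hs : IsSubmodular f) (h3 : IsIncreasing 3 f)
    (hc : ∀ j, 0 ≤ c j) (S O : Finset (Fin n)) :
    resid f c S - resid f c (S ∪ O) ≤ ∑ o ∈ O, (resid f c S - resid f c (S ∪ {o})) := by
  induction O using Finset.induction_on with
  | empty => simp
  | insert o O ho ih =>
    rw [Finset.sum_insert ho]
    have h := resid_diff_antitone hm hs h3 hc o (Finset.subset_union_left (s₁ := S) (s₂ := O))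
    have e : S ∪ insert o O = S ∪ O ∪ {o} := by
      rw [Finset.union_assoc, Finset.union_comm O]; rfl
    rw [e]
    simp only at h
    linarith

/-- A cover gains, in total, the whole residual cost. -/
theorem resid_le_sum_cover (hm : Monotone f) (hs : IsSubmodular f) (h3 : IsIncreasing 3 f)
    (hc : ∀ j, 0 ≤ c j) {O : Finset (Fin n)} (hO : IsCover f O) (S : Finset (Fin n)) :
    resid f c S ≤ ∑ o ∈ O, (resid f c S - resid f c (S ∪ {o})) := by
  have := resid_sub_union_le hm hs h3 hc S O
  rwa [resid_eq_zero hm hO Finset.subset_union_right, sub_zero] at this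

/-- When `o` is bought first, every element before `o` loses some value to `o`. The lost values add
up to what `o` itself has lost when its turn comes, and are charged at a lower price. -/
theorem resid_empty_sub_singleton_le (hm : Monotone f) (hs : IsSubmodular f)
    (hc : ∀ j, 0 ≤ c j) (o : Fin n) :
    resid f c ∅ - resid f c (∅ ∪ {o}) ≤ c o * marginal f o ∅ := by
  simp only [resid, ← Finset.sum_sub_distrib, ← mul_sub, Finset.empty_union]
  have hins : ∀ l, insert l (prec c l) = prec c l ∪ {l} := fun l => by
    rw [Finset.union_comm]; rfl
  -- elements before `o` exchange their gain with `o`, and later elements lose nothing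
  have hterm : ∀ l, c l * (marginal f l (prec c l) - marginal f l ({o} ∪ prec c l)) ≤
      (if l = o then c o * marginal f o (prec c o) else 0) +
      if l ∈ prec c o then
        c o * (marginal f o (prec c l) - marginal f o (insert l (prec c l))) else 0 := by
    intro l
    rcases mem_prec_trichotomy (c := c) o l with H | H | H
    · have hlo : l ≠ o := by rintro rfl; exact notMem_prec_self _ H
      rw [if_neg hlo, if_pos H, zero_add]
      have e : marginal f l (prec c l) - marginal f l ({o} ∪ prec c l) =
          marginal f o (prec c l) - marginal f o (insert l (prec c l)) := by
        rw [hins]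
        simp only [marginal]
        rw [Finset.union_comm {o}, Finset.union_right_comm _ {o}]
        ring
      rw [e]
      refine mul_le_mul_of_nonneg_right (le_cost_of_mem_prec H) (sub_nonneg.2 ?_)
      exact marginal_antitone hm hs o (Finset.subset_insert _ _)
    · subst H
      rw [if_pos rfl, if_neg (notMem_prec_self l), add_zero,
        marginal_eq_zero_of_mem (S := {l} ∪ prec c l) (by simp), sub_zero]
    · have hlo : l ≠ o := by rintro rfl; exact notMem_prec_self _ H
      have h2 : l ∉ prec c o := fun H' =>
        lt_asymm (mem_prec.1 H) (mem_prec.1 H')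
      rw [if_neg hlo, if_neg h2, Finset.union_eq_right.2 (by simpa using H)]
      simp
  refine (Finset.sum_le_sum fun l _ => hterm l).trans ?_
  rw [Finset.sum_add_distrib, Finset.sum_ite_eq' Finset.univ o, if_pos (Finset.mem_univ o),
    ← Finset.sum_filter, Finset.filter_mem_eq_inter, Finset.univ_inter, ← Finset.mul_sum]
  have := sum_prec_telescope (c := c) (fun S => - marginal f o S) o
  simp only [neg_sub_neg] at this
  rw [this]
  have := hc o
  exact le_of_eq (by ring)

/-- The residual cost of the empty set is at most the optimum times the largest singleton. This
fixes the scale of the thresholds for small marginals. -/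
theorem resid_empty_le (hm : Monotone f) (hs : IsSubmodular f) (h3 : IsIncreasing 3 f)
    (hc : ∀ j, 0 ≤ c j) {O : Finset (Fin n)} (hO : IsCover f O) :
    resid f c ∅ ≤ maxSingle f * cost c O := by
  refine (resid_le_sum_cover hm hs h3 hc hO ∅).trans ?_
  rw [cost, Finset.mul_sum]
  refine Finset.sum_le_sum fun o _ => (resid_empty_sub_singleton_le hm hs hc o).trans ?_
  rw [mul_comm]
  exact mul_le_mul_of_nonneg_right (marginal_le_maxSingle hm hs o ∅) (hc o)

/-- Elements with marginal zero at their turn may be skipped, since marginals of submodular functions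
are antitone: going through the ground set, the bought elements keep the value of all elements. -/
theorem isCover_union_fill (hm : Monotone f) (hs : IsSubmodular f) (c : Fin n → ℝ)
    (S : Finset (Fin n)) : IsCover f (S ∪ fill f c S) := by
  have key := initial_induction c (p := fun s => f (S ∪ s) ≤ f (S ∪ (fill f c S ∩ s)))
    (by simp) (by
      intro l ih
      have hins : insert l (prec c l) = prec c l ∪ {l} := by rw [Finset.union_comm]; rfl
      have hsub : S ∪ (fill f c S ∩ prec c l) ⊆ S ∪ prec c l :=
        Finset.union_subset_union_right Finset.inter_subset_right
      by_cases hl : l ∈ fill f c S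
      · have h1 := marginal_antitone hm hs l hsub
        rw [Finset.inter_insert_of_mem hl]
        have e : S ∪ insert l (fill f c S ∩ prec c l) = S ∪ (fill f c S ∩ prec c l) ∪ {l} := by
          rw [Finset.union_assoc, Finset.union_comm (_ ∩ _)]; rfl
        rw [e, hins, ← Finset.union_assoc]
        simp only [marginal] at h1
        linarith
      · have h0 : marginal f l (S ∪ prec c l) = 0 := by
          refine le_antisymm (not_lt.1 fun h => hl ?_) (marginal_nonneg hm _ _)
          simpa [fill] using h
        rw [Finset.inter_insert_of_notMem hl, hins, ← Finset.union_assoc]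
        rw [marginal] at h0
        linarith)
    Finset.univ (fun _ _ => Finset.subset_univ _)
  rw [Finset.inter_univ, Finset.union_eq_right.2 (Finset.subset_univ S)] at key
  exact le_antisymm (hm (Finset.subset_univ _)) key

/-- An element `l` with a positive marginal comes no later than the last element of any cover. -/
theorem le_cost_of_mem_fill (hm : Monotone f) (hc : ∀ j, 0 ≤ c j) {O S : Finset (Fin n)}
    (hO : IsCover f O) {l : Fin n} (hl : l ∈ fill f c S) : c l ≤ cost c O := by
  have h : ¬ O ⊆ S ∪ prec c l := fun h => by
    have := (Finset.mem_filter.1 hl).2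
    rw [marginal_eq_zero_of_cover hm hO h] at this
    exact lt_irrefl _ this
  obtain ⟨o, ho, ho'⟩ := Finset.not_subset.1 h
  have hlo : c l ≤ c o := by
    rcases mem_prec_trichotomy (c := c) l o with H | H | H
    · exact absurd (Finset.mem_union_right _ H) ho'
    · rw [H]
    · exact le_cost_of_mem_prec H
  exact hlo.trans (Finset.single_le_sum (fun j _ => hc j) ho)

/-- If no positive marginal below `m` is met, then completing `S` costs at most the residual cost
divided by `m`. -/
theorem cost_fill_mul_le (hm : Monotone f) (hc : ∀ j, 0 ≤ c j) {S : Finset (Fin n)} {m : ℝ}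
    (h : ∀ l, 0 < marginal f l (S ∪ prec c l) → m ≤ marginal f l (S ∪ prec c l)) :
    cost c (fill f c S) * m ≤ resid f c S := by
  rw [cost, Finset.sum_mul, fill, Finset.sum_filter]
  refine Finset.sum_le_sum fun l _ => ?_
  split_ifs with hl
  · exact mul_le_mul_of_nonneg_left (h l hl) (hc l)
  · exact mul_nonneg (hc l) (marginal_nonneg hm _ _)

theorem cost_nonneg (hc : ∀ j, 0 ≤ c j) (S : Finset (Fin n)) : 0 ≤ cost c S :=
  Finset.sum_nonneg fun j _ => hc j

theorem cost_mono (hc : ∀ j, 0 ≤ c j) {S S' : Finset (Fin n)} (h : S ⊆ S') :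
    cost c S ≤ cost c S' :=
  Finset.sum_le_sum_of_subset_of_nonneg h fun j _ _ => hc j

theorem cost_union_le (hc : ∀ j, 0 ≤ c j) (S S' : Finset (Fin n)) :
    cost c (S ∪ S') ≤ cost c S + cost c S' := by
  rw [cost, cost, cost, ← Finset.sum_union_inter]
  exact le_add_of_nonneg_right (Finset.sum_nonneg fun j _ => hc j)

end SetFun

/-! ### Fractional updates -/

section Fractional

variable {n : ℕ} (f : Finset (Fin n) → ℝ) (c : Fin n → ℝ) (D : ℕ)

/-- The elements that the fractional solution `x` buys entirely. -/
noncomputable def sat (x : Fin n → ℝ) : Finset (Fin n) := Finset.univ.filter fun j => 1 ≤ x j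

/-- The decrease of the residual cost when `j` is added to `S`. -/
noncomputable def gain (S : Finset (Fin n)) (j : Fin n) : ℝ :=
  resid f c S - resid f c (S ∪ {j})

/-- The covering constraint of the set `S`, with its right hand side halved, fails for `x`. -/
def Violated (x : Fin n → ℝ) (S : Finset (Fin n)) : Prop :=
  ∑ j, gain f c S j * x j + ∑ j, gain f c S j * x j < resid f c S

/-- The largest gain per cost. -/
noncomputable def maxRatio (S : Finset (Fin n)) : ℝ :=
  Finset.univ.fold max 0 fun j => gain f c S j / c j

/-- The multiplicative update of `x` for the violated constraint of `S`. The step size is the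
largest for which no `x j + 1 / D` is more than doubled. -/
noncomputable def bump (x : Fin n → ℝ) (S : Finset (Fin n)) (j : Fin n) : ℝ :=
  x j + gain f c S j / c j / maxRatio f c S * (x j + 1 / D)

/-- The range in which fractional solutions stay: free elements are bought, and `x j` is bounded. -/
structure InRange (x : Fin n → ℝ) : Prop where
  nonneg : ∀ j, 0 ≤ x j
  free : ∀ j, c j = 0 → x j = 1
  le : ∀ j, x j + 1 / D ≤ 2 * (1 + 1 / D)

/-- `x'` arises from `x` by `k` updates, as far as the two potential functions can tell: the
cost is paid for by the increase of `∑_{j ∈ O} c(j) ln (x j + 1 / D)`, and every update doubles some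
`x j + 1 / D`. -/
structure Progress (O : Finset (Fin n)) (x x' : Fin n → ℝ) (k : ℕ) : Prop where
  inRange : InRange c D x'
  le : ∀ j, x j ≤ x' j
  pays : ∑ j, c j * x' j - ∑ j, c j * x j ≤
    2 * ∑ j ∈ O, c j * (Real.log (x' j + 1 / D) - Real.log (x j + 1 / D))
  prod : (∏ j, (x j + 1 / (D : ℝ))) * 2 ^ k ≤ ∏ j, (x' j + 1 / (D : ℝ))
  eq : k = 0 → x' = x

variable {f c D}

theorem Progress.refl {O : Finset (Fin n)} {x : Fin n → ℝ} (h : InRange c D x) :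
    Progress c D O x x 0 :=
  ⟨h, fun _ => le_rfl, by simp, by simp, fun _ => rfl⟩

theorem Progress.trans {O : Finset (Fin n)} {x x' x'' : Fin n → ℝ} {k k' : ℕ}
    (h : Progress c D O x x' k) (h' : Progress c D O x' x'' k') :
    Progress c D O x x'' (k + k') := by
  refine ⟨h'.inRange, fun j => (h.le j).trans (h'.le j), ?_, ?_, fun hk => ?_⟩
  · have h1 := h.pays
    have h2 := h'.pays
    simp only [mul_sub, Finset.sum_sub_distrib] at h1 h2 ⊢
    linarith
  · rw [pow_add, ← mul_assoc]
    exact (mul_le_mul_of_nonneg_right h.prod (by positivity)).trans h'.prod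
  · rw [h'.eq (by omega), h.eq (by omega)]

theorem gain_nonneg (hm : Monotone f) (hs : IsSubmodular f) (hc : ∀ j, 0 ≤ c j)
    (S : Finset (Fin n)) (j : Fin n) : 0 ≤ gain f c S j :=
  sub_nonneg.2 (resid_antitone hm hs hc Finset.subset_union_left)

theorem gain_eq_zero {S : Finset (Fin n)} {j : Fin n} (h : j ∈ S) : gain f c S j = 0 := by
  rw [gain, Finset.union_eq_left.2 (by simpa using h), sub_self]

theorem gain_le (hm : Monotone f) (hc : ∀ j, 0 ≤ c j) (S : Finset (Fin n)) (j : Fin n) :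
    gain f c S j ≤ resid f c S :=
  sub_le_self _ (resid_nonneg hm hc _)

theorem half_le_log_one_add {y : ℝ} (h0 : 0 ≤ y) (h1 : y ≤ 1) : y / 2 ≤ Real.log (1 + y) := by
  refine le_trans ?_ (Real.one_sub_inv_le_log_of_pos (by linarith))
  have : 1 - (1 + y)⁻¹ = y / (1 + y) := by field_simp; ring
  rw [this]
  exact div_le_div_of_nonneg_left h0 (by linarith) (by linarith)

/-- The effect of an update on the potential functions. -/
theorem progress_bump (hm : Monotone f) (hs : IsSubmodular f) (h3 : IsIncreasing 3 f)
    (hc : ∀ j, 0 ≤ c j) (hD : 4 * n ≤ D) (hD1 : 1 ≤ D) {O : Finset (Fin n)} (hO : IsCover f O)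
    {x : Fin n → ℝ} (hx : InRange c D x) {S : Finset (Fin n)} (hS : sat x ⊆ S)
    (hv : Violated f c x S) : Progress c D O x (bump f c D x S) 1 := by
  set δ : ℝ := 1 / D with hδ
  have hDpos : (0 : ℝ) < D := by exact_mod_cast hD1
  have hδpos : 0 < δ := by positivity
  have hnδ : n * δ ≤ 1 / 4 := by
    rw [hδ, mul_one_div, div_le_iff₀ hDpos]
    have : (4 * n : ℝ) ≤ D := by exact_mod_cast hD
    linarith
  have hg := gain_nonneg hm hs hc S
  set b := resid f c S with hb
  have hsum : 0 ≤ ∑ j, gain f c S j * x j :=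
    Finset.sum_nonneg fun j _ => mul_nonneg (hg j) (hx.nonneg j)
  have hbpos : 0 < b := by unfold Violated at hv; linarith
  have hcov := resid_le_sum_cover hm hs h3 hc hO S
  -- free elements lie in `S`, so that the division by their cost does no harm
  have hfree : ∀ j, c j = 0 → gain f c S j = 0 := fun j hj =>
    gain_eq_zero (hS (by simp [sat, hx.free j hj]))
  set r := maxRatio f c S with hr
  have hratio : ∀ j, gain f c S j / c j ≤ r := fun j =>
    (Finset.le_fold_max _).2 (Or.inr ⟨j, Finset.mem_univ j, le_rfl⟩)
  have hrpos : 0 < r := by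
    have : ∃ o ∈ O, 0 < gain f c S o := by
      by_contra! hcon
      exact absurd (hbpos.trans_le (hcov.trans (Finset.sum_nonpos hcon))) (lt_irrefl _)
    obtain ⟨o, -, ho⟩ := this
    have hco : 0 < c o := lt_of_le_of_ne (hc o) fun h => by
      rw [hfree o h.symm] at ho; exact lt_irrefl _ ho
    exact (div_pos ho hco).trans_le (hratio o)
  let y : Fin n → ℝ := fun j => gain f c S j / c j / r
  have hy0 : ∀ j, 0 ≤ y j := fun j => div_nonneg (div_nonneg (hg j) (hc j)) hrpos.le
  have hy1 : ∀ j, y j ≤ 1 := fun j => (div_le_one hrpos).2 (hratio j)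
  have hbump : ∀ j, bump f c D x S j + δ = (1 + y j) * (x j + δ) := fun j => by
    simp only [bump, y, ← hδ, ← hr]; ring
  have hxδ : ∀ j, 0 < x j + δ := fun j => by have := hx.nonneg j; linarith
  have hle : ∀ j, x j ≤ bump f c D x S j := fun j => by
    have h1 := hbump j
    nlinarith [mul_nonneg (hy0 j) (hxδ j).le]
  have hcy : ∀ j, c j * y j = gain f c S j / r := fun j => by
    rcases (hc j).eq_or_lt with h | h
    · rw [hfree j h.symm, ← h]; simp
    · simp only [y]; field_simp
  have heqS : ∀ j ∈ S, bump f c D x S j = x j := fun j hj => by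
    rw [bump, gain_eq_zero hj]; simp
  refine ⟨⟨fun j => (hx.nonneg j).trans (hle j), fun j hj => ?_, fun j => ?_⟩, hle, ?_, ?_,
    by simp⟩
  · rw [heqS j (hS (by simp [sat, hx.free j hj])), hx.free j hj]
  · by_cases hj : j ∈ S
    · rw [heqS j hj]; exact hx.le j
    · have hx1 : x j < 1 := by
        by_contra! hcon
        exact hj (hS (by simpa [sat] using hcon))
      rw [← hδ, hbump]
      exact mul_le_mul (by linarith [hy1 j]) (by linarith) (hxδ j).le (by norm_num)
  · have e1 : ∑ j, c j * bump f c D x S j - ∑ j, c j * x j =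
        (∑ j, gain f c S j * x j + δ * ∑ j, gain f c S j) / r := by
      rw [← Finset.sum_sub_distrib, Finset.mul_sum, ← Finset.sum_add_distrib, Finset.sum_div]
      refine Finset.sum_congr rfl fun j _ => ?_
      have h1 : c j * bump f c D x S j - c j * x j = (c j * y j) * (x j + δ) := by
        linear_combination c j * hbump j
      rw [h1, hcy]
      ring
    have e2 : ∑ j, gain f c S j ≤ n * b := by
      refine (Finset.sum_le_sum fun j _ => gain_le hm hc S j).trans ?_
      simp [← hb]
    -- the violated constraint bounds the first sum by `b / 2`, and the second is at most `b / 4`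
    have e3 : ∑ j, c j * bump f c D x S j - ∑ j, c j * x j ≤ b / r := by
      rw [e1]
      refine div_le_div_of_nonneg_right ?_ hrpos.le
      have h1 : δ * ∑ j, gain f c S j ≤ δ * (n * b) := mul_le_mul_of_nonneg_left e2 hδpos.le
      have h2 : n * δ * b ≤ 1 / 4 * b := mul_le_mul_of_nonneg_right hnδ hbpos.le
      unfold Violated at hv
      linarith
    refine e3.trans ?_
    have e4 : b / r ≤ ∑ o ∈ O, c o * y o := by
      simp only [hcy, ← Finset.sum_div]
      exact div_le_div_of_nonneg_right hcov hrpos.le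
    refine e4.trans ?_
    rw [Finset.mul_sum]
    refine Finset.sum_le_sum fun j _ => ?_
    rw [← hδ, hbump, Real.log_mul (by linarith [hy0 j]) (hxδ j).ne']
    have := mul_le_mul_of_nonneg_left (half_le_log_one_add (hy0 j) (hy1 j)) (hc j)
    linarith
  · -- the element with the largest ratio is doubled
    obtain ⟨j, hj⟩ : ∃ j, r ≤ gain f c S j / c j := by
      rcases (Finset.le_fold_max r).1 (le_refl r) with h | ⟨j, -, h⟩
      · exact absurd hrpos (not_lt.2 h)
      · exact ⟨j, h⟩
    have hyj : y j = 1 := le_antisymm (hy1 j) ((one_le_div hrpos).2 hj)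
    simp only [← hδ, hbump]
    rw [Finset.prod_mul_distrib, pow_one, mul_comm]
    refine mul_le_mul_of_nonneg_right ?_ (Finset.prod_nonneg fun j _ => (hxδ j).le)
    have h2 : ∏ i : Fin n, (if i = j then (2 : ℝ) else 1) = 2 := by
      rw [Finset.prod_ite_eq']; simp
    rw [← h2]
    refine Finset.prod_le_prod (fun i _ => by split_ifs <;> norm_num) fun i _ => ?_
    split_ifs with h
    · rw [h, hyj]; norm_num
    · linarith [hy0 i]

end Fractional

/-! ### The online algorithm -/

section Algorithm

variable {n : ℕ}

/-- The effect of the layer `y = (j, u)` on the rounded solution: `j` is added if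
`u + 1 ≤ D * x j`. (Nothing happens if `j` is not below `n`.) -/
noncomputable def pick (D : ℕ) (x : Fin n → ℝ) (y : ℕ × ℕ) : Finset (Fin n) :=
  Finset.univ.filter fun j => j.val = y.1 ∧ (y.2 : ℝ) + 1 ≤ D * x j

theorem mem_pick {D : ℕ} {x : Fin n → ℝ} {y : ℕ × ℕ} {j : Fin n} :
    j ∈ pick D x y ↔ j.val = y.1 ∧ (y.2 : ℝ) + 1 ≤ D * x j := by
  simp [pick]

/-- The state of a pass along a path: the fractional solution, the rounded solution, and the number
of updates so far. -/
structure Work (n : ℕ) where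
  x : Fin n → ℝ
  R : Finset (Fin n)
  cnt : ℕ

section Pass

variable (f : Finset (Fin n) → ℝ) (c : Fin n → ℝ) (D : ℕ)

open Classical in
/-- Process one layer: check the constraint of the current rounded solution, update the fractional
solution if the constraint is violated, and let the layer act on the rounded solution. -/
noncomputable def layerStep (p : Work n) (y : ℕ × ℕ) : Work n :=
  let S := p.R ∪ sat p.x
  let x' := if Violated f c p.x S then bump f c D p.x S else p.x
  ⟨x', S ∪ pick D x' y, if Violated f c p.x S then p.cnt + 1 else p.cnt⟩

/-- Process the first `k` layers of a path. -/
noncomputable def pass (x : Fin n → ℝ) (y : ℕ → ℕ × ℕ) : ℕ → Work n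
  | 0 => ⟨x, ∅, 0⟩
  | k + 1 => layerStep f c D (pass x y k) (y k)

/-- The rounded solution after `k` layers, if the fractional solution stays fixed. -/
noncomputable def layers (D : ℕ) (x : Fin n → ℝ) (y : ℕ → ℕ × ℕ) : ℕ → Finset (Fin n)
  | 0 => ∅
  | k + 1 => layers D x y k ∪ sat x ∪ pick D x (y k)

variable {f c D}

theorem pass_progress (hm : Monotone f) (hs : IsSubmodular f) (h3 : IsIncreasing 3 f)
    (hc : ∀ j, 0 ≤ c j) (hD : 4 * n ≤ D) (hD1 : 1 ≤ D) {O : Finset (Fin n)} (hO : IsCover f O)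
    {x : Fin n → ℝ} (hx : InRange c D x) (y : ℕ → ℕ × ℕ) (k : ℕ) :
    Progress c D O x (pass f c D x y k).x (pass f c D x y k).cnt := by
  induction k with
  | zero => exact Progress.refl hx
  | succ k ih =>
    by_cases h : Violated f c (pass f c D x y k).x ((pass f c D x y k).R ∪ sat (pass f c D x y k).x)
    · have := ih.trans (progress_bump hm hs h3 hc hD hD1 hO ih.inRange
        Finset.subset_union_right h)
      simpa only [pass, layerStep, if_pos h] using this
    · simpa only [pass, layerStep, if_neg h] using ih

/-- A pass without updates leaves the fractional solution alone, computes the rounded solution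
`layers`, and has found no violated constraint. -/
theorem pass_of_cnt_eq_zero {x : Fin n → ℝ} {y : ℕ → ℕ × ℕ} {k : ℕ}
    (h : (pass f c D x y k).cnt = 0) :
    (pass f c D x y k).x = x ∧ (pass f c D x y k).R = layers D x y k ∧
      ∀ i < k, ¬ Violated f c x (layers D x y i ∪ sat x) := by
  induction k with
  | zero => exact ⟨rfl, rfl, by simp⟩
  | succ k ih =>
    by_cases hv : Violated f c (pass f c D x y k).x
        ((pass f c D x y k).R ∪ sat (pass f c D x y k).x)
    · simp [pass, layerStep, hv] at h
    · simp only [pass, layerStep, if_neg hv] at h ⊢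
      obtain ⟨h1, h2, h3⟩ := ih h
      rw [h1, h2] at hv
      refine ⟨h1, by rw [h1, h2]; rfl, fun i hi => ?_⟩
      rcases Nat.lt_succ_iff_lt_or_eq.1 hi with hi | rfl
      · exact h3 i hi
      · exact hv

theorem pass_congr {x : Fin n → ℝ} {y y' : ℕ → ℕ × ℕ} {k : ℕ} (h : ∀ i < k, y i = y' i) :
    pass f c D x y k = pass f c D x y' k := by
  induction k with
  | zero => rfl
  | succ k ih =>
    rw [pass, pass, ih fun i hi => h i (by omega), h k (by omega)]

theorem layers_congr {x : Fin n → ℝ} {y y' : ℕ → ℕ × ℕ} {k : ℕ} (h : ∀ i < k, y i = y' i) :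
    layers D x y k = layers D x y' k := by
  induction k with
  | zero => rfl
  | succ k ih =>
    rw [layers, layers, ih fun i hi => h i (by omega), h k (by omega)]

theorem sat_mono {x x' : Fin n → ℝ} (h : ∀ j, x j ≤ x' j) : sat x ⊆ sat x' :=
  Finset.monotone_filter_right _ fun j _ hj => le_trans hj (h j)

theorem pick_mono {x x' : Fin n → ℝ} (h : ∀ j, x j ≤ x' j) (y : ℕ × ℕ) :
    pick D x y ⊆ pick D x' y :=
  Finset.monotone_filter_right _ fun j _ hj =>
    ⟨hj.1, hj.2.trans (mul_le_mul_of_nonneg_left (h j) (Nat.cast_nonneg D))⟩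

/-- Rounded solutions grow with the fractional solution and with the number of layers. -/
theorem layers_mono {x x' : Fin n → ℝ} (h : ∀ j, x j ≤ x' j) (y : ℕ → ℕ × ℕ) {k k' : ℕ}
    (hk : k ≤ k') : layers D x y k ⊆ layers D x' y k' := by
  have h1 : layers D x y k ⊆ layers D x' y k := by
    induction k with
    | zero => exact Finset.Subset.refl _
    | succ k ih =>
      exact Finset.union_subset_union (Finset.union_subset_union (ih (by omega)) (sat_mono h))
        (pick_mono h _)
  refine h1.trans ?_
  clear h1
  induction k', hk using Nat.le_induction with
  | base => exact Finset.Subset.refl _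
  | succ k' _ ih =>
    exact ih.trans (Finset.subset_union_left.trans Finset.subset_union_left)

/-- Only elements with `x j ≥ 1 / D` are ever bought by rounding, so that the rounded solution costs at
most `D` times as much as the fractional one. -/
theorem le_of_mem_layers (hD1 : 1 ≤ D) {x : Fin n → ℝ} {y : ℕ → ℕ × ℕ} {k : ℕ} {j : Fin n}
    (hj : j ∈ layers D x y k) : 1 ≤ D * x j := by
  have hD' : (1 : ℝ) ≤ D := by exact_mod_cast hD1
  induction k with
  | zero => simp [layers] at hj
  | succ k ih =>
    simp only [layers, Finset.mem_union] at hj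
    rcases hj with (hj | hj) | hj
    · exact ih hj
    · have : 1 ≤ x j := by simpa [sat] using hj
      nlinarith
    · have := (Finset.mem_filter.1 hj).2.2
      have h0 : (0 : ℝ) ≤ (y k).2 := Nat.cast_nonneg _
      linarith

end Pass

/-- The state of the algorithm: the fractional solution, the number of stages of each path, and
the number of updates that each path has caused. -/
@[ext]
structure RunState (n : ℕ) where
  x : Fin n → ℝ
  s : ℕ → ℕ
  cnt : ℕ → ℕ

section Run

/-- The bound below which a positive marginal makes a path with `s` stages too short, at
time `t`. -/
noncomputable def threshold (f : Finset (Fin n) → ℝ) (t s : ℕ) : ℝ :=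
  maxSingle f * t * t * (9 / 10) ^ s

/-- Completing `R` to a cover meets a positive marginal below the threshold. -/
def Small (f : Finset (Fin n) → ℝ) (c : Fin n → ℝ) (t s : ℕ) (R : Finset (Fin n)) : Prop :=
  ∃ l, 0 < marginal f l (R ∪ prec c l) ∧ marginal f l (R ∪ prec c l) < threshold f t s

variable (f : Finset (Fin n) → ℝ) (c : Fin n → ℝ) (D M t : ℕ) (w : ℕ → ℕ → ℕ × ℕ)

open Classical in
/-- Process the path `i`, and give it another stage if it is too short. -/
noncomputable def sweepStep (i : ℕ) (st : RunState n) : RunState n :=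
  let p := pass f c D st.x (w i) (st.s i * D)
  ⟨p.x, if Small f c t (st.s i) p.R then Function.update st.s i (st.s i + 1) else st.s,
    Function.update st.cnt i (st.cnt i + p.cnt)⟩

/-- Process the first `m` paths, one after the other. -/
noncomputable def sweepTo : ℕ → RunState n → RunState n
  | 0, st => st
  | i + 1, st => sweepStep f c D t w i (sweepTo i st)

/-- Process all `M` paths. -/
noncomputable def sweep (st : RunState n) : RunState n := sweepTo f c D t w M st

/-- Sweeping over the paths comes to a standstill. -/
def Settles (st : RunState n) : Prop :=
  ∃ v, (sweep f c D M t w)^[v + 1] st = (sweep f c D M t w)^[v] st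

open Classical in
/-- Sweep over the paths until nothing changes. (The last line is irrelevant, see
`settles_of_bound`.) -/
noncomputable def settle (st : RunState n) : RunState n :=
  if h : Settles f c D M t w st then (sweep f c D M t w)^[Nat.find h] st else st

/-- The initial state: free elements are bought. -/
noncomputable def startState (c : Fin n → ℝ) : RunState n :=
  ⟨fun j => if 0 < c j then 0 else 1, fun _ => 0, fun _ => 0⟩

/-- The state after time `t`. -/
noncomputable def run (f : ℕ → Finset (Fin n) → ℝ) (c : Fin n → ℝ) (D M : ℕ)
    (w : ℕ → ℕ → ℕ × ℕ) : ℕ → RunState n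
  | 0 => startState c
  | t + 1 => settle (f (t + 1)) c D M (t + 1) w (run f c D M w t)

variable {f c D M t w}

theorem iterate_eq_of_fixed {α : Type*} {g : α → α} {a : α} {v v' : ℕ}
    (h : g^[v + 1] a = g^[v] a) (hv : v ≤ v') : g^[v'] a = g^[v] a := by
  induction v', hv using Nat.le_induction with
  | base => rfl
  | succ v' _ ih => rw [Function.iterate_succ_apply', ih, ← Function.iterate_succ_apply' g, h]

theorem settle_eq {st : RunState n} {v : ℕ}
    (h : (sweep f c D M t w)^[v + 1] st = (sweep f c D M t w)^[v] st) {v' : ℕ} (hv : v ≤ v') :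
    (sweep f c D M t w)^[v'] st = settle f c D M t w st := by
  classical
  have hs : Settles f c D M t w st := ⟨v, h⟩
  rw [settle, dif_pos hs]
  exact iterate_eq_of_fixed (Nat.find_spec hs) ((Nat.find_min' hs h).trans hv)

theorem sweep_settle {st : RunState n} (h : Settles f c D M t w st) :
    sweep f c D M t w (settle f c D M t w st) = settle f c D M t w st := by
  classical
  rw [settle, dif_pos h, ← Function.iterate_succ_apply' (sweep f c D M t w)]
  exact Nat.find_spec h

theorem sweepStep_le (i : ℕ) (st : RunState n) (j : ℕ) :
    st.s j ≤ (sweepStep f c D t w i st).s j ∧ st.cnt j ≤ (sweepStep f c D t w i st).cnt j := by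
  constructor
  · simp only [sweepStep]
    split_ifs
    · by_cases h : j = i
      · subst h; simp
      · simp [h]
    · exact le_rfl
  · by_cases h : j = i
    · subst h; simp [sweepStep]
    · simp [sweepStep, h]

theorem sweepTo_le {m m' : ℕ} (h : m ≤ m') (st : RunState n) (j : ℕ) :
    (sweepTo f c D t w m st).s j ≤ (sweepTo f c D t w m' st).s j ∧
      (sweepTo f c D t w m st).cnt j ≤ (sweepTo f c D t w m' st).cnt j := by
  induction m', h using Nat.le_induction with
  | base => exact ⟨le_rfl, le_rfl⟩
  | succ m' _ ih =>
    have := sweepStep_le (f := f) (c := c) (D := D) (t := t) (w := w) m'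
      (sweepTo f c D t w m' st) j
    exact ⟨ih.1.trans this.1, ih.2.trans this.2⟩

theorem sweep_le (st : RunState n) (j : ℕ) :
    st.s j ≤ (sweep f c D M t w st).s j ∧ st.cnt j ≤ (sweep f c D M t w st).cnt j :=
  sweepTo_le (Nat.zero_le M) st j

theorem iterate_sweep_le {v v' : ℕ} (h : v ≤ v') (st : RunState n) (j : ℕ) :
    ((sweep f c D M t w)^[v] st).s j ≤ ((sweep f c D M t w)^[v'] st).s j ∧
      ((sweep f c D M t w)^[v] st).cnt j ≤ ((sweep f c D M t w)^[v'] st).cnt j := by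
  induction v', h using Nat.le_induction with
  | base => exact ⟨le_rfl, le_rfl⟩
  | succ v' _ ih =>
    rw [Function.iterate_succ_apply']
    have := sweep_le (f := f) (c := c) (D := D) (M := M) (t := t) (w := w)
      ((sweep f c D M t w)^[v'] st) j
    exact ⟨ih.1.trans this.1, ih.2.trans this.2⟩

theorem sweepStep_eq_self {i : ℕ} {st : RunState n}
    (hs : (sweepStep f c D t w i st).s i = st.s i)
    (hcnt : (sweepStep f c D t w i st).cnt i = st.cnt i) :
    sweepStep f c D t w i st = st ∧ (pass f c D st.x (w i) (st.s i * D)).cnt = 0 ∧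
      ¬ Small f c t (st.s i) (layers D st.x (w i) (st.s i * D)) := by
  have h1 : (pass f c D st.x (w i) (st.s i * D)).cnt = 0 := by
    simpa [sweepStep] using hcnt
  obtain ⟨h2, h3, -⟩ := pass_of_cnt_eq_zero h1
  have h4 : ¬ Small f c t (st.s i) (pass f c D st.x (w i) (st.s i * D)).R := by
    intro h
    simp [sweepStep, h] at hs
  refine ⟨?_, h1, h3 ▸ h4⟩
  ext j
  · simp [sweepStep, h2]
  · simp [sweepStep, h4]
  · simp [sweepStep, h1]

/-- A sweep that changes none of the counters changes nothing, and finds no violated constraint and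
no path that is too short. -/
theorem sweepTo_eq_self {m : ℕ} {st : RunState n}
    (h : ∀ j < m, (sweepTo f c D t w m st).s j = st.s j ∧
      (sweepTo f c D t w m st).cnt j = st.cnt j) :
    sweepTo f c D t w m st = st ∧ ∀ i < m, (pass f c D st.x (w i) (st.s i * D)).cnt = 0 ∧
      ¬ Small f c t (st.s i) (layers D st.x (w i) (st.s i * D)) := by
  induction m with
  | zero => exact ⟨rfl, by simp⟩
  | succ m ih =>
    have hle := sweepTo_le (f := f) (c := c) (D := D) (t := t) (w := w) (Nat.le_succ m) st
    have hle0 := sweepTo_le (f := f) (c := c) (D := D) (t := t) (w := w) (Nat.zero_le m) st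
    obtain ⟨h1, h2⟩ := ih fun j hj =>
      ⟨le_antisymm ((hle j).1.trans (h j (by omega)).1.le) (hle0 j).1,
        le_antisymm ((hle j).2.trans (h j (by omega)).2.le) (hle0 j).2⟩
    have h3 := h m (by omega)
    simp only [sweepTo, h1] at h3 ⊢
    obtain ⟨h4, h5, h6⟩ := sweepStep_eq_self h3.1 h3.2
    refine ⟨h4, fun i hi => ?_⟩
    rcases Nat.lt_succ_iff_lt_or_eq.1 hi with hi | rfl
    · exact h2 i hi
    · exact ⟨h5, h6⟩

/-- At a standstill, no path meets a violated constraint, and no path is too short. -/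
theorem standstill {st : RunState n} (h : sweep f c D M t w st = st) {i : ℕ} (hi : i < M) :
    (pass f c D st.x (w i) (st.s i * D)).cnt = 0 ∧
      ¬ Small f c t (st.s i) (layers D st.x (w i) (st.s i * D)) := by
  unfold sweep at h
  exact (sweepTo_eq_self (m := M) (st := st) fun j _ => by rw [h]; exact ⟨rfl, rfl⟩).2 i hi

/-- The number of updates and of stages, which measures the progress of the sweeps. -/
def effort (M : ℕ) (st : RunState n) : ℕ := ∑ j ∈ Finset.range M, (st.s j + st.cnt j)

/-- A sweep that changes anything adds an update or a stage. -/
theorem effort_lt {st : RunState n} (h : sweep f c D M t w st ≠ st) :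
    effort M st < effort M (sweep f c D M t w st) := by
  have hle := sweep_le (f := f) (c := c) (D := D) (M := M) (t := t) (w := w) st
  by_contra! hcon
  refine h (sweepTo_eq_self (m := M) (st := st) fun j hj => ?_).1
  have heq := (Finset.sum_eq_sum_iff_of_le (s := Finset.range M)
    (f := fun j => st.s j + st.cnt j)
    (g := fun j => (sweep f c D M t w st).s j + (sweep f c D M t w st).cnt j)
    (fun j _ => Nat.add_le_add (hle j).1 (hle j).2)).1
    (le_antisymm (Finset.sum_le_sum fun j _ => Nat.add_le_add (hle j).1 (hle j).2) hcon)
    j (Finset.mem_range.2 hj)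
  have h1 := (hle j).1
  have h2 := (hle j).2
  unfold sweep at heq h1 h2
  omega

/-- The effort grows with every sweep before the standstill, so it suffices to bound it. -/
theorem settles_of_bound {st : RunState n} (K : ℕ)
    (h : ∀ v, effort M ((sweep f c D M t w)^[v] st) ≤ K) : Settles f c D M t w st := by
  by_contra hcon
  have hgrow : ∀ v, v ≤ effort M ((sweep f c D M t w)^[v] st) := by
    intro v
    induction v with
    | zero => exact Nat.zero_le _
    | succ v ih =>
      have hne : sweep f c D M t w ((sweep f c D M t w)^[v] st) ≠ (sweep f c D M t w)^[v] st := by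
        intro h'
        exact hcon ⟨v, by rw [Function.iterate_succ_apply', h']⟩
      have := effort_lt hne
      rw [← Function.iterate_succ_apply' (sweep f c D M t w)] at this
      exact Nat.lt_of_le_of_lt ih this
  have := hgrow (K + 1)
  have := h (K + 1)
  omega

/-! ### Independence of a path and the fractional solution -/

/-- The states agree, except for the counters of the path `i`. -/
def SameExcept (i : ℕ) (st st' : RunState n) : Prop :=
  st.x = st'.x ∧ ∀ j ≠ i, st.s j = st'.s j ∧ st.cnt j = st'.cnt j

variable {w' : ℕ → ℕ → ℕ × ℕ}

/-- If the path `i` causes no update, then processing a path has the same effect on the fractional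
solution and on the other counters, whatever the layers of the path `i`. -/
theorem sweepStep_sameExcept {i : ℕ} (hw : ∀ j ≠ i, w j = w' j) {st st' : RunState n}
    (h : SameExcept i st st') (m : ℕ) (h0 : (sweepStep f c D t w m st).cnt i = 0)
    (h0' : (sweepStep f c D t w' m st').cnt i = 0) :
    SameExcept i (sweepStep f c D t w m st) (sweepStep f c D t w' m st') := by
  obtain ⟨hx, hj⟩ := h
  by_cases hm : m = i
  · subst hm
    have h1 : (pass f c D st.x (w m) (st.s m * D)).cnt = 0 := by
      simp [sweepStep] at h0; omega
    have h1' : (pass f c D st'.x (w' m) (st'.s m * D)).cnt = 0 := by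
      simp [sweepStep] at h0'; omega
    refine ⟨?_, fun j hjm => ⟨?_, ?_⟩⟩
    · simp only [sweepStep]
      rw [(pass_of_cnt_eq_zero h1).1, (pass_of_cnt_eq_zero h1').1, hx]
    · simp only [sweepStep]
      split_ifs <;> simp [hjm, (hj j hjm).1]
    · simp [sweepStep, hjm, (hj j hjm).2]
  · have hp : pass f c D st.x (w m) (st.s m * D) = pass f c D st'.x (w' m) (st'.s m * D) := by
      rw [hx, hw m hm, (hj m hm).1]
    refine ⟨by simp only [sweepStep, hp], fun j hji => ?_⟩
    by_cases hjm : j = m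
    · subst hjm
      simp only [sweepStep]
      rw [hp]
      constructor
      · rw [(hj j hm).1]
        split_ifs <;> simp [(hj j hm).1]
      · simp [(hj j hm).2]
    · simp only [sweepStep]
      refine ⟨?_, by simp [hjm, (hj j hji).2]⟩
      split_ifs <;> simp [hjm, (hj j hji).1]

theorem sweepTo_sameExcept {i : ℕ} (hw : ∀ j ≠ i, w j = w' j) {st st' : RunState n}
    (h : SameExcept i st st') (m : ℕ) (h0 : (sweepTo f c D t w m st).cnt i = 0)
    (h0' : (sweepTo f c D t w' m st').cnt i = 0) :
    SameExcept i (sweepTo f c D t w m st) (sweepTo f c D t w' m st') := by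
  induction m with
  | zero => exact h
  | succ m ih =>
    refine sweepStep_sameExcept hw (ih ?_ ?_) m h0 h0'
    · exact Nat.le_zero.1 ((sweepTo_le (Nat.le_succ m) st i).2.trans h0.le)
    · exact Nat.le_zero.1 ((sweepTo_le (Nat.le_succ m) st' i).2.trans h0'.le)

theorem iterate_sweep_sameExcept {i : ℕ} (hw : ∀ j ≠ i, w j = w' j) {st st' : RunState n}
    (h : SameExcept i st st') (v : ℕ) (h0 : ((sweep f c D M t w)^[v] st).cnt i = 0)
    (h0' : ((sweep f c D M t w')^[v] st').cnt i = 0) :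
    SameExcept i ((sweep f c D M t w)^[v] st) ((sweep f c D M t w')^[v] st') := by
  induction v with
  | zero => exact h
  | succ v ih =>
    have h1 := ih (Nat.le_zero.1 ((iterate_sweep_le (Nat.le_succ v) st i).2.trans h0.le))
      (Nat.le_zero.1 ((iterate_sweep_le (Nat.le_succ v) st' i).2.trans h0'.le))
    rw [Function.iterate_succ_apply'] at h0 h0' ⊢
    rw [Function.iterate_succ_apply']
    exact sweepTo_sameExcept hw h1 M h0 h0'

/-- The numbers of sweeps until the standstills may differ, but more sweeps do not change anything. -/
theorem settle_sameExcept {i : ℕ} (hw : ∀ j ≠ i, w j = w' j) {st st' : RunState n}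
    (h : SameExcept i st st') (hS : Settles f c D M t w st) (hS' : Settles f c D M t w' st')
    (h0 : (settle f c D M t w st).cnt i = 0) (h0' : (settle f c D M t w' st').cnt i = 0) :
    SameExcept i (settle f c D M t w st) (settle f c D M t w' st') := by
  obtain ⟨v, hv⟩ := hS
  obtain ⟨v', hv'⟩ := hS'
  rw [← settle_eq hv (le_max_left v v')] at h0 ⊢
  rw [← settle_eq hv' (le_max_right v v')] at h0' ⊢
  exact iterate_sweep_sameExcept hw h _ h0 h0'

theorem settle_le {st : RunState n} (hS : Settles f c D M t w st) (j : ℕ) :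
    st.s j ≤ (settle f c D M t w st).s j ∧ st.cnt j ≤ (settle f c D M t w st).cnt j := by
  obtain ⟨v, hv⟩ := hS
  rw [← settle_eq hv le_rfl]
  exact iterate_sweep_le (Nat.zero_le v) st j

end Run

end Algorithm

/-! ### Bounds along a run of the algorithm -/

section Bounds

variable {n : ℕ}

/-- The hypotheses on the instance, and on the resolution `D` of the algorithm. -/
structure Admissible (c : Fin n → ℝ) (f : ℕ → Finset (Fin n) → ℝ) (T D : ℕ) : Prop where
  inst : IsInstance c f T
  inc : ∀ t, 1 ≤ t → t ≤ T → IsIncreasing 3 (f t)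
  le : 4 * n ≤ D
  pos : 1 ≤ D

/-- No path gets more than `Sm` stages up to time `T`: a path with `s` stages is extended only if
there is a small marginal. -/
def StageBound (f : ℕ → Finset (Fin n) → ℝ) (c : Fin n → ℝ) (T Sm : ℕ) : Prop :=
  ∀ t, 1 ≤ t → t ≤ T → ∀ s R, Small (f t) c t s R → s + 1 ≤ Sm

/-- The total number of updates. -/
def updates (M : ℕ) (st : RunState n) : ℕ := ∑ i ∈ Finset.range M, st.cnt i

/-- `st'` arises from `st` by updates. -/
def Reaches (c : Fin n → ℝ) (D M : ℕ) (O : Finset (Fin n)) (st st' : RunState n) : Prop :=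
  ∃ k, Progress c D O st.x st'.x k ∧ updates M st' = updates M st + k

theorem Reaches.refl {c : Fin n → ℝ} {D M : ℕ} {O : Finset (Fin n)} {st : RunState n}
    (h : InRange c D st.x) : Reaches c D M O st st := ⟨0, Progress.refl h, rfl⟩

theorem Reaches.trans {c : Fin n → ℝ} {D M : ℕ} {O : Finset (Fin n)} {st st' st'' : RunState n}
    (h : Reaches c D M O st st') (h' : Reaches c D M O st' st'') : Reaches c D M O st st'' := by
  obtain ⟨k, h1, h2⟩ := h
  obtain ⟨k', h1', h2'⟩ := h'
  exact ⟨k + k', h1.trans h1', by omega⟩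

theorem Reaches.inRange {c : Fin n → ℝ} {D M : ℕ} {O : Finset (Fin n)} {st st' : RunState n}
    (h : Reaches c D M O st st') : InRange c D st'.x := by
  obtain ⟨k, h1, -⟩ := h
  exact h1.inRange

theorem startState_inRange {c : Fin n → ℝ} {D : ℕ} (hD1 : 1 ≤ D) :
    InRange c D (startState c).x := by
  have hδ : (0 : ℝ) < 1 / D := by
    have : (0 : ℝ) < D := by exact_mod_cast hD1
    positivity
  refine ⟨fun j => ?_, fun j hj => ?_, fun j => ?_⟩
  · simp only [startState]; split_ifs <;> norm_num
  · simp [startState, hj]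
  · simp only [startState]; split_ifs <;> linarith

variable {c : Fin n → ℝ} {f : ℕ → Finset (Fin n) → ℝ} {T D M q Sm : ℕ} {w : ℕ → ℕ → ℕ × ℕ}

theorem Admissible.mono (h : Admissible c f T D) {T' : ℕ} (hT : T' ≤ T) :
    Admissible c f T' D :=
  ⟨⟨h.inst.cost_nonneg, fun t h1 h2 => h.inst.nonneg t h1 (h2.trans hT),
    fun t h1 h2 => h.inst.mono t h1 (h2.trans hT),
    fun t h1 h2 => h.inst.submodular t h1 (h2.trans hT),
    fun t h1 h2 => h.inst.timeMonotone t h1 (h2.trans hT)⟩,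
    fun t h1 h2 => h.inc t h1 (h2.trans hT), h.le, h.pos⟩

theorem IsInstance.isCover_of_le (h : IsInstance c f T) {S : Finset (Fin n)} {t t' : ℕ}
    (ht : 1 ≤ t) (htt : t ≤ t') (ht' : t' ≤ T) (hS : IsCover (f t') S) : IsCover (f t) S := by
  induction t', htt using Nat.le_induction with
  | base => exact hS
  | succ t' h1 ih => exact ih (by omega) (h.timeMonotone t' (by omega) ht' S hS)

theorem sweepTo_reaches (h : Admissible c f T D) {t : ℕ} (ht : 1 ≤ t) (htT : t ≤ T)
    {O : Finset (Fin n)} (hO : IsCover (f t) O) {st : RunState n} (hx : InRange c D st.x)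
    {m : ℕ} (hm : m ≤ M) : Reaches c D M O st (sweepTo (f t) c D t w m st) := by
  induction m with
  | zero => exact Reaches.refl hx
  | succ m ih =>
    have ih := ih (by omega)
    refine ih.trans ?_
    refine ⟨_, pass_progress (h.inst.mono t ht htT) (h.inst.submodular t ht htT)
      (h.inc t ht htT) h.inst.cost_nonneg h.le h.pos hO ih.inRange (w m) _, ?_⟩
    simp only [updates, sweepTo, sweepStep]
    rw [Finset.sum_update_of_mem (Finset.mem_range.2 (by omega)),
      ← Finset.add_sum_erase _ _ (Finset.mem_range.2 (show m < M by omega)), Finset.sdiff_singleton_eq_erase]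
    omega

theorem iterate_sweep_reaches (h : Admissible c f T D) {t : ℕ} (ht : 1 ≤ t) (htT : t ≤ T)
    {O : Finset (Fin n)} (hO : IsCover (f t) O) {st : RunState n} (hx : InRange c D st.x)
    (v : ℕ) : Reaches c D M O st ((sweep (f t) c D M t w)^[v] st) := by
  induction v with
  | zero => exact Reaches.refl hx
  | succ v ih =>
    rw [Function.iterate_succ_apply']
    exact ih.trans (sweepTo_reaches h ht htT hO ih.inRange le_rfl)

/-- A path is extended only when it meets a small marginal, so stages stay below the bound. -/
theorem sweepTo_s_le {t : ℕ} (hs : ∀ s R, Small (f t) c t s R → s + 1 ≤ Sm)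
    {st : RunState n} (h0 : ∀ j, st.s j ≤ Sm) (m j : ℕ) :
    (sweepTo (f t) c D t w m st).s j ≤ Sm := by
  induction m generalizing j with
  | zero => exact h0 j
  | succ m ih =>
    simp only [sweepTo, sweepStep]
    split_ifs with hsm
    · by_cases hj : j = m
      · subst hj; rw [Function.update_self]; exact hs _ _ hsm
      · rw [Function.update_of_ne hj]; exact ih j
    · exact ih j

theorem iterate_sweep_s_le {t : ℕ} (hs : ∀ s R, Small (f t) c t s R → s + 1 ≤ Sm)
    {st : RunState n} (h0 : ∀ j, st.s j ≤ Sm) (v j : ℕ) :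
    ((sweep (f t) c D M t w)^[v] st).s j ≤ Sm := by
  induction v generalizing j with
  | zero => exact h0 j
  | succ v ih =>
    rw [Function.iterate_succ_apply']
    exact sweepTo_s_le hs ih M j

theorem updates_startState : updates M (startState c) = 0 := by simp [updates, startState]

theorem le_two_mul_of_inRange (hD1 : 1 ≤ D) {x : Fin n → ℝ} (hx : InRange c D x) (j : Fin n) :
    x j + 1 / D ≤ 4 * D * (1 / D) := by
  have hD' : (1 : ℝ) ≤ D := by exact_mod_cast hD1
  have h1 : 1 / (D : ℝ) ≤ 1 := by rw [div_le_one (by linarith)]; exact hD'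
  have h2 := hx.le j
  have h3 : 4 * (D : ℝ) * (1 / D) = 4 := by field_simp
  linarith

/-- Every update doubles a factor of `∏ (x j + 1 / D)`, so there are few of them. -/
theorem updates_le (hD : D = 2 ^ q) {O : Finset (Fin n)} {st : RunState n}
    (h : Reaches c D M O (startState c) st) : updates M st ≤ n * (q + 2) := by
  have hD1 : 1 ≤ D := hD ▸ Nat.one_le_two_pow
  have hDpos : (0 : ℝ) < D := by exact_mod_cast hD1
  obtain ⟨k, hk, hu⟩ := h
  rw [updates_startState, zero_add] at hu
  rw [hu]
  have h1 : ∏ j, (st.x j + 1 / (D : ℝ)) ≤ (4 * D * (1 / D)) ^ n := by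
    refine (Finset.prod_le_prod (fun j _ => ?_) fun j _ =>
      le_two_mul_of_inRange hD1 hk.inRange j).trans ?_
    · have := hk.inRange.nonneg j
      positivity
    · simp
  have h2 : (1 / (D : ℝ)) ^ n ≤ ∏ j, ((startState c).x j + 1 / (D : ℝ)) := by
    have : ∏ _j : Fin n, (1 / (D : ℝ)) = (1 / D) ^ n := by simp
    rw [← this]
    refine Finset.prod_le_prod (fun j _ => by positivity) fun j _ => ?_
    have := (startState_inRange (c := c) hD1).nonneg j
    linarith
  have h3 : (1 / (D : ℝ)) ^ n * 2 ^ k ≤ (4 * D) ^ n * (1 / D) ^ n := by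
    rw [← mul_pow]
    exact (mul_le_mul_of_nonneg_right h2 (by positivity)).trans (hk.prod.trans h1)
  have h4 : (2 : ℝ) ^ k ≤ (4 * D) ^ n := by
    rw [mul_comm] at h3
    exact le_of_mul_le_mul_right h3 (by positivity)
  have h5 : (4 * D : ℝ) ^ n = 2 ^ (n * (q + 2)) := by
    rw [hD, mul_comm n, pow_mul]
    push_cast
    ring
  rw [h5] at h4
  exact (pow_le_pow_iff_right₀ (by norm_num)).1 h4

/-- The invariants of a run: the total progress, and the number of stages. -/
structure RunInv (c : Fin n → ℝ) (f : ℕ → Finset (Fin n) → ℝ) (D M Sm t : ℕ)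
    (st : RunState n) : Prop where
  reaches : ∀ O, (∀ t', 1 ≤ t' → t' ≤ t → IsCover (f t') O) →
    Reaches c D M O (startState c) st
  stages : ∀ j, st.s j ≤ Sm

theorem RunInv.inRange {t : ℕ} {st : RunState n} (h : RunInv c f D M Sm t st) :
    InRange c D st.x := (h.reaches Finset.univ fun _ _ _ => rfl).inRange

theorem RunInv.iterate (h : Admissible c f T D) (hS : StageBound f c T Sm) {t : ℕ}
    (ht : t + 1 ≤ T) {st : RunState n} (hi : RunInv c f D M Sm t st) (v : ℕ) :
    RunInv c f D M Sm (t + 1) ((sweep (f (t + 1)) c D M (t + 1) w)^[v] st) := by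
  refine ⟨fun O hO => ?_, iterate_sweep_s_le (hS (t + 1) (by omega) ht) hi.stages v⟩
  exact (hi.reaches O fun t' h1 h2 => hO t' h1 (by omega)).trans
    (iterate_sweep_reaches h (by omega) ht (hO (t + 1) (by omega) le_rfl) hi.inRange v)

theorem RunInv.updates_le {t : ℕ} {st : RunState n} (hi : RunInv c f D M Sm t st)
    (hD : D = 2 ^ q) : updates M st ≤ n * (q + 2) :=
  OnlineCover.updates_le hD (hi.reaches Finset.univ fun _ _ _ => rfl)

theorem RunInv.effort_le {t : ℕ} {st : RunState n} (hi : RunInv c f D M Sm t st)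
    (hD : D = 2 ^ q) : effort M st ≤ M * Sm + n * (q + 2) := by
  rw [effort, Finset.sum_add_distrib]
  refine Nat.add_le_add ?_ (hi.updates_le hD)
  refine (Finset.sum_le_sum fun j _ => hi.stages j).trans ?_
  simp

/-- The effort is bounded by the number of possible stages and updates. -/
theorem RunInv.settles (h : Admissible c f T D) (hS : StageBound f c T Sm) (hD : D = 2 ^ q)
    {t : ℕ} (ht : t + 1 ≤ T) {st : RunState n} (hi : RunInv c f D M Sm t st) :
    Settles (f (t + 1)) c D M (t + 1) w st :=
  settles_of_bound _ fun v => (hi.iterate h hS ht v).effort_le hD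

theorem run_inv (h : Admissible c f T D) (hS : StageBound f c T Sm) (hD : D = 2 ^ q) {t : ℕ}
    (ht : t ≤ T) : RunInv c f D M Sm t (run f c D M w t) := by
  induction t with
  | zero =>
    exact ⟨fun O _ => Reaches.refl (startState_inRange h.pos),
      fun j => Nat.zero_le _⟩
  | succ t ih =>
    have ih := ih (by omega)
    obtain ⟨v, hv⟩ := ih.settles (w := w) h hS hD ht
    rw [run, ← settle_eq hv le_rfl]
    exact ih.iterate h hS ht v

theorem run_settles (h : Admissible c f T D) (hS : StageBound f c T Sm) (hD : D = 2 ^ q) {t : ℕ}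
    (ht : t + 1 ≤ T) : Settles (f (t + 1)) c D M (t + 1) w (run f c D M w t) :=
  (run_inv h hS hD (by omega)).settles h hS hD ht

/-- The fractional solution and all counters grow with time. -/
theorem run_mono (h : Admissible c f T D) (hS : StageBound f c T Sm) (hD : D = 2 ^ q) {t t' : ℕ}
    (htt : t ≤ t') (ht : t' ≤ T) :
    (∀ j, (run f c D M w t).x j ≤ (run f c D M w t').x j) ∧
    (∀ i, (run f c D M w t).s i ≤ (run f c D M w t').s i) ∧
    ∀ i, (run f c D M w t).cnt i ≤ (run f c D M w t').cnt i := by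
  induction t', htt using Nat.le_induction with
  | base => exact ⟨fun _ => le_rfl, fun _ => le_rfl, fun _ => le_rfl⟩
  | succ t' _ ih =>
    obtain ⟨h1, h2, h3⟩ := ih (by omega)
    have hset := run_settles (w := w) (M := M) h hS hD ht
    have hle := settle_le hset
    refine ⟨fun j => (h1 j).trans ?_, fun i => (h2 i).trans (hle i).1,
      fun i => (h3 i).trans (hle i).2⟩
    obtain ⟨v, hv⟩ := hset
    rw [run, ← settle_eq hv le_rfl]
    obtain ⟨k, hk, -⟩ := iterate_sweep_reaches (M := M) (w := w) h (by omega) ht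
      (O := Finset.univ) rfl (run_inv (w := w) (M := M) h hS hD (t := t') (by omega)).inRange v
    exact hk.le j

/-- As long as the path `i` causes no update, the fractional solutions do not depend on its layers. -/
theorem run_sameExcept (h : Admissible c f T D) (hS : StageBound f c T Sm) (hD : D = 2 ^ q)
    {w' : ℕ → ℕ → ℕ × ℕ} {i : ℕ} (hw : ∀ j ≠ i, w j = w' j) {t : ℕ} (ht : t ≤ T)
    (h0 : (run f c D M w t).cnt i = 0) (h0' : (run f c D M w' t).cnt i = 0) :
    SameExcept i (run f c D M w t) (run f c D M w' t) := by
  induction t with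
  | zero => exact ⟨rfl, fun _ _ => ⟨rfl, rfl⟩⟩
  | succ t ih =>
    refine settle_sameExcept hw (ih (by omega) ?_ ?_) (run_settles h hS hD ht)
      (run_settles h hS hD ht) h0 h0'
    · exact Nat.le_zero.1 (((run_mono h hS hD (Nat.le_succ t) ht).2.2 i).trans h0.le)
    · exact Nat.le_zero.1 (((run_mono h hS hD (Nat.le_succ t) ht).2.2 i).trans h0'.le)

/-- The cost of the fractional solution. -/
theorem fractional_cost_le (hc : ∀ j, 0 ≤ c j) (hD1 : 1 ≤ D) {O : Finset (Fin n)}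
    {st : RunState n} (h : Reaches c D M O (startState c) st) :
    ∑ j, c j * st.x j ≤ 2 * Real.log (4 * D) * cost c O := by
  have hDpos : (0 : ℝ) < D := by exact_mod_cast hD1
  obtain ⟨k, hk, -⟩ := h
  have h0 : ∑ j, c j * (startState c).x j = 0 := by
    refine Finset.sum_eq_zero fun j _ => ?_
    simp only [startState]
    split_ifs with hj
    · simp
    · rw [le_antisymm (not_lt.1 hj) (hc j), zero_mul]
  have h1 := hk.pays
  rw [h0, sub_zero] at h1
  refine h1.trans ?_
  rw [mul_assoc]
  refine mul_le_mul_of_nonneg_left ?_ zero_le_two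
  rw [cost, Finset.mul_sum]
  refine Finset.sum_le_sum fun j _ => ?_
  rw [mul_comm]
  refine mul_le_mul_of_nonneg_right ?_ (hc j)
  have hx0 := (startState_inRange (c := c) hD1).nonneg j
  have h2 : Real.log (1 / D) ≤ Real.log ((startState c).x j + 1 / D) :=
    Real.log_le_log (by positivity) (by linarith)
  have h3 : Real.log (st.x j + 1 / D) ≤ Real.log (4 * D * (1 / D)) := by
    have := hk.inRange.nonneg j
    exact Real.log_le_log (by positivity) (le_two_mul_of_inRange hD1 hk.inRange j)
  rw [Real.log_mul (by positivity) (by positivity)] at h3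
  linarith

/-! ### The integral solution -/

/-- The rounded solution of the path `i`. -/
noncomputable def rounded (D : ℕ) (w : ℕ → ℕ → ℕ × ℕ) (i : ℕ) (st : RunState n) :
    Finset (Fin n) := layers D st.x (w i) (st.s i * D)

/-- The solution maintained by the algorithm, if `i` is the secret path: at each time, the rounded
solution of that path is bought, and completed to a cover. -/
noncomputable def solution (f : ℕ → Finset (Fin n) → ℝ) (c : Fin n → ℝ) (D M : ℕ)
    (w : ℕ → ℕ → ℕ × ℕ) (i : ℕ) : ℕ → Finset (Fin n)
  | 0 => ∅
  | t + 1 => solution f c D M w i t ∪ (rounded D w i (run f c D M w (t + 1)) ∪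
      fill (f (t + 1)) c (rounded D w i (run f c D M w (t + 1))))

/-- The elements that are bought to complete the rounded solutions of the first `t` times. -/
noncomputable def fills (f : ℕ → Finset (Fin n) → ℝ) (c : Fin n → ℝ) (D M : ℕ)
    (w : ℕ → ℕ → ℕ × ℕ) (i : ℕ) (t : ℕ) : Finset (Fin n) :=
  (Finset.range t).biUnion fun t => fill (f (t + 1)) c (rounded D w i (run f c D M w (t + 1)))

theorem rounded_mono (h : Admissible c f T D) (hS : StageBound f c T Sm) (hD : D = 2 ^ q)
    (i : ℕ) {t t' : ℕ} (htt : t ≤ t') (ht : t' ≤ T) :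
    rounded D w i (run f c D M w t) ⊆ rounded D w i (run f c D M w t') := by
  obtain ⟨h1, h2, -⟩ := run_mono (w := w) (M := M) h hS hD htt ht
  exact layers_mono h1 _ (Nat.mul_le_mul_right _ (h2 i))

/-- The solution consists of the last rounded solution, which contains the earlier ones, and of the
elements that completed it at the various times. -/
theorem solution_subset (h : Admissible c f T D) (hS : StageBound f c T Sm) (hD : D = 2 ^ q)
    (i : ℕ) {t : ℕ} (ht : t ≤ T) :
    solution f c D M w i t ⊆ rounded D w i (run f c D M w T) ∪ fills f c D M w i t := by
  induction t with
  | zero => exact Finset.empty_subset _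
  | succ t ih =>
    refine Finset.union_subset ((ih (by omega)).trans ?_) (Finset.union_subset ?_ ?_)
    · refine Finset.union_subset_union_right ?_
      exact Finset.biUnion_subset_biUnion_of_subset_left _ (Finset.range_mono (Nat.le_succ t))
    · exact (rounded_mono h hS hD i ht le_rfl).trans Finset.subset_union_left
    · refine Finset.Subset.trans ?_ Finset.subset_union_right
      exact Finset.subset_biUnion_of_mem
        (fun t => fill (f (t + 1)) c (rounded D w i (run f c D M w (t + 1)))) (by simp)

theorem cost_fills_le (hc : ∀ j, 0 ≤ c j) (i t : ℕ) : cost c (fills f c D M w i t) ≤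
    ∑ t ∈ Finset.range t, cost c (fill (f (t + 1)) c (rounded D w i (run f c D M w (t + 1)))) := by
  induction t with
  | zero => simp [fills, cost]
  | succ t ih =>
    rw [Finset.sum_range_succ, fills, Finset.range_add_one, Finset.biUnion_insert,
      Finset.union_comm]
    exact (cost_union_le hc _ _).trans (add_le_add_left ih _)

/-- A crude bound for the cost of completing the rounded solutions, for any outcome of the coins. -/
theorem cost_fills_le_card_mul (h : Admissible c f T D) {O : Finset (Fin n)}
    (hO : ∀ t, 1 ≤ t → t ≤ T → IsCover (f t) O) (i : ℕ) :
    cost c (fills f c D M w i T) ≤ n * cost c O := by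
  have : ∀ j ∈ fills f c D M w i T, c j ≤ cost c O := by
    intro j hj
    obtain ⟨t, ht, hj⟩ := Finset.mem_biUnion.1 hj
    have ht := Finset.mem_range.1 ht
    exact le_cost_of_mem_fill (h.inst.mono (t + 1) (by omega) (by omega)) h.inst.cost_nonneg
      (hO (t + 1) (by omega) (by omega)) hj
  refine (Finset.sum_le_card_nsmul _ _ _ this).trans ?_
  rw [nsmul_eq_mul]
  refine mul_le_mul_of_nonneg_right ?_ (cost_nonneg h.inst.cost_nonneg O)
  exact_mod_cast (Finset.card_le_univ _).trans (by simp)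

/-- A crude bound for the cost of the rounded solution, for any outcome of the coins. -/
theorem cost_layers_le_mul (hc : ∀ j, 0 ≤ c j) (hD1 : 1 ≤ D) {x : Fin n → ℝ}
    (hx : ∀ j, 0 ≤ x j) (y : ℕ → ℕ × ℕ) (k : ℕ) :
    cost c (layers D x y k) ≤ D * ∑ j, c j * x j := by
  rw [Finset.mul_sum, cost]
  refine (Finset.sum_le_sum (g := fun j => D * (c j * x j)) fun j hj => ?_).trans
    (Finset.sum_le_sum_of_subset_of_nonneg (Finset.subset_univ _) fun j _ _ => ?_)
  · have := mul_le_mul_of_nonneg_left (le_of_mem_layers hD1 hj) (hc j)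
    linarith
  · exact mul_nonneg (Nat.cast_nonneg D) (mul_nonneg (hc j) (hx j))

end Bounds

/-! ### The expected cost of the solution -/

section Expectation

/-- Averaging over functions, one coordinate may be averaged first. -/
theorem sum_update_eq {ι α : Type*} [Fintype ι] [DecidableEq ι] [Fintype α] (k : ι)
    (F : (ι → α) → ℝ) :
    ∑ p : ι → α, ∑ a : α, F (Function.update p k a) = Fintype.card α * ∑ p : ι → α, F p := by
  rw [← (Equiv.funSplitAt k α).symm.sum_comp, ← (Equiv.funSplitAt k α).symm.sum_comp F,
    Fintype.sum_prod_type, Fintype.sum_prod_type]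
  have e : ∀ (a b : α) (g : {j // j ≠ k} → α), Function.update
      ((Equiv.funSplitAt k α).symm (a, g)) k b = (Equiv.funSplitAt k α).symm (b, g) := by
    intro a b g
    funext j
    by_cases hj : j = k
    · subst hj; simp [Equiv.funSplitAt, Equiv.piSplitAt]
    · simp [Equiv.funSplitAt, Equiv.piSplitAt, hj]
  simp only [e]
  rw [Finset.sum_const, nsmul_eq_mul, Finset.card_univ, Finset.sum_comm]

variable {n : ℕ}

/-- A layer, as drawn from two numbers below `D`. -/
def toLayer {D : ℕ} (y : Fin D × Fin D) : ℕ × ℕ := (y.1, y.2)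

/-- Extend a finite path by irrelevant layers. -/
def extPath {D K : ℕ} (p : Fin K → Fin D × Fin D) (k : ℕ) : ℕ × ℕ :=
  if h : k < K then toLayer (p ⟨k, h⟩) else (0, 0)

/-- Extend a finite family of finite paths by irrelevant layers. -/
def extPaths {D K M : ℕ} (W : Fin M → Fin K → Fin D × Fin D) (i : ℕ) : ℕ → ℕ × ℕ :=
  if h : i < M then extPath (W ⟨i, h⟩) else fun _ => (0, 0)

/-- A real number `a ≥ 0` is the number of `u < D` with `u + 1 ≤ a`, up to a rounding error of at
most `1`, as long as it is below `D`. -/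
theorem card_filter_add_one_le (D : ℕ) {a : ℝ} (h0 : 0 ≤ a) :
    ((Finset.univ.filter fun u : Fin D => ((u : ℕ) : ℝ) + 1 ≤ a).card : ℝ) ≤ a ∧
    (a < D → a - 1 ≤ (Finset.univ.filter
      fun u : Fin D => ((u : ℕ) : ℝ) + 1 ≤ a).card) := by
  have e : (Finset.univ.filter fun u : Fin D => ((u : ℕ) : ℝ) + 1 ≤ a) =
      Finset.univ.filter fun u : Fin D => (u : ℕ) < ⌊a⌋₊ := by
    ext u
    simp only [Finset.mem_filter, Finset.mem_univ, true_and]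
    rw [Nat.lt_iff_add_one_le, Nat.le_floor_iff h0]
    push_cast
    rfl
  rw [e, Fin.card_filter_val_lt]
  refine ⟨?_, fun h => ?_⟩
  · refine le_trans ?_ (Nat.floor_le h0)
    exact_mod_cast min_le_right _ _
  · have : ⌊a⌋₊ ≤ D := by
      have := (Nat.floor_lt h0).2 h
      omega
    rw [min_eq_right this]
    have := Nat.lt_floor_add_one a
    linarith

section Layer

variable {f : Finset (Fin n) → ℝ} {c : Fin n → ℝ} {D : ℕ}

/-- The number of layers that add `j`. -/
theorem sum_layer_indicator (hD : n ≤ D) (x : Fin n → ℝ) (j : Fin n) :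
    ∑ y : Fin D × Fin D, (if j ∈ pick D x (toLayer y) then (1 : ℝ) else 0) =
      (Finset.univ.filter fun u : Fin D => ((u : ℕ) : ℝ) + 1 ≤ D * x j).card := by
  rw [Fintype.sum_prod_type, Finset.sum_eq_single (⟨j, j.2.trans_le hD⟩ : Fin D)]
  · rw [Finset.card_filter]
    push_cast
    refine Finset.sum_congr rfl fun u _ => ?_
    simp only [mem_pick, toLayer, true_and]
  · intro a _ ha
    refine Finset.sum_eq_zero fun u _ => if_neg fun h => ha ?_
    exact Fin.ext (Finset.mem_filter.1 h).2.1.symm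
  · simp

/-- A layer adds at most one element, so its effect on the residual cost is linear. -/
theorem resid_union_pick (x : Fin n → ℝ) (S : Finset (Fin n)) (y : ℕ × ℕ) :
    resid f c (S ∪ pick D x y) =
      resid f c S - ∑ j, gain f c S j * (if j ∈ pick D x y then 1 else 0) := by
  rcases (pick D x y).eq_empty_or_nonempty with h | ⟨j, hj⟩
  · simp [h]
  · have e : pick D x y = {j} := by
      ext i
      simp only [pick, Finset.mem_filter, Finset.mem_univ, true_and, Finset.mem_singleton] at hj ⊢
      constructor
      · rintro ⟨h1, -⟩
        exact Fin.ext (h1.trans hj.1.symm)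
      · rintro rfl
        exact hj
    rw [e]
    simp [gain]

/-- A random layer decreases the residual cost by a constant factor, unless the constraint is
violated. -/
theorem sum_resid_pick_le (hm : Monotone f) (hs : IsSubmodular f) (hc : ∀ j, 0 ≤ c j)
    (hD : 4 * n ≤ D) (hD1 : 1 ≤ D) {x : Fin n → ℝ} (hx : ∀ j, 0 ≤ x j) {S : Finset (Fin n)}
    (hS : sat x ⊆ S) (hv : ¬ Violated f c x S) :
    ∑ y : Fin D × Fin D, resid f c (S ∪ pick D x (toLayer y)) ≤
      (D : ℝ) ^ 2 * ((1 - 1 / (4 * D)) * resid f c S) := by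
  have hDpos : (0 : ℝ) < D := by exact_mod_cast hD1
  have hD4 : (4 * n : ℝ) ≤ D := by exact_mod_cast hD
  have hg := gain_nonneg hm hs hc S
  simp only [resid_union_pick]
  rw [Finset.sum_sub_distrib, Finset.sum_comm]
  simp only [← Finset.mul_sum, sum_layer_indicator (show n ≤ D by omega)]
  have h1 : ∀ j, gain f c S j * (D * x j - 1) ≤ gain f c S j *
      (Finset.univ.filter fun u : Fin D => ((u : ℕ) : ℝ) + 1 ≤ D * x j).card := by
    intro j
    by_cases hj : j ∈ S
    · rw [gain_eq_zero hj, zero_mul, zero_mul]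
    · have hx1 : x j < 1 := by
        by_contra! hcon
        exact hj (hS (by simpa [sat] using hcon))
      refine mul_le_mul_of_nonneg_left ?_ (hg j)
      exact (card_filter_add_one_le D (mul_nonneg hDpos.le (hx j))).2 (by nlinarith)
  have h2 := Finset.sum_le_sum fun j (_ : j ∈ Finset.univ) => h1 j
  have h3 : ∑ j, gain f c S j * (D * x j - 1) =
      D * ∑ j, gain f c S j * x j - ∑ j, gain f c S j := by
    rw [Finset.mul_sum, ← Finset.sum_sub_distrib]
    exact Finset.sum_congr rfl fun j _ => by ring
  have h4 : ∑ j, gain f c S j ≤ n * resid f c S := by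
    refine (Finset.sum_le_sum fun j _ => gain_le hm hc S j).trans ?_
    simp
  have hr : 0 ≤ resid f c S := resid_nonneg hm hc S
  have h5 : (n : ℝ) * resid f c S ≤ D / 4 * resid f c S :=
    mul_le_mul_of_nonneg_right (by linarith) hr
  have h6 : D / 2 * resid f c S ≤ D * ∑ j, gain f c S j * x j := by
    rw [Violated, not_lt] at hv
    nlinarith
  have h7 : (D : ℝ) ^ 2 * ((1 - 1 / (4 * D)) * resid f c S) =
      D ^ 2 * resid f c S - D / 4 * resid f c S := by
    field_simp
  rw [h7, Finset.sum_const, Finset.card_univ, Fintype.card_prod, Fintype.card_fin, nsmul_eq_mul]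
  push_cast
  -- half of the constraint, minus at most `n ≤ D / 4` times the residual cost lost by rounding
  have h8 : D / 2 * resid f c S = D / 4 * resid f c S + D / 4 * resid f c S := by ring
  linarith

/-- A random layer costs on average at most the fraction `1 / D` of the fractional cost. -/
theorem sum_cost_pick_le (hc : ∀ j, 0 ≤ c j) (hD : n ≤ D) {x : Fin n → ℝ}
    (hx : ∀ j, 0 ≤ x j) :
    ∑ y : Fin D × Fin D, cost c (pick D x (toLayer y)) ≤ D * ∑ j, c j * x j := by
  have e : ∀ y : Fin D × Fin D, cost c (pick D x (toLayer y)) =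
      ∑ j, c j * (if j ∈ pick D x (toLayer y) then 1 else 0) := fun y => by
    simp [cost, Finset.sum_ite_mem]
  simp only [e]
  rw [Finset.sum_comm]
  simp only [← Finset.mul_sum, sum_layer_indicator hD]
  rw [Finset.mul_sum]
  refine Finset.sum_le_sum fun j _ => ?_
  have := mul_le_mul_of_nonneg_left
    (card_filter_add_one_le D (mul_nonneg (Nat.cast_nonneg D) (hx j))).1 (hc j)
  linarith

end Layer

section Path

variable {f : Finset (Fin n) → ℝ} {c : Fin n → ℝ} {D K : ℕ}

theorem extPath_update_of_ne (p : Fin K → Fin D × Fin D) (k : Fin K) (a : Fin D × Fin D) {i : ℕ}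
    (h : i ≠ k) : extPath (Function.update p k a) i = extPath p i := by
  unfold extPath
  split_ifs with hi
  · rw [Function.update_of_ne]
    intro he
    exact h (congrArg Fin.val he)
  · rfl

theorem extPath_update_self (p : Fin K → Fin D × Fin D) (k : Fin K) (a : Fin D × Fin D) :
    extPath (Function.update p k a) k = toLayer a := by
  simp [extPath]

open Classical in
/-- The residual cost of the rounded solution after `k` layers, if no constraint on the way is
violated, and `0` otherwise. -/
noncomputable def goodResid (f : Finset (Fin n) → ℝ) (c : Fin n → ℝ) (D : ℕ) (x : Fin n → ℝ)
    (y : ℕ → ℕ × ℕ) (k : ℕ) : ℝ :=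
  if ∀ i < k, ¬ Violated f c x (layers D x y i ∪ sat x) then resid f c (layers D x y k) else 0

theorem goodResid_nonneg (hm : Monotone f) (hc : ∀ j, 0 ≤ c j) (x : Fin n → ℝ)
    (y : ℕ → ℕ × ℕ) (k : ℕ) : 0 ≤ goodResid f c D x y k := by
  unfold goodResid
  split_ifs
  · exact resid_nonneg hm hc _
  · exact le_rfl

/-- On average over the paths, the residual cost decreases geometrically. -/
theorem sum_goodResid_le (hm : Monotone f) (hs : IsSubmodular f) (hc : ∀ j, 0 ≤ c j)
    (hD : 4 * n ≤ D) (hD1 : 1 ≤ D) {x : Fin n → ℝ} (hx : ∀ j, 0 ≤ x j) {k : ℕ} (hk : k ≤ K) :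
    ∑ p : Fin K → Fin D × Fin D, goodResid f c D x (extPath p) k ≤
      Fintype.card (Fin K → Fin D × Fin D) * ((1 - 1 / (4 * D)) ^ k * resid f c ∅) := by
  have hDpos : (1 : ℝ) ≤ D := by exact_mod_cast hD1
  have hq : (0 : ℝ) ≤ 1 - 1 / (4 * D) := by
    rw [sub_nonneg, div_le_one (by linarith)]
    linarith
  induction k with
  | zero => simp [goodResid, layers]
  | succ k ih =>
    have ih := ih (by omega)
    have hstep : ∀ p : Fin K → Fin D × Fin D,
        ∑ a, goodResid f c D x (extPath (Function.update p ⟨k, hk⟩ a)) (k + 1) ≤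
        (D : ℝ) ^ 2 * ((1 - 1 / (4 * D)) * goodResid f c D x (extPath p) k) := by
      intro p
      have hl : ∀ a, ∀ i ≤ k, layers D x (extPath (Function.update p ⟨k, hk⟩ a)) i =
          layers D x (extPath p) i := fun a i hi =>
        layers_congr fun i' hi' => extPath_update_of_ne p _ a (show i' ≠ k by omega)
      have hvio : ∀ a, (∀ i < k + 1, ¬ Violated f c x
          (layers D x (extPath (Function.update p ⟨k, hk⟩ a)) i ∪ sat x)) ↔
          ∀ i < k + 1, ¬ Violated f c x (layers D x (extPath p) i ∪ sat x) := fun a =>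
        forall₂_congr fun i hi => by rw [hl a i (by omega)]
      by_cases hgood : ∀ i < k + 1, ¬ Violated f c x (layers D x (extPath p) i ∪ sat x)
      · have e1 : ∀ a, goodResid f c D x (extPath (Function.update p ⟨k, hk⟩ a)) (k + 1) =
            resid f c (layers D x (extPath p) k ∪ sat x ∪ pick D x (toLayer a)) := by
          intro a
          rw [goodResid, if_pos ((hvio a).2 hgood), layers, hl a k le_rfl]
          have := extPath_update_self p ⟨k, hk⟩ a
          simp only at this
          rw [this]
        simp only [e1]
        refine (sum_resid_pick_le hm hs hc hD hD1 hx Finset.subset_union_right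
          (hgood k (by omega))).trans ?_
        rw [goodResid, if_pos fun i hi => hgood i (by omega)]
        refine mul_le_mul_of_nonneg_left (mul_le_mul_of_nonneg_left ?_ hq) (by positivity)
        exact resid_antitone hm hs hc Finset.subset_union_left
      · have e1 : ∀ a, goodResid f c D x (extPath (Function.update p ⟨k, hk⟩ a)) (k + 1) = 0 :=
          fun a => if_neg fun h => hgood ((hvio a).1 h)
        simp only [e1, Finset.sum_const_zero]
        have := goodResid_nonneg (D := D) hm hc x (extPath p) k
        positivity
    have hsum := sum_update_eq (⟨k, hk⟩ : Fin K)
      (fun p : Fin K → Fin D × Fin D => goodResid f c D x (extPath p) (k + 1))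
    have h1 := Finset.sum_le_sum fun p (_ : p ∈ Finset.univ) => hstep p
    rw [hsum, ← Finset.mul_sum, ← Finset.mul_sum, Fintype.card_prod, Fintype.card_fin] at h1
    push_cast at h1
    rw [← sq] at h1
    have h2 := le_of_mul_le_mul_left h1 (by positivity)
    refine h2.trans ((mul_le_mul_of_nonneg_left ih hq).trans (le_of_eq ?_))
    ring

theorem sum_path_apply (k : Fin K) (g : Fin D × Fin D → ℝ) (hD1 : 1 ≤ D) :
    ∑ p : Fin K → Fin D × Fin D, g (p k) =
      Fintype.card (Fin K → Fin D × Fin D) * ((∑ y, g y) / D ^ 2) := by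
  have hDpos : (1 : ℝ) ≤ D := by exact_mod_cast hD1
  have := sum_update_eq k (fun p : Fin K → Fin D × Fin D => g (p k))
  simp only [Function.update_self, Finset.sum_const, nsmul_eq_mul, Finset.card_univ] at this
  rw [Fintype.card_prod, Fintype.card_fin] at this
  push_cast at this
  field_simp
  linarith

/-- On average over the paths, every `D` layers cost at most as much as the fractional solution.
The saturated elements account for the summand `1`. -/
theorem sum_cost_layers_le (hc : ∀ j, 0 ≤ c j) (hD : n ≤ D) (hD1 : 1 ≤ D) {x : Fin n → ℝ}
    (hx : ∀ j, 0 ≤ x j) {k : ℕ} (hk : k ≤ K) :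
    ∑ p : Fin K → Fin D × Fin D, cost c (layers D x (extPath p) k) ≤
      Fintype.card (Fin K → Fin D × Fin D) * ((1 + k / D) * ∑ j, c j * x j) := by
  have hDpos : (1 : ℝ) ≤ D := by exact_mod_cast hD1
  have hX : 0 ≤ ∑ j, c j * x j := Finset.sum_nonneg fun j _ => mul_nonneg (hc j) (hx j)
  have hsat : cost c (sat x) ≤ ∑ j, c j * x j := by
    rw [cost, sat, Finset.sum_filter]
    refine Finset.sum_le_sum fun j _ => ?_
    split_ifs with h
    · exact le_mul_of_one_le_right (hc j) h
    · exact mul_nonneg (hc j) (hx j)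
  have hpt : ∀ p : Fin K → Fin D × Fin D, cost c (layers D x (extPath p) k ∪ sat x) ≤
      ∑ j, c j * x j + ∑ i ∈ Finset.range k, cost c (pick D x (extPath p i)) := by
    intro p
    clear hk
    induction k with
    | zero => simpa [layers] using hsat
    | succ k ih =>
      rw [Finset.sum_range_succ, layers, Finset.union_right_comm _ _ (sat x),
        Finset.union_assoc _ (sat x) (sat x), Finset.union_self]
      have := cost_union_le hc (layers D x (extPath p) k ∪ sat x) (pick D x (extPath p k))
      linarith
  have hpick : ∀ i ∈ Finset.range k,
      ∑ p : Fin K → Fin D × Fin D, cost c (pick D x (extPath p i)) ≤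
      Fintype.card (Fin K → Fin D × Fin D) * ((1 / D) * ∑ j, c j * x j) := by
    intro i hi
    have hi' : i < K := (Finset.mem_range.1 hi).trans_le hk
    have e : ∀ p : Fin K → Fin D × Fin D, extPath p i = toLayer (p ⟨i, hi'⟩) := fun p => by
      simp [extPath, hi']
    simp only [e]
    rw [sum_path_apply ⟨i, hi'⟩ (fun y => cost c (pick D x (toLayer y))) hD1]
    refine mul_le_mul_of_nonneg_left ?_ (Nat.cast_nonneg _)
    rw [div_le_iff₀ (by positivity)]
    refine (sum_cost_pick_le hc hD hx).trans (le_of_eq ?_)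
    field_simp
  have h1 := Finset.sum_le_sum fun p (_ : p ∈ Finset.univ) =>
    (cost_mono hc Finset.subset_union_left).trans (hpt p)
  refine h1.trans ?_
  rw [Finset.sum_add_distrib, Finset.sum_const, Finset.sum_comm, Finset.card_univ, nsmul_eq_mul]
  refine (add_le_add_right (Finset.sum_le_sum hpick) _).trans (le_of_eq ?_)
  rw [Finset.sum_const, Finset.card_range, nsmul_eq_mul]
  ring

end Path

/-- A stage of `D` layers decreases the residual cost by the factor `4 / 5`. -/
theorem one_sub_pow_le {D : ℕ} (hD1 : 1 ≤ D) (s : ℕ) :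
    (1 - 1 / (4 * D) : ℝ) ^ (s * D) ≤ (4 / 5) ^ s := by
  have hDpos : (1 : ℝ) ≤ D := by exact_mod_cast hD1
  have hq : (0 : ℝ) ≤ 1 - 1 / (4 * D) := by
    rw [sub_nonneg, div_le_one (by linarith)]
    linarith
  rw [mul_comm s D, pow_mul]
  refine pow_le_pow_left₀ (pow_nonneg hq _) ?_ s
  have h1 : (1 - 1 / (4 * D) : ℝ) ≤ Real.exp (-(1 / (4 * D))) := by
    have := Real.add_one_le_exp (-(1 / (4 * (D : ℝ))))
    linarith
  refine (pow_le_pow_left₀ hq h1 D).trans ?_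
  rw [← Real.exp_nat_mul]
  have h2 : (D : ℝ) * -(1 / (4 * D)) = -(1 / 4) := by field_simp
  rw [h2, Real.exp_neg, inv_le_comm₀ (Real.exp_pos _) (by norm_num)]
  have := Real.add_one_le_exp (1 / 4 : ℝ)
  norm_num at this ⊢
  linarith

theorem sum_inv_sq_le (T : ℕ) :
    ∑ t ∈ Finset.range T, 1 / (((t + 1 : ℕ) : ℝ) * ((t + 1 : ℕ) : ℝ)) ≤ 2 := by
  have : ∀ T : ℕ, ∑ t ∈ Finset.range (T + 1), 1 / (((t + 1 : ℕ) : ℝ) * ((t + 1 : ℕ) : ℝ)) ≤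
      2 - 1 / ((T : ℝ) + 1) := by
    intro T
    induction T with
    | zero => norm_num
    | succ T ih =>
      rw [Finset.sum_range_succ]
      have : 1 / (((T + 1 + 1 : ℕ) : ℝ) * ((T + 1 + 1 : ℕ) : ℝ)) ≤
          1 / ((T : ℝ) + 1) - 1 / (((T + 1 : ℕ) : ℝ) + 1) := by
        have hT : (0 : ℝ) ≤ T := Nat.cast_nonneg T
        push_cast
        rw [div_sub_div _ _ (by positivity) (by positivity),
          div_le_div_iff₀ (by positivity) (by positivity)]
        nlinarith
      linarith
  cases T with
  | zero => norm_num
  | succ T =>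
    have h := this T
    have : (0 : ℝ) ≤ 1 / ((T : ℝ) + 1) := by positivity
    linarith

theorem sum_geom_le (m : ℕ) : ∑ s ∈ Finset.range m, (8 / 9 : ℝ) ^ s ≤ 9 := by
  have h := geom_sum_eq (show (8 / 9 : ℝ) ≠ 1 by norm_num) m
  rw [h]
  have : (0 : ℝ) ≤ (8 / 9) ^ m := by positivity
  rw [div_le_iff_of_neg (by norm_num)]
  linarith

end Expectation

section ExpectedCost

variable {n : ℕ}

theorem threshold_nonneg (g : Finset (Fin n) → ℝ) (t s : ℕ) : 0 ≤ threshold g t s := by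
  have := maxSingle_nonneg (f := g)
  unfold threshold
  positivity

/-- If no small marginal is met, completing `R` costs at most the residual cost over the threshold. -/
theorem cost_fill_le_div {g : Finset (Fin n) → ℝ} {c : Fin n → ℝ} (hm : Monotone g)
    (hs : IsSubmodular g) (hc : ∀ j, 0 ≤ c j) {t s : ℕ} (ht : 1 ≤ t) {R : Finset (Fin n)}
    (h : ¬ Small g c t s R) : cost c (fill g c R) ≤ resid g c R / threshold g t s := by
  have ht' : (1 : ℝ) ≤ t := by exact_mod_cast ht
  rcases (maxSingle_nonneg (f := g)).eq_or_lt with h0 | h0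
  -- the threshold may vanish, but only if there is nothing to buy
  · have : fill g c R = ∅ := by
      rw [fill, Finset.filter_eq_empty_iff]
      intro l _ hl
      have := marginal_le_maxSingle hm hs l (R ∪ prec c l)
      linarith
    rw [this, threshold, ← h0]
    simp [cost]
  · have hpos : 0 < threshold g t s := by unfold threshold; positivity
    rw [le_div_iff₀ hpos]
    refine cost_fill_mul_le hm hc fun l hl => ?_
    by_contra! hcon
    exact h ⟨l, hl, hcon⟩

/-- The average cost of completing the rounded solution after `s` stages, as long as no constraint
is violated on the way. -/
theorem sum_goodResid_div_le {g : Finset (Fin n) → ℝ} {c : Fin n → ℝ} (hm : Monotone g)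
    (hs : IsSubmodular g) (h3 : IsIncreasing 3 g) (hc : ∀ j, 0 ≤ c j) {D : ℕ}
    (hD : 4 * n ≤ D) (hD1 : 1 ≤ D) {O : Finset (Fin n)} (hO : IsCover g O) {x : Fin n → ℝ}
    (hx : ∀ j, 0 ≤ x j) {t s Sm : ℕ} (ht : 1 ≤ t) (hsm : s ≤ Sm) :
    ∑ p : Fin (Sm * D) → Fin D × Fin D,
        goodResid g c D x (extPath p) (s * D) / threshold g t s ≤
      Fintype.card (Fin (Sm * D) → Fin D × Fin D) *
        ((8 / 9) ^ s * (cost c O * (1 / (t * t)))) := by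
  have ht' : (1 : ℝ) ≤ t := by exact_mod_cast ht
  have hcO := cost_nonneg hc O
  rcases (maxSingle_nonneg (f := g)).eq_or_lt with h0 | h0
  · simp only [threshold, ← h0, zero_mul, div_zero, Finset.sum_const_zero]
    positivity
  · have hpos : 0 < threshold g t s := by unfold threshold; positivity
    rw [← Finset.sum_div, div_le_iff₀ hpos]
    refine (sum_goodResid_le hm hs hc hD hD1 hx (Nat.mul_le_mul_right D hsm)).trans ?_
    rw [mul_assoc]
    refine mul_le_mul_of_nonneg_left ?_ (Nat.cast_nonneg _)
    refine (mul_le_mul (one_sub_pow_le hD1 s) (resid_empty_le hm hs h3 hc hO)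
      (resid_nonneg hm hc _) (by positivity)).trans (le_of_eq ?_)
    have : (4 / 5 : ℝ) ^ s = (8 / 9) ^ s * (9 / 10) ^ s := by rw [← mul_pow]; norm_num
    rw [this, threshold]
    field_simp

variable {c : Fin n → ℝ} {f : ℕ → Finset (Fin n) → ℝ} {T D M q Sm : ℕ}

open Classical in
/-- The cost of the solution if the path `i` never causes an update, and `0` otherwise. -/
noncomputable def quietCost (f : ℕ → Finset (Fin n) → ℝ) (c : Fin n → ℝ) (D M T : ℕ)
    (w : ℕ → ℕ → ℕ × ℕ) (i : ℕ) : ℝ :=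
  if (run f c D M w T).cnt i = 0 then
    cost c (rounded D w i (run f c D M w T)) + cost c (fills f c D M w i T) else 0

/-- The number of stages of the path `i` depends on its layers. The sum over all possible numbers
of stages gets rid of this dependence. -/
theorem fill_le_sum_goodResid (h : Admissible c f T D) (hS : StageBound f c T Sm)
    (hD : D = 2 ^ q) {w : ℕ → ℕ → ℕ × ℕ} {i : ℕ} (hi : i < M) {t : ℕ} (ht : t + 1 ≤ T) :
    cost c (fill (f (t + 1)) c (rounded D w i (run f c D M w (t + 1)))) ≤
      ∑ s ∈ Finset.range (Sm + 1),
        goodResid (f (t + 1)) c D (run f c D M w (t + 1)).x (w i) (s * D) /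
          threshold (f (t + 1)) (t + 1) s := by
  have hm := h.inst.mono (t + 1) (by omega) ht
  have hs := h.inst.submodular (t + 1) (by omega) ht
  have hc := h.inst.cost_nonneg
  obtain ⟨h1, h2⟩ := standstill (sweep_settle (run_settles (w := w) (M := M) h hS hD ht)) hi
  change (pass (f (t + 1)) c D (run f c D M w (t + 1)).x (w i)
    ((run f c D M w (t + 1)).s i * D)).cnt = 0 at h1
  change ¬ Small (f (t + 1)) c (t + 1) ((run f c D M w (t + 1)).s i)
    (rounded D w i (run f c D M w (t + 1))) at h2
  obtain ⟨-, -, h3⟩ := pass_of_cnt_eq_zero h1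
  have h4 := cost_fill_le_div hm hs hc (by omega) h2
  have h5 : resid (f (t + 1)) c (rounded D w i (run f c D M w (t + 1))) =
      goodResid (f (t + 1)) c D (run f c D M w (t + 1)).x (w i)
        ((run f c D M w (t + 1)).s i * D) := by
    rw [goodResid, if_pos h3]; rfl
  rw [h5] at h4
  refine h4.trans ?_
  have hle := (run_inv (w := w) (M := M) h hS hD ht).stages i
  exact Finset.single_le_sum (f := fun s =>
    goodResid (f (t + 1)) c D (run f c D M w (t + 1)).x (w i) (s * D) /
      threshold (f (t + 1)) (t + 1) s)
    (fun s _ => div_nonneg (goodResid_nonneg hm hc _ _ _) (threshold_nonneg _ _ _))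
    (Finset.mem_range.2 (Nat.lt_succ_of_le hle))

theorem extPaths_update_of_ne {K : ℕ} (W : Fin M → Fin K → Fin D × Fin D) (i : Fin M)
    (p : Fin K → Fin D × Fin D) {j : ℕ} (hj : j ≠ i) :
    extPaths (Function.update W i p) j = extPaths W j := by
  unfold extPaths
  split_ifs with h
  · rw [Function.update_of_ne]
    intro he
    exact hj (congrArg Fin.val he)
  · rfl

theorem extPaths_update_self {K : ℕ} (W : Fin M → Fin K → Fin D × Fin D) (i : Fin M)
    (p : Fin K → Fin D × Fin D) : extPaths (Function.update W i p) i = extPath p := by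
  simp [extPaths]

/-- If all paths but `i` are fixed, the average over the path `i` of the cost of the solution, as
far as that path never causes an update: the fractional solutions are then independent of the
path `i`, and its layers behave like fresh random layers. -/
theorem sum_quietCost_update_le (h : Admissible c f T D) (hS : StageBound f c T Sm)
    (hD : D = 2 ^ q) {O : Finset (Fin n)} (hO : ∀ t, 1 ≤ t → t ≤ T → IsCover (f t) O)
    (W : Fin M → Fin (Sm * D) → Fin D × Fin D) (i : Fin M) :
    ∑ p, quietCost f c D M T (extPaths (Function.update W i p)) i ≤
      Fintype.card (Fin (Sm * D) → Fin D × Fin D) *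
        ((1 + Sm) * (2 * Real.log (4 * D) * cost c O) + 18 * cost c O) := by
  have hc := h.inst.cost_nonneg
  have hcO := cost_nonneg hc O
  have hD1 := h.pos
  have hDpos : (1 : ℝ) ≤ D := by exact_mod_cast hD1
  have hlog : 0 ≤ Real.log (4 * D) := Real.log_nonneg (by linarith)
  by_cases hex : ∃ p, (run f c D M (extPaths (Function.update W i p)) T).cnt i = 0
  swap
  · push Not at hex
    have e : ∀ p, quietCost f c D M T (extPaths (Function.update W i p)) i = 0 :=
      fun p => if_neg (hex p)
    simp only [e, Finset.sum_const_zero]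
    positivity
  obtain ⟨p₀, hp₀⟩ := hex
  set w₀ := extPaths (Function.update W i p₀) with hw₀
  -- the fractional solutions, which are the same for all quiet choices of the path `i`
  let y : ℕ → Fin n → ℝ := fun t => (run f c D M w₀ t).x
  have hy : ∀ t ≤ T, InRange c D (y t) := fun t ht =>
    (run_inv (w := w₀) (M := M) h hS hD ht).inRange
  have hpt : ∀ p, quietCost f c D M T (extPaths (Function.update W i p)) i ≤
      cost c (layers D (y T) (extPath p) (Sm * D)) +
      ∑ t ∈ Finset.range T, ∑ s ∈ Finset.range (Sm + 1),
        goodResid (f (t + 1)) c D (y (t + 1)) (extPath p) (s * D) /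
          threshold (f (t + 1)) (t + 1) s := by
    intro p
    set w := extPaths (Function.update W i p) with hw
    unfold quietCost
    split_ifs with h0
    · have hx : ∀ t ≤ T, (run f c D M w t).x = y t := by
        intro t ht
        refine (run_sameExcept (w := w) (w' := w₀) h hS hD (i := i) (fun j hj => ?_) ht
          (Nat.le_zero.1 (((run_mono h hS hD ht le_rfl).2.2 i).trans h0.le))
          (Nat.le_zero.1 (((run_mono h hS hD ht le_rfl).2.2 i).trans hp₀.le))).1
        rw [hw, hw₀, extPaths_update_of_ne _ _ _ hj, extPaths_update_of_ne _ _ _ hj]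
      have hwi : w i = extPath p := extPaths_update_self W i p
      refine add_le_add ?_ ((cost_fills_le hc _ _).trans (Finset.sum_le_sum fun t ht => ?_))
      · rw [rounded, hx T le_rfl, hwi]
        exact cost_mono hc (layers_mono (fun _ => le_rfl) _
          (Nat.mul_le_mul_right D ((run_inv h hS hD le_rfl).stages i)))
      · have ht := Finset.mem_range.1 ht
        have := fill_le_sum_goodResid (w := w) h hS hD i.2 (t := t) (by omega)
        rwa [hx (t + 1) (by omega), hwi] at this
    · refine add_nonneg (cost_nonneg hc _) (Finset.sum_nonneg fun t ht =>
        Finset.sum_nonneg fun s _ => div_nonneg (goodResid_nonneg ?_ hc _ _ _)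
          (threshold_nonneg _ _ _))
      have ht := Finset.mem_range.1 ht
      exact h.inst.mono (t + 1) (by omega) (by omega)
  refine (Finset.sum_le_sum fun p _ => hpt p).trans ?_
  rw [Finset.sum_add_distrib, mul_add]
  have hX := fractional_cost_le (M := M) hc hD1
    ((run_inv (w := w₀) h hS hD le_rfl).reaches O hO)
  refine add_le_add ?_ ?_
  · refine (sum_cost_layers_le hc (by have := h.le; omega) hD1 (hy T le_rfl).nonneg le_rfl).trans ?_
    refine mul_le_mul_of_nonneg_left ?_ (Nat.cast_nonneg _)
    have e : (1 : ℝ) + ((Sm * D : ℕ) : ℝ) / D = 1 + Sm := by push_cast; field_simp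
    rw [e]
    exact mul_le_mul_of_nonneg_left hX (by positivity)
  · rw [Finset.sum_comm]
    have h1 : ∀ t ∈ Finset.range T, ∑ p : Fin (Sm * D) → Fin D × Fin D,
        ∑ s ∈ Finset.range (Sm + 1),
          goodResid (f (t + 1)) c D (y (t + 1)) (extPath p) (s * D) /
            threshold (f (t + 1)) (t + 1) s ≤
        Fintype.card (Fin (Sm * D) → Fin D × Fin D) * (9 * (cost c O *
          (1 / (((t + 1 : ℕ) : ℝ) * ((t + 1 : ℕ) : ℝ))))) := by
      intro t ht
      have ht := Finset.mem_range.1 ht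
      rw [Finset.sum_comm]
      refine (Finset.sum_le_sum fun s hs => sum_goodResid_div_le
        (h.inst.mono (t + 1) (by omega) (by omega))
        (h.inst.submodular (t + 1) (by omega) (by omega))
        (h.inc (t + 1) (by omega) (by omega)) hc h.le hD1 (hO (t + 1) (by omega) (by omega))
        (hy (t + 1) (by omega)).nonneg (by omega)
        (Nat.lt_succ_iff.1 (Finset.mem_range.1 hs))).trans ?_
      rw [← Finset.mul_sum, ← Finset.sum_mul]
      refine mul_le_mul_of_nonneg_left ?_ (Nat.cast_nonneg _)
      exact mul_le_mul_of_nonneg_right (sum_geom_le _) (by positivity)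
    refine (Finset.sum_le_sum h1).trans ?_
    rw [← Finset.mul_sum, ← Finset.mul_sum, ← Finset.mul_sum]
    refine mul_le_mul_of_nonneg_left ?_ (Nat.cast_nonneg _)
    have := mul_le_mul_of_nonneg_left (sum_inv_sq_le T) hcO
    linarith

/-- The cost of the solution, summed over all choices of the paths and of the secret path. -/
theorem sum_cost_solution_le (h : Admissible c f T D) (hS : StageBound f c T Sm)
    (hD : D = 2 ^ q) {O : Finset (Fin n)} (hO : ∀ t, 1 ≤ t → t ≤ T → IsCover (f t) O)
    (hM : n * (q + 2) * D ≤ M) :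
    ∑ W : Fin M → Fin (Sm * D) → Fin D × Fin D, ∑ i : Fin M,
        cost c (solution f c D M (extPaths W) i T) ≤
      Fintype.card (Fin M → Fin (Sm * D) → Fin D × Fin D) *
        (M * ((2 + Sm) * (2 * Real.log (4 * D) * cost c O) + 19 * cost c O)) := by
  have hc := h.inst.cost_nonneg
  have hcO := cost_nonneg hc O
  have hD1 := h.pos
  have hDpos : (1 : ℝ) ≤ D := by exact_mod_cast hD1
  set X := 2 * Real.log (4 * D) * cost c O with hX
  have hX0 : 0 ≤ X := by
    have : 0 ≤ Real.log (4 * D) := Real.log_nonneg (by linarith)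
    positivity
  have hpt : ∀ (W : Fin M → Fin (Sm * D) → Fin D × Fin D) (i : Fin M),
      cost c (solution f c D M (extPaths W) i T) ≤ quietCost f c D M T (extPaths W) i +
        ((run f c D M (extPaths W) T).cnt i) * (D * X + n * cost c O) := by
    intro W i
    have h1 := (cost_mono hc (solution_subset (w := extPaths W) (M := M) h hS hD i le_rfl)).trans
      (cost_union_le hc _ _)
    refine h1.trans ?_
    unfold quietCost
    split_ifs with h0
    · rw [h0]; simp
    · have h2 := cost_fills_le_card_mul (w := extPaths W) (M := M) h hO i
      have hinv := run_inv (w := extPaths W) (M := M) h hS hD le_rfl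
      have h3 : cost c (rounded D (extPaths W) i (run f c D M (extPaths W) T)) ≤ D * X := by
        refine (cost_layers_le_mul hc hD1 hinv.inRange.nonneg _ _).trans ?_
        exact mul_le_mul_of_nonneg_left (fractional_cost_le hc hD1 (hinv.reaches O hO))
          (by linarith)
      have h4 : (1 : ℝ) ≤ (run f c D M (extPaths W) T).cnt i := by
        exact_mod_cast Nat.one_le_iff_ne_zero.2 h0
      have h5 : (0 : ℝ) ≤ D * X + n * cost c O := by positivity
      have h6 := mul_le_mul_of_nonneg_right h4 h5
      linarith
  refine (Finset.sum_le_sum fun W _ => Finset.sum_le_sum fun i _ => hpt W i).trans ?_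
  simp only [Finset.sum_add_distrib]
  -- the secret path rarely causes an update
  have hloud : ∀ W : Fin M → Fin (Sm * D) → Fin D × Fin D,
      ∑ i : Fin M, ((run f c D M (extPaths W) T).cnt i : ℝ) * (D * X + n * cost c O) ≤
        M * (X + cost c O) := by
    intro W
    have hu := (run_inv (w := extPaths W) (M := M) h hS hD le_rfl).updates_le hD
    rw [← Finset.sum_mul]
    have e : ∑ i : Fin M, ((run f c D M (extPaths W) T).cnt i : ℝ) =
        (updates M (run f c D M (extPaths W) T) : ℝ) := by
      rw [updates, Finset.sum_range]; push_cast; rfl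
    rw [e]
    have h1 : (updates M (run f c D M (extPaths W) T) : ℝ) * D ≤ M := by
      exact_mod_cast (Nat.mul_le_mul_right D hu).trans hM
    have h2 : (n : ℝ) * cost c O ≤ D * cost c O := by
      refine mul_le_mul_of_nonneg_right ?_ hcO
      have := h.le
      exact_mod_cast (show n ≤ D by omega)
    have h3 : (0 : ℝ) ≤ (updates M (run f c D M (extPaths W) T) : ℝ) := Nat.cast_nonneg _
    calc (updates M (run f c D M (extPaths W) T) : ℝ) * (D * X + n * cost c O)
        ≤ (updates M (run f c D M (extPaths W) T) : ℝ) * (D * X + D * cost c O) :=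
          mul_le_mul_of_nonneg_left (by linarith) h3
      _ = (updates M (run f c D M (extPaths W) T) : ℝ) * D * (X + cost c O) := by ring
      _ ≤ M * (X + cost c O) := mul_le_mul_of_nonneg_right h1 (by positivity)
  have hquiet : ∀ i : Fin M, ∑ W : Fin M → Fin (Sm * D) → Fin D × Fin D,
      quietCost f c D M T (extPaths W) i ≤
        Fintype.card (Fin M → Fin (Sm * D) → Fin D × Fin D) *
          ((1 + Sm) * X + 18 * cost c O) := by
    intro i
    have h1 := Finset.sum_le_sum fun W (_ : W ∈ Finset.univ) =>
      sum_quietCost_update_le (M := M) h hS hD hO W i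
    rw [sum_update_eq i (fun W => quietCost f c D M T (extPaths W) i), Finset.sum_const,
      Finset.card_univ, nsmul_eq_mul, mul_left_comm] at h1
    refine le_of_mul_le_mul_left h1 ?_
    have : Nonempty (Fin D × Fin D) := ⟨(⟨0, hD1⟩, ⟨0, hD1⟩)⟩
    exact_mod_cast Fintype.card_pos
  rw [Finset.sum_comm]
  refine (add_le_add (Finset.sum_le_sum fun i _ => hquiet i)
    (Finset.sum_le_sum fun W _ => hloud W)).trans (le_of_eq ?_)
  rw [Finset.sum_const, Finset.sum_const, Finset.card_univ, Finset.card_univ, Fintype.card_fin,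
    nsmul_eq_mul, nsmul_eq_mul]
  ring

end ExpectedCost

/-! ### The number of stages -/

section Stages

variable {n : ℕ} {c : Fin n → ℝ} {f : ℕ → Finset (Fin n) → ℝ} {T : ℕ}

theorem finite_marginals (f : ℕ → Finset (Fin n) → ℝ) (T : ℕ) :
    {x | ∃ t, 1 ≤ t ∧ t ≤ T ∧ ∃ j S, x = marginal (f t) j S}.Finite := by
  refine (Set.finite_range fun p : Fin (T + 1) × Fin n × Finset (Fin n) =>
    marginal (f p.1) p.2.1 p.2.2).subset ?_
  rintro x ⟨t, -, ht, j, S, rfl⟩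
  exact ⟨(⟨t, by omega⟩, j, S), rfl⟩

theorem marginal_le_fmax {t : ℕ} (h1 : 1 ≤ t) (h2 : t ≤ T) (j : Fin n) (S : Finset (Fin n)) :
    marginal (f t) j S ≤ fmax f T :=
  le_csSup (finite_marginals f T).bddAbove ⟨t, h1, h2, j, S, rfl⟩

theorem fmin_le_marginal {t : ℕ} (h1 : 1 ≤ t) (h2 : t ≤ T) {j : Fin n} {S : Finset (Fin n)}
    (h : marginal (f t) j S ≠ 0) : fmin f T ≤ marginal (f t) j S :=
  csInf_le ((finite_marginals f T).subset fun _ hx => hx.2).bddBelow ⟨h, t, h1, h2, j, S, rfl⟩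

theorem fmin_pos (hf : IsInstance c f T) {t : ℕ} (h1 : 1 ≤ t) (h2 : t ≤ T) {j : Fin n}
    {S : Finset (Fin n)} (h : marginal (f t) j S ≠ 0) : 0 < fmin f T := by
  have hne : {x | x ≠ 0 ∧ ∃ t, 1 ≤ t ∧ t ≤ T ∧ ∃ j S, x = marginal (f t) j S}.Nonempty :=
    ⟨_, h, t, h1, h2, j, S, rfl⟩
  obtain ⟨h0, t', h1', h2', j', S', he⟩ :=
    hne.csInf_mem ((finite_marginals f T).subset fun _ hx => hx.2)
  change fmin f T ≠ 0 at h0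
  change fmin f T = _ at he
  refine lt_of_le_of_ne ?_ (Ne.symm h0)
  rw [he]
  exact marginal_nonneg (hf.mono t' h1' h2') _ _

/-- The logarithm of the ratio of the largest and the smallest marginal is never negative. -/
theorem log_ratio_nonneg (hf : IsInstance c f T) : 0 ≤ Real.log (fmax f T / fmin f T) := by
  by_cases h : ∃ t, 1 ≤ t ∧ t ≤ T ∧ ∃ j S, marginal (f t) j S ≠ 0
  · obtain ⟨t, h1, h2, j, S, h⟩ := h
    have hpos := fmin_pos hf h1 h2 h
    refine Real.log_nonneg ((one_le_div hpos).2 ?_)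
    exact (fmin_le_marginal h1 h2 h).trans (marginal_le_fmax h1 h2 j S)
  · have : fmin f T = 0 := by
      rw [fmin]
      have he : {x | x ≠ 0 ∧ ∃ t, 1 ≤ t ∧ t ≤ T ∧ ∃ j S, x = marginal (f t) j S} = ∅ := by
        refine Set.eq_empty_of_forall_notMem ?_
        rintro x ⟨h0, t, h1, h2, j, S, rfl⟩
        exact h ⟨t, h1, h2, j, S, h0⟩
      rw [he, Real.sInf_empty]
    simp [this]

theorem log_mul_ratio_nonneg (hf : IsInstance c f T) (hT : 1 ≤ T) :
    0 ≤ Real.log (T * fmax f T / fmin f T) := by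
  have h := log_ratio_nonneg hf
  have hT' : (1 : ℝ) ≤ T := by exact_mod_cast hT
  rw [mul_div_assoc]
  by_cases h0 : fmax f T / fmin f T = 0
  · simp [h0]
  · rw [Real.log_mul (by linarith) h0]
    have := Real.log_nonneg hT'
    linarith

/-- Only the crude bound `log T ≤ T` matters for the running time. -/
theorem log_mul_ratio_le (hf : IsInstance c f T) (hT : 1 ≤ T) :
    Real.log (T * fmax f T / fmin f T) ≤ T + Real.log (fmax f T / fmin f T) := by
  have h := log_ratio_nonneg hf
  have hT' : (1 : ℝ) ≤ T := by exact_mod_cast hT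
  rw [mul_div_assoc]
  by_cases h0 : fmax f T / fmin f T = 0
  · simp [h0]
  · rw [Real.log_mul (by linarith) h0]
    have := Real.log_le_sub_one_of_pos (show (0 : ℝ) < T by linarith)
    linarith

/-- A bound for the number of stages of a path up to time `T`. -/
noncomputable def maxStages (f : ℕ → Finset (Fin n) → ℝ) (T : ℕ) : ℕ :=
  ⌊1 + 20 * Real.log (T * fmax f T / fmin f T)⌋₊

theorem maxStages_le (hf : IsInstance c f T) (hT : 1 ≤ T) :
    (maxStages f T : ℝ) ≤ 1 + 20 * Real.log (T * fmax f T / fmin f T) := by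
  have := log_mul_ratio_nonneg hf hT
  exact Nat.floor_le (by linarith)

/-- If `fmin ≤ fmax * T ^ 2 * (9 / 10) ^ s`, then `s` is bounded by logarithms, as
`log (9 / 10) ≤ -1 / 10`. -/
theorem stageBound (hf : IsInstance c f T) : StageBound f c T (maxStages f T) := by
  rintro t h1 h2 s R ⟨l, h0, hlt⟩
  have hT : (1 : ℝ) ≤ T := by exact_mod_cast h1.trans h2
  have ht : (t : ℝ) ≤ T := by exact_mod_cast h2
  have hpos := fmin_pos hf h1 h2 h0.ne'
  have hmin := fmin_le_marginal h1 h2 h0.ne'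
  have hmm := marginal_le_fmax h1 h2 l (R ∪ prec c l) (f := f)
  have hF : maxSingle (f t) ≤ fmax f T :=
    (Finset.fold_max_le _).2 ⟨by linarith, fun j _ => marginal_le_fmax h1 h2 j ∅⟩
  have hp : (0 : ℝ) < (9 / 10) ^ s := by positivity
  have hmax : 0 < fmax f T := by linarith
  have hthr : threshold (f t) t s ≤ fmax f T * T * T * (9 / 10) ^ s := by
    have := maxSingle_nonneg (f := f t)
    unfold threshold
    gcongr
  have hlog : Real.log (fmin f T) ≤ Real.log (fmax f T * T * T * (9 / 10) ^ s) :=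
    Real.log_le_log hpos (by linarith)
  rw [Real.log_mul (by positivity) hp.ne', Real.log_mul (by positivity) (by positivity),
    Real.log_mul (by positivity) (by positivity), Real.log_pow] at hlog
  have h9 : Real.log (9 / 10) ≤ -(1 / 10) := by
    have := Real.log_le_sub_one_of_pos (show (0 : ℝ) < 9 / 10 by norm_num)
    linarith
  have hr := log_ratio_nonneg hf
  rw [Real.log_div hmax.ne' hpos.ne'] at hr
  have hs := mul_le_mul_of_nonneg_left h9 (Nat.cast_nonneg (α := ℝ) s)
  rw [maxStages, Nat.le_floor_iff' (by omega)]
  rw [Real.log_div (by positivity) hpos.ne', Real.log_mul (by positivity) hmax.ne']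
  push_cast
  linarith

theorem exists_optCost (c : Fin n → ℝ) (g : Finset (Fin n) → ℝ) :
    ∃ O, IsCover g O ∧ cost c O = optCost c g := by
  have hne : (cost c '' {S | IsCover g S}).Nonempty := ⟨_, Finset.univ, rfl, rfl⟩
  obtain ⟨O, hO, he⟩ := hne.csInf_mem (Set.toFinite _)
  exact ⟨O, hO, he⟩

end Stages

/-! ### The program -/

section Program

/-- Integer variable. -/
local notation "iv" => IExp.var
/-- Real variable. -/
local notation "rv" => RExp.var
/-- Integer constant. -/
local notation "ic" => IExp.const

/-- A real constant. -/
def rc (k : ℕ) : RExp := .ofInt (.const k)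

/-- Sequence of commands. -/
local infixr:60 " ;; " => Cmd.seq

/-!
The program uses the following memory.

Integer variables: `0` the size `n`, `1` the time, `2` the resolution `D`, `3` the number `M` of
paths, `4` the secret path, `5` the number `q` of bits with `D = 2 ^ q`, `6` the number of layers
drawn so far, `7` the number of pairs drawn so far, `8` whether the current sweep has changed
anything, `9` the current path, `10` the current layer, `11` the position of its pair,
`12`, `13`, `14` elements, `15` an element to be added to the rounded solution (or `n`),
`16` whether a small marginal was met, `17` a coin, `18` a random number, `20`, `21` counters.

Integer arrays: `0` the solution, `1` and `2` the two components of the pairs drawn so far, `3` the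
number of layers of each path, `4` the rounded solution, `5` the set to be queried, `6` the set that
completes the rounded solution.

Real variables: `0` the residual cost, `1` and `2` values of the function, `3` the residual cost
of the rounded solution, `4` the left hand side of the constraint, `5` the largest ratio, `6` the
largest singleton, `7` the threshold for small marginals.

Real arrays: `0` the costs, `1` the fractional solution, `2` the powers of `9 / 10` of the numbers
of stages, `3` the gains.
-/

/-- One round of `buildCmd`. -/
def buildBody : Cmd :=
  .ite (.ilt (ic 0) (.get 4 (iv 14))) (.iput 5 (iv 14) (ic 1))
    (.ite (.rlt (.get 0 (iv 14)) (.get 0 (iv 13))) (.iput 5 (iv 14) (ic 1))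
      (.ite (.rlt (.get 0 (iv 13)) (.get 0 (iv 14))) (.iput 5 (iv 14) (ic 0))
        (.ite (.ilt (iv 14) (iv 13)) (.iput 5 (iv 14) (ic 1)) (.iput 5 (iv 14) (ic 0)))))

/-- Store the union of the rounded solution and the elements before the current element. -/
def buildCmd : Cmd := .for 14 (iv 0) buildBody

/-- Account for the marginal of the current element, once the set to be queried has been built. -/
def residTail : Cmd :=
  .iput 5 (iv 15) (ic 1) ;; .query 1 5 ;; .iput 5 (iv 13) (ic 1) ;; .query 2 5 ;;
  .rset 0 (.add (rv 0) (.mul (.get 0 (iv 13)) (.sub (rv 2) (rv 1)))) ;;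
  .iput 6 (iv 13) (ic 0) ;;
  .ite (.rlt (rc 0) (.sub (rv 2) (rv 1)))
    (.iput 6 (iv 13) (ic 1) ;;
      .ite (.rlt (.sub (rv 2) (rv 1)) (rv 7)) (.iset 16 (ic 1)) .skip) .skip

/-- Compute the residual cost of the rounded solution and one more element. -/
def residCmd : Cmd :=
  .rset 0 (rc 0) ;; .iset 16 (ic 0) ;; .for 13 (iv 0) (buildCmd ;; residTail)

/-- Add the saturated elements to the rounded solution. -/
def satCmd : Cmd :=
  .for 14 (iv 0) (.ite (.rlt (.get 1 (iv 14)) (rc 1)) .skip (.iput 4 (iv 14) (ic 1)))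

/-- Account for the gain of the current element. -/
def gainTail : Cmd :=
  .rput 3 (iv 12) (.sub (rv 3) (rv 0)) ;;
  .rset 4 (.add (rv 4) (.mul (.get 3 (iv 12)) (.get 1 (iv 12)))) ;;
  .ite (.rlt (rv 5) (.div (.get 3 (iv 12)) (.get 0 (iv 12))))
    (.rset 5 (.div (.get 3 (iv 12)) (.get 0 (iv 12)))) .skip

/-- Compute all gains, the left hand side of the constraint, and the largest ratio. -/
def gainCmd : Cmd :=
  .iset 15 (iv 0) ;; residCmd ;; .rset 3 (rv 0) ;; .rset 4 (rc 0) ;; .rset 5 (rc 0) ;;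
  .for 12 (iv 0) (.iset 15 (iv 12) ;; residCmd ;; gainTail)

/-- Update the fractional solution. -/
def bumpCmd : Cmd :=
  .for 14 (iv 0) (.rput 1 (iv 14) (.add (.get 1 (iv 14))
    (.mul (.div (.div (.get 3 (iv 14)) (.get 0 (iv 14))) (rv 5))
      (.add (.get 1 (iv 14)) (.div (rc 1) (.ofInt (iv 2)))))))

/-- Check the constraint of the rounded solution, and update the fractional solution if it is
violated. -/
def checkCmd : Cmd :=
  satCmd ;; gainCmd ;;
  .ite (.rlt (.add (rv 4) (rv 4)) (rv 3)) (.iset 8 (ic 1) ;; bumpCmd) .skip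

/-- Let the current layer act on the rounded solution. -/
def pickCmd : Cmd :=
  .ite (.rlt (.mul (.ofInt (iv 2)) (.get 1 (.get 1 (iv 11))))
      (.ofInt (.add (.get 2 (iv 11)) (ic 1)))) .skip (.iput 4 (.get 1 (iv 11)) (ic 1)) ;;
  .iset 11 (.add (iv 11) (iv 3))

/-- Draw a number with `q` bits. -/
def drawNumCmd : Cmd :=
  .iset 18 (ic 0) ;;
  .for 20 (iv 5) (.flip 17 ;; .iset 18 (.add (.add (iv 18) (iv 18)) (iv 17)))

/-- Draw a pair of numbers. -/
def drawPairCmd : Cmd :=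
  drawNumCmd ;; .iput 1 (iv 7) (iv 18) ;; drawNumCmd ;; .iput 2 (iv 7) (iv 18) ;;
  .iset 7 (.add (iv 7) (ic 1))

/-- Draw another layer for every path. -/
def drawLayerCmd : Cmd := .for 21 (iv 3) drawPairCmd ;; .iset 6 (.add (iv 6) (ic 1))

/-- Process the current path. -/
def passCmd : Cmd :=
  .for 14 (iv 0) (.iput 4 (iv 14) (ic 0)) ;;
  .while (.ilt (iv 6) (.get 3 (iv 9))) drawLayerCmd ;;
  .iset 11 (iv 9) ;;
  .for 10 (.get 3 (iv 9)) (checkCmd ;; pickCmd) ;;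
  .rset 7 (.mul (.mul (.mul (rv 6) (.ofInt (iv 1))) (.ofInt (iv 1))) (.get 2 (iv 9))) ;;
  .iset 15 (iv 0) ;; residCmd

/-- Give the current path another stage if it is too short. -/
def extendCmd : Cmd :=
  .ite (.ilt (ic 0) (iv 16))
    (.iput 3 (iv 9) (.add (.get 3 (iv 9)) (iv 2)) ;;
      .rput 2 (iv 9) (.mul (.get 2 (iv 9)) (.div (rc 9) (rc 10))) ;; .iset 8 (ic 1)) .skip

/-- Process all paths. -/
def sweepCmd : Cmd := .iset 8 (ic 0) ;; .for 9 (iv 3) (passCmd ;; extendCmd)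

/-- Sweep over the paths until nothing changes. -/
def settleCmd : Cmd := .iset 8 (ic 1) ;; .while (.ilt (ic 0) (iv 8)) sweepCmd

/-- Compute the largest value of a singleton. -/
def maxCmd : Cmd :=
  .for 14 (iv 0) (.iput 5 (iv 14) (ic 0)) ;; .query 1 5 ;; .rset 6 (rc 0) ;;
  .for 14 (iv 0) (.iput 5 (iv 14) (ic 1) ;; .query 2 5 ;;
    .ite (.rlt (rv 6) (.sub (rv 2) (rv 1))) (.rset 6 (.sub (rv 2) (rv 1))) .skip ;;
    .iput 5 (iv 14) (ic 0))

/-- Buy the rounded solution of the secret path, and complete it to a cover. -/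
def buyCmd : Cmd :=
  .iset 9 (iv 4) ;; passCmd ;;
  .for 14 (iv 0) (.ite (.ilt (ic 0) (.get 4 (iv 14))) (.iput 0 (iv 14) (ic 1)) .skip ;;
    .ite (.ilt (ic 0) (.get 6 (iv 14))) (.iput 0 (iv 14) (ic 1)) .skip)

/-- Choose the resolution. -/
def resolutionCmd : Cmd :=
  .iset 2 (ic 4) ;; .iset 5 (ic 2) ;;
  .while (.ilt (iv 2) (.add (.add (iv 0) (iv 0)) (.add (iv 0) (iv 0))))
    (.iset 2 (.add (iv 2) (iv 2)) ;; .iset 5 (.add (iv 5) (ic 1)))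

/-- Choose the number of paths, and the secret path. -/
def secretCmd : Cmd :=
  .iset 3 (ic 1) ;; .iset 4 (ic 0) ;;
  .for 20 (.add (.add (iv 5) (iv 5)) (iv 5))
    (.flip 17 ;; .iset 4 (.add (.add (iv 4) (iv 4)) (iv 17)) ;; .iset 3 (.add (iv 3) (iv 3)))

/-- Initialize the memory. -/
def initCmd : Cmd :=
  resolutionCmd ;; secretCmd ;;
  .for 14 (iv 0) (.ite (.rlt (rc 0) (.get 0 (iv 14))) (.rput 1 (iv 14) (rc 0))
    (.rput 1 (iv 14) (rc 1))) ;;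
  .for 9 (iv 3) (.rput 2 (iv 9) (rc 1))

/-- The online algorithm. -/
def coverProgram : Cmd :=
  .ite (.ilt (ic 0) (iv 1)) .skip initCmd ;; .iset 1 (.add (iv 1) (ic 1)) ;;
  maxCmd ;; settleCmd ;; buyCmd

end Program

/-! ### Correctness of the arithmetic part of the program -/

namespace Store

variable (σ : Store)

theorem setI_ivar (x v y : ℕ) : (σ.setI x v).ivar y = if y = x then v else σ.ivar y :=
  Function.update_apply _ _ _ _

theorem setI_rvar (x v : ℕ) : (σ.setI x v).rvar = σ.rvar := rfl

theorem setI_iarr (x v : ℕ) : (σ.setI x v).iarr = σ.iarr := rfl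

theorem setI_rarr (x v : ℕ) : (σ.setI x v).rarr = σ.rarr := rfl

theorem setR_rvar (x y : ℕ) (v : ℝ) : (σ.setR x v).rvar y = if y = x then v else σ.rvar y :=
  Function.update_apply _ _ _ _

theorem setR_ivar (x : ℕ) (v : ℝ) : (σ.setR x v).ivar = σ.ivar := rfl

theorem setR_iarr (x : ℕ) (v : ℝ) : (σ.setR x v).iarr = σ.iarr := rfl

theorem setR_rarr (x : ℕ) (v : ℝ) : (σ.setR x v).rarr = σ.rarr := rfl

theorem putI_iarr (a i v b k : ℕ) :
    (σ.putI a i v).iarr b k = if b = a ∧ k = i then v else σ.iarr b k := by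
  simp only [putI, Function.update_apply]
  by_cases h : b = a
  · subst h; simp [Function.update_apply]
  · simp [h]

theorem putI_ivar (a i v : ℕ) : (σ.putI a i v).ivar = σ.ivar := rfl

theorem putI_rvar (a i v : ℕ) : (σ.putI a i v).rvar = σ.rvar := rfl

theorem putI_rarr (a i v : ℕ) : (σ.putI a i v).rarr = σ.rarr := rfl

theorem putR_rarr (a i b k : ℕ) (v : ℝ) :
    (σ.putR a i v).rarr b k = if b = a ∧ k = i then v else σ.rarr b k := by
  simp only [putR, Function.update_apply]
  by_cases h : b = a
  · subst h; simp [Function.update_apply]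
  · simp [h]

theorem putR_ivar (a i : ℕ) (v : ℝ) : (σ.putR a i v).ivar = σ.ivar := rfl

theorem putR_rvar (a i : ℕ) (v : ℝ) : (σ.putR a i v).rvar = σ.rvar := rfl

theorem putR_iarr (a i : ℕ) (v : ℝ) : (σ.putR a i v).iarr = σ.iarr := rfl

theorem set_congr {σ σ' : Store} {n a : ℕ} (h : σ'.iarr a = σ.iarr a) :
    σ'.set n a = σ.set n a := by simp [set, h]

theorem mem_set {n a : ℕ} {j : Fin n} : j ∈ σ.set n a ↔ σ.iarr a j ≠ 0 := by simp [set]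

end Store

section Spec

variable {n : ℕ} {g : Finset (Fin n) → ℝ} {c : Fin n → ℝ}

/-- The elements with index below `i`. -/
def below (n i : ℕ) : Finset (Fin n) := Finset.univ.filter fun j => j.val < i

theorem mem_below {i : ℕ} {j : Fin n} : j ∈ below n i ↔ j.val < i := by simp [below]

theorem below_zero : below n 0 = ∅ := by ext; simp [mem_below]

theorem below_self : below n n = Finset.univ := by ext; simp [mem_below]

theorem below_succ {i : ℕ} (h : i < n) : below n (i + 1) = insert ⟨i, h⟩ (below n i) := by
  ext j
  simp only [mem_below, Finset.mem_insert, Fin.ext_iff]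
  omega

theorem notMem_below {i : ℕ} (h : i < n) : (⟨i, h⟩ : Fin n) ∉ below n i := by simp [mem_below]

/-- The singleton of the element with index `e`, or the empty set if there is none. -/
def single (n e : ℕ) : Finset (Fin n) := Finset.univ.filter fun j => j.val = e

theorem mem_single {e : ℕ} {j : Fin n} : j ∈ single n e ↔ j.val = e := by simp [single]

theorem single_self : single n n = ∅ := by
  ext j
  simp [mem_single, j.2.ne]

theorem single_val (j : Fin n) : single n j = {j} := by
  ext i
  simp [mem_single, Fin.ext_iff]

/-- The fractional solution in memory. -/
def xval (n : ℕ) (s : CState) (j : Fin n) : ℝ := s.1.rarr 1 j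

/-- The memory holds the size of the ground set, and the costs. -/
structure Ctx (c : Fin n → ℝ) (s : CState) : Prop where
  size : s.1.ivar 0 = n
  cost : ∀ j : Fin n, s.1.rarr 0 j = c j

theorem Ctx.frame {P : Cmd} {s s' : CState} (h : Ctx c s) (hF : Frame P s s')
    (h1 : P.writes (.iv 0) = false) (h2 : P.writes (.ra 0) = false) : Ctx c s' :=
  ⟨Eq.trans (hF _ h1) h.size, fun j => (congrFun (hF _ h2) _).trans (h.cost j)⟩

/-- `buildCmd` stores the union of the rounded solution and the predecessors of `l` as set `5`. -/
theorem build_spec {s : CState} (hs : Ctx c s) (l : Fin n) (hl : s.1.ivar 13 = l) :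
    Ends g buildCmd (n * 12 + 3) s fun s' => s'.1.set n 5 = s.1.set n 4 ∪ prec c l := by
  refine (Ends.for n (fun i s' => ∀ h : Fin n, h.val < i →
    (s'.1.iarr 5 h ≠ 0 ↔ h ∈ s.1.set n 4 ∪ prec c l)) rfl (fun _ _ _ h => h) (by simp)
    (fun s' hF => ?_) (fun i s' hi hI hv hF => ?_)).mono le_rfl fun s' h => ?_
  · exact Eq.trans (hF (.iv 0) rfl) hs.size
  · refine Ends.of_exec (P := buildBody) rfl ?_
    have e1 : s'.1.iarr 4 = s.1.iarr 4 := hF (.ia 4) rfl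
    have e2 : s'.1.rarr 0 = s.1.rarr 0 := hF (.ra 0) rfl
    have e3 : s'.1.ivar 13 = l := Eq.trans (hF (.iv 13) rfl) hl
    have key : ∃ v, exec g buildBody s' = (s'.1.putI 5 i v, s'.2) ∧
        (v ≠ 0 ↔ (⟨i, hi⟩ : Fin n) ∈ s.1.set n 4 ∪ prec c l) := by
      have ei : s.1.rarr 0 i = c ⟨i, hi⟩ := hs.cost ⟨i, hi⟩
      have el := hs.cost l
      simp only [buildBody, exec, Test.Holds, IExp.eval, RExp.eval, hv, e1, e2, e3, ei, el,
        Finset.mem_union, Store.mem_set, prec, Finset.mem_filter, Finset.mem_univ, true_and]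
      by_cases h1 : 0 < s.1.iarr 4 i
      · rw [if_pos h1]; exact ⟨_, rfl, by simp; omega⟩
      · rw [if_neg h1]
        have h1' : s.1.iarr 4 i = 0 := by omega
        by_cases h2 : c ⟨i, hi⟩ < c l
        · rw [if_pos h2]; exact ⟨_, rfl, by simp [h2]⟩
        · rw [if_neg h2]
          by_cases h3 : c l < c ⟨i, hi⟩
          · rw [if_pos h3]; exact ⟨_, rfl, by simp [h2, h1', h3.ne']⟩
          · rw [if_neg h3]
            have h4 : c ⟨i, hi⟩ = c l := le_antisymm (not_lt.1 h3) (not_lt.1 h2)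
            by_cases h5 : i < l
            · rw [if_pos h5]; exact ⟨_, rfl, by simp [h4, Fin.lt_def, h5]⟩
            · rw [if_neg h5]; exact ⟨_, rfl, by simp [h4, Fin.lt_def, h5, h1']⟩
    obtain ⟨v, hv1, hv2⟩ := key
    rw [hv1]
    intro h hh
    simp only [Store.putI_iarr, true_and]
    by_cases hhi : h.val = i
    · have : h = ⟨i, hi⟩ := Fin.ext hhi
      rw [if_pos hhi, hv2, this]
    · rw [if_neg hhi]; exact hI h (by omega)
  · ext j
    rw [Store.mem_set]
    exact h j j.2

/-- `residTail` queries `S` and `S ∪ {l}`, and adds the contribution of `l` to the results of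
`residCmd`. -/
theorem residTail_spec {s : CState} (l : Fin n) (hl : s.1.ivar 13 = l)
    (hl0 : s.1.rarr 0 l = c l) {S : Finset (Fin n)}
    (hS : s.1.set n 5 ∪ single n (s.1.ivar 15) = S) :
    Ends g residTail 19 s fun s' => s'.1.rvar 0 = s.1.rvar 0 + c l * marginal g l S ∧
      s'.1.rvar 7 = s.1.rvar 7 ∧
      (s'.1.ivar 16 ≠ 0 ↔ s.1.ivar 16 ≠ 0 ∨
        (0 < marginal g l S ∧ marginal g l S < s.1.rvar 7)) ∧
      ∀ h : Fin n, s'.1.iarr 6 h ≠ 0 ↔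
        if h = l then 0 < marginal g l S else s.1.iarr 6 h ≠ 0 := by
  refine (Ends.of_exec (P := residTail) rfl ?_).mono (by decide) fun _ h => h
  have q1 : (s.1.putI 5 (s.1.ivar 15) 1).set n 5 = S := by
    rw [← hS]
    ext j
    simp only [Store.mem_set, Store.putI_iarr, Finset.mem_union, mem_single]
    by_cases h : j.val = s.1.ivar 15 <;> simp [h]
  have q2 : ∀ v : ℝ, (((s.1.putI 5 (s.1.ivar 15) 1).setR 1 v).putI 5 (s.1.ivar 13) 1).set n 5 =
      S ∪ {l} := by
    intro v
    rw [← q1]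
    ext j
    simp only [Store.mem_set, Store.putI_iarr, Store.setR_iarr, Finset.mem_union,
      Finset.mem_singleton, hl, true_and, Fin.ext_iff]
    by_cases h : j.val = l.val <;> simp [h]
  have hm : g (S ∪ {l}) - g S = marginal g l S := rfl
  simp [-Finset.union_singleton, -sub_pos, residTail, exec, IExp.eval, RExp.eval, Test.Holds,
    Store.putI_ivar, Store.setR_ivar, q1, q2, Store.setR_rvar, Store.putI_rvar, Store.putI_rarr,
    Store.setR_rarr, rc, hm]
  generalize marginal g l S = a
  by_cases h1 : 0 < a
  · by_cases h2 : a < s.1.rvar 7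
    · simp [h1, h2, hl, hl0, Store.setI_ivar, Store.setI_rvar, Store.setI_iarr,
        Store.putI_rvar, Store.setR_rvar, Store.putI_iarr, Store.setR_iarr, Fin.ext_iff]
      grind
    · simp [h1, h2, hl, hl0, Store.putI_ivar, Store.setR_ivar,
        Store.putI_rvar, Store.setR_rvar, Store.putI_iarr, Store.setR_iarr, Fin.ext_iff]
      grind
  · simp [h1, hl, hl0, Store.putI_ivar, Store.setR_ivar,
        Store.putI_rvar, Store.setR_rvar, Store.putI_iarr, Store.setR_iarr, Fin.ext_iff]

/-- The time for `residCmd`. -/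
def residTime (n : ℕ) : ℕ := n * (n * 12 + 26) + 7

/-- `residCmd` computes the residual cost of `S`, whether completing `S` meets a positive marginal
below real variable `7`, and the set that completes `S`. Here `S` is the rounded solution together with
the element in integer variable `15`; the index `n` stands for no element. -/
theorem residCmd_spec {s : CState} (hs : Ctx c s) {S : Finset (Fin n)}
    (hS : s.1.set n 4 ∪ single n (s.1.ivar 15) = S) :
    Ends g residCmd (residTime n) s fun s' => s'.1.rvar 0 = resid g c S ∧
      (s'.1.ivar 16 ≠ 0 ↔ ∃ l, 0 < marginal g l (S ∪ prec c l) ∧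
        marginal g l (S ∪ prec c l) < s.1.rvar 7) ∧
      s'.1.set n 6 = fill g c S := by
  have h1 : Ends g (.rset 0 (rc 0)) 1 s fun s' => s'.1.rvar 0 = 0 :=
    Ends.of_exec (P := .rset 0 (rc 0)) rfl (by simp [exec, rc, RExp.eval, IExp.eval, Store.setR_rvar])
  refine (h1.seq fun s₁ e1 hF1 => ?_).mono (k := 1 + (1 + (n * ((n * 12 + 3) + 19 + 1 + 3) + 3) + 1)
    + 1) (le_of_eq (by simp only [residTime]; ring)) fun _ h => h
  have h2 : Ends g (.iset 16 (.const 0)) 1 s₁ fun s' => s'.1.ivar 16 = 0 :=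
    Ends.of_exec (P := .iset 16 (.const 0)) rfl (by simp [exec, IExp.eval, Store.setI_ivar])
  refine h2.seq fun s₂ e2 hF2 => ?_
  have hs2 : Ctx c s₂ := (hs.frame hF1 rfl rfl).frame hF2 rfl rfl
  have hr : s₂.1.rvar 0 = 0 := Eq.trans (hF2 (.rv 0) rfl) e1
  have hthr : s₂.1.rvar 7 = s.1.rvar 7 := Eq.trans (hF2 (.rv 7) rfl) (hF1 (.rv 7) rfl)
  have hS2 : s₂.1.set n 4 ∪ single n (s₂.1.ivar 15) = S := by
    have a1 : s₂.1.iarr 4 = s.1.iarr 4 := Eq.trans (hF2 (.ia 4) rfl) (hF1 (.ia 4) rfl)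
    have a2 : s₂.1.ivar 15 = s.1.ivar 15 := Eq.trans (hF2 (.iv 15) rfl) (hF1 (.iv 15) rfl)
    rw [Store.set_congr a1, a2, hS]
  clear h1 h2 hS e1
  refine (Ends.for n (fun i s' =>
    s'.1.rvar 0 = ∑ l ∈ below n i, c l * marginal g l (S ∪ prec c l) ∧
    (s'.1.ivar 16 ≠ 0 ↔ ∃ l ∈ below n i, 0 < marginal g l (S ∪ prec c l) ∧
        marginal g l (S ∪ prec c l) < s.1.rvar 7) ∧
    ∀ h ∈ below n i, s'.1.iarr 6 h ≠ 0 ↔ 0 < marginal g h (S ∪ prec c h)) rfl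
    (fun i s' z h => ?_) ?_ (fun s' hF => ?_) (fun i s' hi hI hv hF => ?_)).mono le_rfl
    fun s' h => ?_
  · simpa [Store.setI_ivar, Store.setI_rvar, Store.setI_iarr] using h
  · simp [below_zero, hr, e2]
  · exact (hs2.frame hF rfl rfl).size
  · have hs' : Ctx c s' := hs2.frame hF rfl rfl
    set l : Fin n := ⟨i, hi⟩ with hl
    refine Ends.mono (k := n * 12 + 3 + 19 + 1) ((build_spec hs' l hv).seq fun s'' e hF' => ?_)
      (by omega) fun _ h => h
    have hs'' : Ctx c s'' := hs'.frame hF' rfl rfl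
    have a1 : s'.1.iarr 4 = s₂.1.iarr 4 := hF (.ia 4) rfl
    have a2 : s''.1.ivar 15 = s₂.1.ivar 15 := Eq.trans (hF' (.iv 15) rfl) (hF (.iv 15) rfl)
    have a3 : s''.1.ivar 13 = l := Eq.trans (hF' (.iv 13) rfl) hv
    have a4 : s''.1.rvar 7 = s.1.rvar 7 :=
      (Eq.trans (hF' (.rv 7) rfl) (hF (.rv 7) rfl)).trans hthr
    have a5 : s''.1.rvar 0 = s'.1.rvar 0 := hF' (.rv 0) rfl
    have a6 : s''.1.ivar 16 = s'.1.ivar 16 := hF' (.iv 16) rfl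
    have a7 : s''.1.iarr 6 = s'.1.iarr 6 := hF' (.ia 6) rfl
    have hS'' : s''.1.set n 5 ∪ single n (s''.1.ivar 15) = S ∪ prec c l := by
      rw [e, a2, Store.set_congr a1, ← hS2, Finset.union_right_comm]
    refine (residTail_spec l a3 (hs''.cost l) hS'').mono le_rfl fun s₃ h => ?_
    obtain ⟨b1, b2, b3, b4⟩ := h
    obtain ⟨i1, i2, i3⟩ := hI
    rw [below_succ hi]
    refine ⟨?_, ?_, fun h hh => ?_⟩
    · rw [b1, a5, i1, Finset.sum_insert (notMem_below hi), add_comm]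
    · rw [b3, a6, i2, a4, Finset.exists_mem_insert, or_comm]
    · rw [b4, a7]
      rcases Finset.mem_insert.1 hh with rfl | hh
      · rw [if_pos rfl]
      · rw [if_neg (ne_of_mem_of_not_mem hh (notMem_below hi)), i3 h hh]
  · rw [below_self] at h
    refine ⟨h.1, by simpa using h.2.1, ?_⟩
    ext j
    rw [Store.mem_set, h.2.2 j (Finset.mem_univ j), fill]
    simp

end Spec

section Spec

variable {n : ℕ} {g : Finset (Fin n) → ℝ} {c : Fin n → ℝ}

theorem Frame.set_eq {P : Cmd} {s s' : CState} (hF : Frame P s s') {a : ℕ}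
    (h : P.writes (.ia a) = false) : s'.1.set n a = s.1.set n a := Store.set_congr (hF _ h)

theorem Frame.xval_eq {P : Cmd} {s s' : CState} (hF : Frame P s s')
    (h : P.writes (.ra 1) = false) : xval n s' = xval n s := by
  have : s'.1.rarr 1 = s.1.rarr 1 := hF _ h
  funext j
  simp [xval, this]

/-- A loop over the ground set with a body without loops. -/
theorem Ends.forAll {s : CState} {v : ℕ} {P : Cmd} (hP : P.loopFree = true) (hs : s.1.ivar 0 = n)
    (hv : P.writes (.iv v) = false) (h0 : (Cmd.for v (.var 0) P).writes (.iv 0) = false)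
    (Inv : Finset (Fin n) → CState → Prop)
    (hstab : ∀ A (s : CState) z, Inv A s → Inv A (s.1.setI v z, s.2)) (hz : Inv ∅ s)
    (hstep : ∀ A (j : Fin n) s', j ∉ A → Inv A s' → s'.1.ivar v = j →
      Frame (Cmd.for v (.var 0) P) s s' → Inv (insert j A) (exec g P s')) :
    Ends g (Cmd.for v (.var 0) P) (n * (P.size + 3) + 3) s (Inv Finset.univ) := by
  refine (Ends.for n (fun i => Inv (below n i)) hv (fun i => hstab _) (by rwa [below_zero])
    (fun s' hF => Eq.trans (hF (.iv 0) h0) hs) (fun i s' hi hI hv hF => ?_)).mono le_rfl fun s' h => ?_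
  · refine Ends.of_exec hP ?_
    rw [below_succ hi]
    exact hstep _ ⟨i, hi⟩ s' (notMem_below hi) hI hv hF
  · rwa [below_self] at h

theorem satCmd_spec {s : CState} (hs : Ctx c s) :
    Ends g satCmd (n * 6 + 3) s fun s' => s'.1.set n 4 = s.1.set n 4 ∪ sat (xval n s) := by
  refine (Ends.forAll (n := n) rfl hs.size rfl rfl (fun A s' => ∀ h : Fin n, s'.1.iarr 4 h ≠ 0 ↔
    h ∈ s.1.set n 4 ∨ (h ∈ A ∧ 1 ≤ xval n s h)) (fun _ _ _ h => h) ?_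
    (fun A j s' hj hI hv hF => ?_)).mono le_rfl fun s' h => ?_
  · simp [Store.mem_set]
  · have e1 : s'.1.rarr 1 = s.1.rarr 1 := hF (.ra 1) rfl
    have e2 : s.1.rarr 1 j = xval n s j := rfl
    intro h
    by_cases h1 : xval n s j < 1
    · simp only [exec, Test.Holds, RExp.eval, IExp.eval, rc, hv, e1, e2, Nat.cast_one, if_pos h1,
        hI h, Finset.mem_insert]
      grind
    · simp only [exec, Test.Holds, RExp.eval, IExp.eval, rc, hv, e1, e2, Nat.cast_one, if_neg h1,
        Store.putI_iarr, true_and, Finset.mem_insert, ← Fin.ext_iff]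
      have := hI h
      grind
  · ext j
    rw [Store.mem_set, h j]
    simp [sat]

/-- The time for `gainCmd`. -/
def gainTime (n : ℕ) : ℕ := n * (residTime n + 13) + residTime n + 13

/-- `gainCmd` computes the data of the constraint of the rounded solution. -/
theorem gainCmd_spec {s : CState} (hs : Ctx c s) :
    Ends g gainCmd (gainTime n) s fun s' =>
      (∀ j : Fin n, s'.1.rarr 3 j = gain g c (s.1.set n 4) j) ∧
      s'.1.rvar 3 = resid g c (s.1.set n 4) ∧
      s'.1.rvar 4 = ∑ j, gain g c (s.1.set n 4) j * xval n s j ∧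
      s'.1.rvar 5 = maxRatio g c (s.1.set n 4) := by
  set S := s.1.set n 4 with hSdef
  have h1 : Ends g (.iset 15 (.var 0)) 1 s fun s' => s'.1.ivar 15 = n :=
    Ends.of_exec (P := .iset 15 (.var 0)) rfl
      (by simpa [exec, IExp.eval, Store.setI_ivar] using hs.size)
  refine Ends.mono (k := 1 + (residTime n + (1 + (1 + (1 + (n * ((1 + (residTime n + 7 + 1) + 1)
    + 3) + 3) + 1) + 1) + 1) + 1) + 1) (h1.seq fun s₁ e1 hF1 => ?_)
    (by simp only [gainTime]; ring_nf; omega) fun _ h => h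
  have hs1 := hs.frame hF1 rfl rfl
  have hS1 : s₁.1.set n 4 ∪ single n (s₁.1.ivar 15) = S := by
    rw [e1, single_self, Finset.union_empty, hF1.set_eq rfl]
  refine (residCmd_spec hs1 hS1).seq fun s₂ e2 hF2 => ?_
  have hs2 := hs1.frame hF2 rfl rfl
  have h3 : Ends g (.rset 3 (.var 0)) 1 s₂ fun s' => s'.1.rvar 3 = resid g c S :=
    Ends.of_exec (P := .rset 3 (.var 0)) rfl
      (by simpa [exec, RExp.eval, Store.setR_rvar] using e2.1)
  refine h3.seq fun s₃ e3 hF3 => ?_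
  have hs3 := hs2.frame hF3 rfl rfl
  have h4 : Ends g (.rset 4 (rc 0)) 1 s₃ fun s' => s'.1.rvar 4 = 0 :=
    Ends.of_exec (P := .rset 4 (rc 0)) rfl (by simp [exec, rc, RExp.eval, IExp.eval, Store.setR_rvar])
  refine h4.seq fun s₄ e4 hF4 => ?_
  have hs4 := hs3.frame hF4 rfl rfl
  have h5 : Ends g (.rset 5 (rc 0)) 1 s₄ fun s' => s'.1.rvar 5 = 0 :=
    Ends.of_exec (P := .rset 5 (rc 0)) rfl (by simp [exec, rc, RExp.eval, IExp.eval, Store.setR_rvar])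
  refine h5.seq fun s₅ e5 hF5 => ?_
  have hs5 := hs4.frame hF5 rfl rfl
  have a3 : s₅.1.rvar 3 = resid g c S :=
    Eq.trans (hF5 (.rv 3) rfl) (Eq.trans (hF4 (.rv 3) rfl) e3)
  have a4 : s₅.1.rvar 4 = 0 := Eq.trans (hF5 (.rv 4) rfl) e4
  have aS : s₅.1.set n 4 = S := by
    rw [hF5.set_eq rfl, hF4.set_eq rfl, hF3.set_eq rfl, hF2.set_eq rfl, hF1.set_eq rfl]
  have ax : xval n s₅ = xval n s := by
    rw [hF5.xval_eq rfl, hF4.xval_eq rfl, hF3.xval_eq rfl, hF2.xval_eq rfl, hF1.xval_eq rfl]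
  clear h1 h3 h4 h5
  refine (Ends.for n (fun i s' =>
    (∀ j ∈ below n i, s'.1.rarr 3 j = gain g c S j) ∧ s'.1.rvar 3 = resid g c S ∧
      s'.1.rvar 4 = ∑ j ∈ below n i, gain g c S j * xval n s j ∧
      s'.1.rvar 5 = (below n i).fold max 0 fun j => gain g c S j / c j) rfl
    (fun i s' z h => h) ?_ (fun s' hF => ?_) (fun i s' hi hI hv hF => ?_)).mono le_rfl
    fun s' h => ?_
  · simp [below_zero, a3, a4, e5]
  · exact (hs5.frame hF rfl rfl).size
  · have hs' : Ctx c s' := hs5.frame hF rfl rfl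
    set j : Fin n := ⟨i, hi⟩ with hj
    have k1 : Ends g (.iset 15 (.var 12)) 1 s' fun s' => s'.1.ivar 15 = j :=
      Ends.of_exec (P := .iset 15 (.var 12)) rfl
        (by simpa [exec, IExp.eval, Store.setI_ivar] using hv)
    refine k1.seq fun t₁ f1 hG1 => ?_
    have ht1 := hs'.frame hG1 rfl rfl
    have hS1 : t₁.1.set n 4 ∪ single n (t₁.1.ivar 15) = S ∪ {j} := by
      rw [f1, single_val, hG1.set_eq rfl, hF.set_eq rfl, aS]
    refine (residCmd_spec ht1 hS1).seq fun t₂ f2 hG2 => ?_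
    have ht2 := ht1.frame hG2 rfl rfl
    refine Ends.of_exec (P := gainTail) rfl ?_
    have b3 : t₂.1.rvar 3 = resid g c S :=
      Eq.trans (hG2 (.rv 3) rfl) (Eq.trans (hG1 (.rv 3) rfl) hI.2.1)
    have b4 : t₂.1.rvar 4 = ∑ j ∈ below n i, gain g c S j * xval n s j :=
      Eq.trans (hG2 (.rv 4) rfl) (Eq.trans (hG1 (.rv 4) rfl) hI.2.2.1)
    have b5 : t₂.1.rvar 5 = (below n i).fold max 0 fun j => gain g c S j / c j :=
      Eq.trans (hG2 (.rv 5) rfl) (Eq.trans (hG1 (.rv 5) rfl) hI.2.2.2)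
    have b6 : t₂.1.ivar 12 = j := Eq.trans (hG2 (.iv 12) rfl) (Eq.trans (hG1 (.iv 12) rfl) hv)
    have b7 : t₂.1.rarr 1 j = xval n s j := by
      rw [← ax, ← hF.xval_eq rfl, ← hG1.xval_eq rfl, ← hG2.xval_eq rfl]; rfl
    have b8 : t₂.1.rarr 3 = s'.1.rarr 3 := Eq.trans (hG2 (.ra 3) rfl) (hG1 (.ra 3) rfl)
    have b9 : t₂.1.rarr 0 j = c j := ht2.cost j
    have hg : resid g c S - resid g c (S ∪ {j}) = gain g c S j := rfl
    have key : exec g gainTail t₂ = (if t₂.1.rvar 5 < gain g c S j / c j then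
        (((t₂.1.putR 3 j (gain g c S j)).setR 4 (t₂.1.rvar 4 + gain g c S j * xval n s j)).setR 5
          (gain g c S j / c j), t₂.2) else
        ((t₂.1.putR 3 j (gain g c S j)).setR 4 (t₂.1.rvar 4 + gain g c S j * xval n s j),
          t₂.2)) := by
      simp [-Finset.union_singleton, gainTail, exec, RExp.eval, IExp.eval, Test.Holds, b3, f2.1, b6,
        hg, Store.putR_rarr, Store.setR_rarr, Store.setR_rvar, Store.putR_rvar, Store.setR_ivar,
        Store.putR_ivar, b7, b9]
    have hin : ∀ h ∈ insert j (below n i), (t₂.1.putR 3 j (gain g c S j)).rarr 3 h =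
        gain g c S h := by
      intro h hh
      rw [Store.putR_rarr, b8]
      by_cases hhj : h = j
      · simp [hhj]
      · rw [if_neg (by simpa [Fin.ext_iff] using hhj)]
        exact hI.1 h ((Finset.mem_insert.1 hh).resolve_left hhj)
    rw [key, below_succ hi, Finset.sum_insert (notMem_below hi),
      Finset.fold_insert (notMem_below hi)]
    by_cases hlt : t₂.1.rvar 5 < gain g c S j / c j
    · rw [if_pos hlt]
      refine ⟨hin, ?_, ?_, ?_⟩
      · simp [Store.setR_rvar, Store.putR_rvar, b3]
      · simp [Store.setR_rvar, b4, add_comm, hj]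
      · rw [b5] at hlt
        simp only [Store.setR_rvar, if_true]
        exact (max_eq_left hlt.le).symm
    · rw [if_neg hlt]
      refine ⟨hin, ?_, ?_, ?_⟩
      · simp [Store.setR_rvar, Store.putR_rvar, b3]
      · simp [Store.setR_rvar, b4, add_comm, hj]
      · rw [b5] at hlt
        refine Eq.trans ?_ (max_eq_right (not_lt.1 hlt)).symm
        simp [Store.setR_rvar, Store.putR_rvar, b5]
  · rw [below_self] at h
    exact ⟨fun j => h.1 j (Finset.mem_univ j), h.2⟩

theorem bumpCmd_spec {s : CState} (hs : Ctx c s) {D : ℕ} (hD : s.1.ivar 2 = D)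
    {S : Finset (Fin n)} (h3 : ∀ j : Fin n, s.1.rarr 3 j = gain g c S j)
    (h5 : s.1.rvar 5 = maxRatio g c S) :
    Ends g bumpCmd (n * 4 + 3) s fun s' => xval n s' = bump g c D (xval n s) S := by
  refine (Ends.forAll (n := n) rfl hs.size rfl rfl (fun A s' => ∀ h : Fin n, xval n s' h =
    if h ∈ A then bump g c D (xval n s) S h else xval n s h) (fun _ _ _ h => h) (by simp)
    (fun A j s' hj hI hv hF => ?_)).mono le_rfl fun s' h => ?_
  · have e1 : s'.1.rarr 3 j = gain g c S j := (congrFun (hF (.ra 3) rfl) _).trans (h3 j)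
    have e2 : s'.1.rvar 5 = maxRatio g c S := Eq.trans (hF (.rv 5) rfl) h5
    have e3 : s'.1.rarr 0 j = c j := (hs.frame hF rfl rfl).cost j
    have e4 : s'.1.ivar 2 = D := Eq.trans (hF (.iv 2) rfl) hD
    have e5 : s'.1.rarr 1 j = xval n s j := (hI j).trans (if_neg hj)
    intro h
    simp only [xval, exec, RExp.eval, IExp.eval, rc, hv, e1, e2, e3, e4, e5, Store.putR_rarr,
      true_and, Finset.mem_insert, ← Fin.ext_iff]
    have := hI h
    by_cases hh : h = j
    · simp [hh, bump, xval]
    · simpa [hh, xval] using this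
  · funext j
    simpa using h j

/-- The time for `checkCmd`. -/
def checkTime (n : ℕ) : ℕ := gainTime n + n * 10 + 11

open Classical in
/-- `checkCmd` makes the first half of `layerStep`, and reports an update in integer variable `8`. -/
theorem checkCmd_spec {s : CState} (hs : Ctx c s) {D : ℕ} (hD : s.1.ivar 2 = D) {x : Fin n → ℝ}
    (hx : xval n s = x) {S : Finset (Fin n)} (hS : s.1.set n 4 ∪ sat x = S) :
    Ends g checkCmd (checkTime n) s fun s' => s'.1.set n 4 = S ∧
      xval n s' = (if Violated g c x S then bump g c D x S else x) ∧
      (s'.1.ivar 8 ≠ 0 ↔ s.1.ivar 8 ≠ 0 ∨ Violated g c x S) := by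
  refine Ends.mono (k := (n * 6 + 3) + (gainTime n + (1 + (n * 4 + 3) + 1 + 1) + 1) + 1)
    ((satCmd_spec hs).seq fun s₁ e1 hF1 => ?_) (by simp only [checkTime]; omega) fun _ h => h
  have hs1 := hs.frame hF1 rfl rfl
  rw [hx, hS] at e1
  have hx1 : xval n s₁ = x := (hF1.xval_eq rfl).trans hx
  refine (gainCmd_spec hs1).seq fun s₂ e2 hF2 => ?_
  have hs2 := hs1.frame hF2 rfl rfl
  rw [e1, hx1] at e2
  have hx2 : xval n s₂ = x := (hF2.xval_eq rfl).trans hx1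
  have hS2 : s₂.1.set n 4 = S := (hF2.set_eq rfl).trans e1
  have hb : (Test.rlt (.add (.var 4) (.var 4)) (.var 3)).Holds s₂.1 ↔ Violated g c x S := by
    simp [Test.Holds, RExp.eval, e2.2.1, e2.2.2.1, Violated]
  have h8 : s₂.1.ivar 8 = s.1.ivar 8 := Eq.trans (hF2 (.iv 8) rfl) (hF1 (.iv 8) rfl)
  have hD2 : s₂.1.ivar 2 = D :=
    Eq.trans (hF2 (.iv 2) rfl) (Eq.trans (hF1 (.iv 2) rfl) hD)
  refine Ends.ite (fun h => ?_) (fun h => ?_)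
  · rw [hb] at h
    have h1 : Ends g (.iset 8 (.const 1)) 1 s₂ fun s' => s'.1.ivar 8 = 1 :=
      Ends.of_exec (P := .iset 8 (.const 1)) rfl (by simp [exec, IExp.eval, Store.setI_ivar])
    refine h1.seq fun s₃ e3 hF3 => ?_
    have hs3 := hs2.frame hF3 rfl rfl
    refine ((bumpCmd_spec (g := g) hs3 (D := D) (S := S) (Eq.trans (hF3 (.iv 2) rfl) hD2)
      (fun j => (congrFun (hF3 (.ra 3) rfl) _).trans (e2.1 j))
      (Eq.trans (hF3 (.rv 5) rfl) e2.2.2.2)).frame).mono le_rfl ?_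
    rintro s₄ ⟨e4, hF4⟩
    have h84 : s₄.1.ivar 8 = 1 := Eq.trans (hF4 (.iv 8) rfl) e3
    refine ⟨?_, ?_, ?_⟩
    · rw [hF4.set_eq rfl, hF3.set_eq rfl, hS2]
    · rw [if_pos h, e4, hF3.xval_eq rfl, hx2]
    · simp [h84, h]
  · rw [hb] at h
    refine (Ends.of_exec (P := .skip) rfl ?_).mono (k := 1) (by omega) fun _ h => h
    refine ⟨hS2, ?_, ?_⟩
    · rw [if_neg h]; exact hx2
    · simp [exec, h8, h]

/-- `pickCmd` makes the second half of `layerStep`, and moves on to the next layer of the path.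
A layer with an index that is not below `n` writes outside of the set, and has no effect. -/
theorem pickCmd_spec {s : CState} {D : ℕ} (hD : s.1.ivar 2 = D) :
    Ends g pickCmd 5 s fun s' => s'.1.set n 4 = s.1.set n 4 ∪
        pick D (xval n s) (s.1.iarr 1 (s.1.ivar 11), s.1.iarr 2 (s.1.ivar 11)) ∧
      s'.1.ivar 11 = s.1.ivar 11 + s.1.ivar 3 := by
  refine Ends.of_exec (P := pickCmd) rfl ?_
  set a := s.1.iarr 1 (s.1.ivar 11)
  set u := s.1.iarr 2 (s.1.ivar 11)
  have key : exec g pickCmd s = if D * s.1.rarr 1 a < u + 1 then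
      (s.1.setI 11 (s.1.ivar 11 + s.1.ivar 3), s.2) else
      ((s.1.putI 4 a 1).setI 11 (s.1.ivar 11 + s.1.ivar 3), s.2) := by
    simp only [pickCmd, exec, Test.Holds, RExp.eval, IExp.eval, hD]
    push_cast
    split_ifs <;> rfl
  rw [key]
  split_ifs with h
  · refine ⟨?_, by simp [Store.setI_ivar]⟩
    rw [eq_comm]
    refine Finset.union_eq_left.2 fun j hj => ?_
    obtain ⟨h1 : j.val = a, h2 : (u : ℝ) + 1 ≤ _⟩ := mem_pick.1 hj
    rw [← h1] at h
    exact absurd h (not_lt.2 h2)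
  · refine ⟨?_, by simp [Store.setI_ivar]⟩
    ext j
    simp only [Store.mem_set, Store.setI_iarr, Store.putI_iarr, Finset.mem_union, mem_pick,
      true_and]
    by_cases hja : j.val = a
    · simp only [← hja] at h
      simp only [hja, if_true, true_and]
      have := not_lt.1 h
      simp [xval, this]
    · simp [hja]

end Spec

/-! ### Correctness of the random part of the program -/

section Spec

variable {n : ℕ} {g : Finset (Fin n) → ℝ} {c : Fin n → ℝ} {D q M I t : ℕ} {ω : ℕ → Bool}

/-- The memory holds the parameters of the algorithm. -/
structure Base (c : Fin n → ℝ) (D q M I t : ℕ) (s : CState) : Prop extends Ctx c s where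
  time : s.1.ivar 1 = t
  res : s.1.ivar 2 = D
  paths : s.1.ivar 3 = M
  secret : s.1.ivar 4 = I
  bits : s.1.ivar 5 = q

theorem Base.frame {P : Cmd} {s s' : CState} (h : Base c D q M I t s) (hF : Frame P s s')
    (hP : ∀ l ∈ [Loc.iv 0, .iv 1, .iv 2, .iv 3, .iv 4, .iv 5, .ra 0], P.writes l = false) :
    Base c D q M I t s' where
  toCtx := h.toCtx.frame hF (hP _ (by simp)) (hP _ (by simp))
  time := Eq.trans (hF (.iv 1) (hP _ (by simp))) h.time
  res := Eq.trans (hF (.iv 2) (hP _ (by simp))) h.res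
  paths := Eq.trans (hF (.iv 3) (hP _ (by simp))) h.paths
  secret := Eq.trans (hF (.iv 4) (hP _ (by simp))) h.secret
  bits := Eq.trans (hF (.iv 5) (hP _ (by simp))) h.bits

/-- The first `z` pairs have been read off the coin stream `ω`, and stored. -/
structure Tape (q : ℕ) (ω : ℕ → Bool) (z : ℕ) (s : CState) : Prop where
  ptr : s.1.ivar 7 = z
  coins : s.2 = dropCoins (z * (q + q)) ω
  pairs : ∀ y < z, (s.1.iarr 1 y, s.1.iarr 2 y) = coinPair q y ω

theorem Tape.frame {P : Cmd} {s s' : CState} {z : ℕ} (h : Tape q ω z s) (hF : Frame P s s')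
    (hP : ∀ l ∈ [Loc.iv 7, .ia 1, .ia 2, .coin], P.writes l = false) : Tape q ω z s' where
  ptr := Eq.trans (hF (.iv 7) (hP _ (by simp))) h.ptr
  coins := Eq.trans (hF .coin (hP _ (by simp))) h.coins
  pairs := fun y hy => by
    have h1 : s'.1.iarr 1 = s.1.iarr 1 := hF (.ia 1) (hP _ (by simp))
    have h2 : s'.1.iarr 2 = s.1.iarr 2 := hF (.ia 2) (hP _ (by simp))
    rw [h1, h2]
    exact h.pairs y hy

/-- The time for `drawNumCmd`. -/
def drawNumTime (q : ℕ) : ℕ := q * 6 + 5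

/-- `drawNumCmd` reads the number `coinNum` off the stream. -/
theorem drawNumCmd_spec {s : CState} (hq : s.1.ivar 5 = q) :
    Ends g drawNumCmd (drawNumTime q) s fun s' =>
      s'.1.ivar 18 = coinNum q 0 s.2 ∧ s'.2 = dropCoins q s.2 := by
  have h1 : Ends g (.iset 18 (.const 0)) 1 s fun s' => s'.1.ivar 18 = 0 :=
    Ends.of_exec (P := .iset 18 (.const 0)) rfl (by simp [exec, IExp.eval, Store.setI_ivar])
  refine Ends.mono (k := 1 + (q * (3 + 3) + 3) + 1) (h1.seq fun s₁ e1 hF1 => ?_)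
    (by simp only [drawNumTime]; omega) fun _ h => h
  have ec : s₁.2 = s.2 := hF1 .coin rfl
  refine Ends.for q (fun i s' => s'.1.ivar 18 = coinNum i 0 s.2 ∧ s'.2 = dropCoins i s.2) rfl
    (fun i s' z h => ?_) ⟨e1, ec⟩ (fun s' hF => ?_) (fun i s' hi hI hv hF => ?_)
  · simpa [Store.setI_ivar] using h
  · exact Eq.trans (hF (.iv 5) rfl) (Eq.trans (hF1 (.iv 5) rfl) hq)
  · refine Ends.of_exec
      (P := .seq (.flip 17) (.iset 18 (.add (.add (.var 18) (.var 18)) (.var 17)))) rfl ?_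
    rw [coinNum_succ, dropCoins_succ]
    obtain ⟨h1, h2⟩ := hI
    simp only [exec, IExp.eval, Store.setI_ivar, h1, h2]
    refine ⟨?_, trivial⟩
    simp only [if_true, Nat.reduceEqDiff, if_false]
    cases dropCoins i s.2 0 <;> simp

theorem drawPairCmd_spec {s : CState} (hq : s.1.ivar 5 = q) {z : ℕ} (h : Tape q ω z s) :
    Ends g drawPairCmd (q * 12 + 17) s (Tape q ω (z + 1)) := by
  refine Ends.mono (k := drawNumTime q + (1 + (drawNumTime q + 3 + 1) + 1) + 1)
    ((drawNumCmd_spec hq).seq fun s₁ e1 hF1 => ?_) (by simp only [drawNumTime]; omega) fun _ h => h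
  have h1 : Ends g (.iput 1 (.var 7) (.var 18)) 1 s₁ fun s' =>
      ∀ y, s'.1.iarr 1 y = if y = z then coinNum q 0 s.2 else s.1.iarr 1 y :=
    Ends.of_exec (P := .iput 1 (.var 7) (.var 18)) rfl (by
      have a1 : s₁.1.ivar 7 = z := Eq.trans (hF1 (.iv 7) rfl) h.ptr
      have a2 : s₁.1.iarr 1 = s.1.iarr 1 := hF1 (.ia 1) rfl
      simp [exec, IExp.eval, Store.putI_iarr, a1, a2, e1.1])
  refine h1.seq fun s₂ e2 hF2 => ?_
  refine (drawNumCmd_spec (Eq.trans (hF2 (.iv 5) rfl) (Eq.trans (hF1 (.iv 5) rfl) hq))).seq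
    fun s₃ e3 hF3 => ?_
  have ec : s₂.2 = dropCoins q s.2 := Eq.trans (hF2 .coin rfl) e1.2
  rw [ec] at e3
  have b1 : s₃.1.ivar 7 = z :=
    Eq.trans (hF3 (.iv 7) rfl) (Eq.trans (hF2 (.iv 7) rfl) (Eq.trans (hF1 (.iv 7) rfl) h.ptr))
  have b2 : s₃.1.iarr 1 = s₂.1.iarr 1 := hF3 (.ia 1) rfl
  have b3 : s₃.1.iarr 2 = s.1.iarr 2 :=
    Eq.trans (hF3 (.ia 2) rfl) (Eq.trans (hF2 (.ia 2) rfl) (hF1 (.ia 2) rfl))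
  refine Ends.of_exec (P := .seq (.iput 2 (.var 7) (.var 18))
    (.iset 7 (.add (.var 7) (.const 1)))) rfl ?_
  refine ⟨?_, ?_, fun y hy => ?_⟩
  · simp [exec, IExp.eval, Store.setI_ivar, Store.putI_ivar, b1]
  · simp only [exec, e3.2, h.coins, ← dropCoins_add]
    congr 1
    ring
  · simp only [exec, IExp.eval, Store.setI_iarr, Store.putI_iarr, b1, b2, b3, e2, e3.1]
    by_cases hyz : y = z
    · simp [hyz, coinPair, h.coins, ← dropCoins_add]
    · simpa [hyz] using h.pairs y (by omega)

/-- The time for `drawLayerCmd`. -/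
def drawTime (M q : ℕ) : ℕ := M * (q * 12 + 20) + 5

theorem drawLayerCmd_spec {s : CState} (hb : Base c D q M I t s)
    (h : Tape q ω (s.1.ivar 6 * M) s) :
    Ends g drawLayerCmd (drawTime M q) s fun s' =>
      s'.1.ivar 6 = s.1.ivar 6 + 1 ∧ Tape q ω (s'.1.ivar 6 * M) s' := by
  have h1 : Ends g (.for 21 (.var 3) drawPairCmd) (M * ((q * 12 + 17) + 3) + 3) s
      (Tape q ω (s.1.ivar 6 * M + M)) := by
    refine Ends.for M (fun i => Tape q ω (s.1.ivar 6 * M + i)) rfl (fun i s' z h => ?_) h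
      (fun s' hF => ?_) (fun i s' hi hI hv hF => ?_)
    · exact ⟨by simpa [Store.setI_ivar] using h.ptr, h.coins, h.pairs⟩
    · exact Eq.trans (hF (.iv 3) rfl) hb.paths
    · exact drawPairCmd_spec (Eq.trans (hF (.iv 5) rfl) hb.bits) hI
  refine Ends.mono (k := (M * ((q * 12 + 17) + 3) + 3) + 1 + 1) (h1.seq fun s₁ e1 hF1 => ?_)
    (by simp only [drawTime]; ring_nf; omega) fun _ h => h
  refine Ends.of_exec (P := .iset 6 (.add (.var 6) (.const 1))) rfl ?_
  have a : s₁.1.ivar 6 = s.1.ivar 6 := hF1 (.iv 6) rfl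
  have e : (exec g (.iset 6 (.add (.var 6) (.const 1))) s₁).1.ivar 6 = s.1.ivar 6 + 1 := by
    simp [exec, IExp.eval, Store.setI_ivar, a]
  refine ⟨e, ?_⟩
  rw [e, add_mul, one_mul]
  exact ⟨by simpa [exec, Store.setI_ivar] using e1.ptr, e1.coins, e1.pairs⟩

/-- Layers are drawn for all paths at once, as soon as the current path needs them. So the layers of
a path are at fixed places of the stream, whatever the order in which they are used. -/
theorem drawWhile_spec {s : CState} (hb : Base c D q M I t s)
    (h : Tape q ω (s.1.ivar 6 * M) s) {m : ℕ} (hm : s.1.iarr 3 (s.1.ivar 9) = m) :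
    Ends g (.while (.ilt (.var 6) (.get 3 (.var 9))) drawLayerCmd) (m * (drawTime M q + 1) + 1) s
      fun s' => m ≤ s'.1.ivar 6 ∧ Tape q ω (s'.1.ivar 6 * M) s' := by
  have key := Ends.while (f := g) (b := .ilt (.var 6) (.get 3 (.var 9))) (P := drawLayerCmd)
    (k := drawTime M q)
    (fun i s' => m ≤ s'.1.ivar 6 + i ∧ Base c D q M I t s' ∧ s'.1.iarr 3 (s'.1.ivar 9) = m ∧
      Tape q ω (s'.1.ivar 6 * M) s')
    (fun s' h hlt => by
      simp only [Test.Holds, IExp.eval] at hlt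
      omega)
    (fun i s' h hlt => by
      refine ((drawLayerCmd_spec h.2.1 h.2.2.2).frame).mono le_rfl ?_
      rintro s'' ⟨e, hF⟩
      refine ⟨i, le_rfl, by omega, h.2.1.frame hF (by decide), ?_, e.2⟩
      have a1 : s''.1.iarr 3 = s'.1.iarr 3 := hF (.ia 3) rfl
      have a2 : s''.1.ivar 9 = s'.1.ivar 9 := hF (.iv 9) rfl
      rw [a1, a2, h.2.2.1])
    m s ⟨by omega, hb, hm, h⟩
  refine key.mono le_rfl ?_
  rintro s' ⟨⟨j, -, -, h3, h4⟩, hlt⟩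
  simp only [Test.Holds, IExp.eval] at hlt
  exact ⟨by omega, h4⟩

/-- The path `i` is made of every `M`-th pair of the stream. -/
def streamPath (q M : ℕ) (ω : ℕ → Bool) (i k : ℕ) : ℕ × ℕ := coinPair q (k * M + i) ω

/-- The time for `passCmd`, if the path has `m` layers. -/
def passTime (n M q m : ℕ) : ℕ :=
  m * (drawTime M q + checkTime n + 10) + residTime n + n * 4 + 16

/-- `passCmd` computes `pass`, and then what is needed to extend and to complete the rounded
solution. Updates are reported in integer variable `8`, and small marginals in `16`. -/
theorem passCmd_spec {s : CState} (hb : Base c D q M I t s)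
    (hω : Tape q ω (s.1.ivar 6 * M) s) {i σ : ℕ} (hi : i < M) (h9 : s.1.ivar 9 = i)
    (hlen : s.1.iarr 3 i = σ * D) (hpow : s.1.rarr 2 i = (9 / 10) ^ σ)
    (h6 : s.1.rvar 6 = maxSingle g) {x : Fin n → ℝ} (hx : xval n s = x) {p : Work n}
    (hp : pass g c D x (streamPath q M ω i) (σ * D) = p) :
    Ends g passCmd (passTime n M q (σ * D)) s fun s' =>
      Tape q ω (s'.1.ivar 6 * M) s' ∧ xval n s' = p.x ∧ s'.1.set n 4 = p.R ∧
      s'.1.set n 6 = fill g c p.R ∧ (s'.1.ivar 16 ≠ 0 ↔ Small g c t σ p.R) ∧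
      (s'.1.ivar 8 ≠ 0 ↔ s.1.ivar 8 ≠ 0 ∨ p.cnt ≠ 0) := by
  set m := σ * D with hmdef
  have h1 : Ends g (.for 14 (.var 0) (.iput 4 (.var 14) (.const 0))) (n * (1 + 3) + 3) s
      fun s' => s'.1.set n 4 = ∅ := by
    refine (Ends.forAll (n := n) rfl hb.size rfl rfl
      (fun A s' => ∀ j ∈ A, s'.1.iarr 4 j = 0) (fun _ _ _ h => h) (by simp)
      (fun A j s' hj hI hv hF => ?_)).mono le_rfl fun s' h => ?_
    · intro h hh
      simp only [exec, IExp.eval, Store.putI_iarr, hv]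
      split_ifs with hc
      · rfl
      · refine hI h ((Finset.mem_insert.1 hh).resolve_left fun e => hc ⟨trivial, by rw [e]⟩)
    · ext j
      simp [Store.mem_set, h j]
  refine Ends.mono (k := (n * (1 + 3) + 3) + ((m * (drawTime M q + 1) + 1) + (1 +
    ((m * ((checkTime n + 5 + 1) + 3) + 3) + (1 + (1 + residTime n + 1) + 1) + 1) + 1) + 1) + 1)
    (h1.seq fun s₁ e1 hF1 => ?_) (by simp only [passTime]; ring_nf; omega) fun _ h => h
  have hb1 := hb.frame hF1 (by decide)
  have hω1 : Tape q ω (s₁.1.ivar 6 * M) s₁ := by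
    have : s₁.1.ivar 6 = s.1.ivar 6 := hF1 (.iv 6) rfl
    rw [this]
    exact hω.frame hF1 (by decide)
  have h91 : s₁.1.ivar 9 = i := Eq.trans (hF1 (.iv 9) rfl) h9
  have hlen1 : s₁.1.iarr 3 (s₁.1.ivar 9) = m := by
    rw [h91]
    exact (congrFun (hF1 (.ia 3) rfl) i).trans hlen
  refine (drawWhile_spec hb1 hω1 hlen1).seq fun s₂ e2 hF2 => ?_
  have hb2 := hb1.frame hF2 (by decide)
  obtain ⟨hm2, hω2⟩ := e2
  have h92 : s₂.1.ivar 9 = i := Eq.trans (hF2 (.iv 9) rfl) h91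
  have h3 : Ends g (.iset 11 (.var 9)) 1 s₂ fun s' => s'.1.ivar 11 = i :=
    Ends.of_exec (P := .iset 11 (.var 9)) rfl (by simp [exec, IExp.eval, Store.setI_ivar, h92])
  refine h3.seq fun s₃ e3 hF3 => ?_
  have hb3 := hb2.frame hF3 (by decide)
  have h63 : s₃.1.ivar 6 = s₂.1.ivar 6 := hF3 (.iv 6) rfl
  have hω3 : Tape q ω (s₂.1.ivar 6 * M) s₃ := hω2.frame hF3 (by decide)
  have h93 : s₃.1.ivar 9 = i := Eq.trans (hF3 (.iv 9) rfl) h92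
  have hlen3 : s₃.1.iarr 3 i = m := by
    rw [← hlen1, h91]
    exact congrFun (Eq.trans (hF3 (.ia 3) rfl) (hF2 (.ia 3) rfl)) i
  have h83 : s₃.1.ivar 8 = s.1.ivar 8 :=
    Eq.trans (hF3 (.iv 8) rfl) (Eq.trans (hF2 (.iv 8) rfl) (hF1 (.iv 8) rfl))
  have hx3 : xval n s₃ = x := by rw [hF3.xval_eq rfl, hF2.xval_eq rfl, hF1.xval_eq rfl, hx]
  have hR3 : s₃.1.set n 4 = ∅ := by rw [hF3.set_eq rfl, hF2.set_eq rfl, e1]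
  have hpow3 : s₃.1.rarr 2 i = (9 / 10) ^ σ := (congrFun (Eq.trans (hF3 (.ra 2) rfl)
    (Eq.trans (hF2 (.ra 2) rfl) (hF1 (.ra 2) rfl))) i).trans hpow
  have h6r : s₃.1.rvar 6 = maxSingle g := Eq.trans (hF3 (.rv 6) rfl)
    (Eq.trans (hF2 (.rv 6) rfl) (Eq.trans (hF1 (.rv 6) rfl) h6))
  have h4 : Ends g (.for 10 (.get 3 (.var 9)) (.seq checkCmd pickCmd))
      (m * ((checkTime n + 5 + 1) + 3) + 3) s₃ fun s' => s'.1.set n 4 = p.R ∧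
        xval n s' = p.x ∧ (s'.1.ivar 8 ≠ 0 ↔ s.1.ivar 8 ≠ 0 ∨ p.cnt ≠ 0) := by
    set P := pass g c D x (streamPath q M ω i) with hP
    refine (Ends.for m (fun k s' => s'.1.set n 4 = (P k).R ∧ xval n s' = (P k).x ∧
      (s'.1.ivar 8 ≠ 0 ↔ s.1.ivar 8 ≠ 0 ∨ (P k).cnt ≠ 0) ∧ s'.1.ivar 11 = k * M + i) rfl
      (fun k s' z h => ?_) ⟨hR3, hx3, ?_, ?_⟩ (fun s' hF => ?_)
      (fun k s' hk hI hv hF => ?_)).mono le_rfl fun s' h => ?_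
    · obtain ⟨h1, h2, h3, h4⟩ := h
      exact ⟨h1, h2, by simpa [Store.setI_ivar] using h3, by simpa [Store.setI_ivar] using h4⟩
    · simp [h83, hP, pass]
    · rw [e3]; ring
    · have a1 : s'.1.iarr 3 = s₃.1.iarr 3 := hF (.ia 3) rfl
      have a2 : s'.1.ivar 9 = s₃.1.ivar 9 := hF (.iv 9) rfl
      simp only [IExp.eval]
      rw [a1, a2, h93, hlen3]
    · obtain ⟨hI1, hI2, hI3, hI4⟩ := hI
      have hb' := hb3.frame hF (by decide)
      refine (checkCmd_spec hb'.toCtx hb'.res hI2 (S := (P k).R ∪ sat (P k).x)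
        (by rw [hI1])).seq fun t₁ f1 hG1 => ?_
      have hb1' := hb'.frame hG1 (by decide)
      refine (((pickCmd_spec (g := g) hb1'.res).frame).mono le_rfl ?_)
      rintro t₂ ⟨f2, hG2⟩
      have h11 : t₁.1.ivar 11 = k * M + i := Eq.trans (hG1 (.iv 11) rfl) hI4
      have hlt : k * M + i < s₂.1.ivar 6 * M := by
        have : (k + 1) * M ≤ s₂.1.ivar 6 * M := Nat.mul_le_mul_right _ (by omega)
        rw [add_mul] at this
        omega
      have hpair : (t₁.1.iarr 1 (t₁.1.ivar 11), t₁.1.iarr 2 (t₁.1.ivar 11)) =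
          streamPath q M ω i k := by
        rw [h11]
        exact ((hω3.frame hF (by decide)).frame hG1 (by decide)).pairs _ hlt
      rw [hpair, f1.2.1, f1.1, h11, hb1'.paths] at f2
      have h8 : t₂.1.ivar 8 = t₁.1.ivar 8 := hG2 (.iv 8) rfl
      refine ⟨?_, ?_, ?_, ?_⟩
      · rw [f2.1]; rfl
      · rw [hG2.xval_eq rfl, f1.2.1]; rfl
      · rw [h8, f1.2.2, hI3]
        simp only [hP, pass, layerStep]
        rw [← hP]
        split_ifs with hv
        · simp [hv]
        · simp [hv]
      · rw [f2.2]; ring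
    · rw [hp] at h
      exact ⟨h.1, h.2.1, h.2.2.1⟩
  refine h4.seq fun s₄ e4 hF4 => ?_
  have hb4 := hb3.frame hF4 (by decide)
  have h94 : s₄.1.ivar 9 = i := Eq.trans (hF4 (.iv 9) rfl) h93
  have h5 : Ends g (.rset 7 (.mul (.mul (.mul (.var 6) (.ofInt (.var 1))) (.ofInt (.var 1)))
      (.get 2 (.var 9)))) 1 s₄ fun s' => s'.1.rvar 7 = threshold g t σ :=
    Ends.of_exec (P := .rset 7 (.mul (.mul (.mul (.var 6) (.ofInt (.var 1))) (.ofInt (.var 1)))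
      (.get 2 (.var 9)))) rfl (by
      have a1 : s₄.1.rvar 6 = maxSingle g := Eq.trans (hF4 (.rv 6) rfl) h6r
      have a2 : s₄.1.rarr 2 i = (9 / 10) ^ σ := (congrFun (hF4 (.ra 2) rfl) i).trans hpow3
      simp [exec, IExp.eval, RExp.eval, Store.setR_rvar, h94, hb4.time, a1, a2, threshold])
  refine h5.seq fun s₅ e5 hF5 => ?_
  have hb5 := hb4.frame hF5 (by decide)
  have h7 : Ends g (.iset 15 (.var 0)) 1 s₅ fun s' => s'.1.ivar 15 = n :=
    Ends.of_exec (P := .iset 15 (.var 0)) rfl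
      (by simpa [exec, IExp.eval, Store.setI_ivar] using hb5.size)
  refine h7.seq fun s₆ e6 hF6 => ?_
  have hb6 := hb5.frame hF6 (by decide)
  have hR6 : s₆.1.set n 4 = p.R := by rw [hF6.set_eq rfl, hF5.set_eq rfl, e4.1]
  refine ((residCmd_spec (g := g) hb6.toCtx (S := p.R)
    (by rw [hR6, e6, single_self, Finset.union_empty])).frame).mono le_rfl ?_
  rintro s₇ ⟨e7, hF7⟩
  have ethr : s₆.1.rvar 7 = threshold g t σ := Eq.trans (hF6 (.rv 7) rfl) e5
  rw [ethr] at e7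
  have h67 : s₇.1.ivar 6 = s₂.1.ivar 6 := Eq.trans (hF7 (.iv 6) rfl) (Eq.trans (hF6 (.iv 6) rfl)
    (Eq.trans (hF5 (.iv 6) rfl) (Eq.trans (hF4 (.iv 6) rfl) h63)))
  have h87 : s₇.1.ivar 8 = s₄.1.ivar 8 := Eq.trans (hF7 (.iv 8) rfl)
    (Eq.trans (hF6 (.iv 8) rfl) (hF5 (.iv 8) rfl))
  refine ⟨?_, ?_, ?_, e7.2.2, e7.2.1, ?_⟩
  · rw [h67]
    exact (((hω3.frame hF4 (by decide)).frame hF5 (by decide)).frame hF6 (by decide)).frame hF7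
      (by decide)
  · rw [hF7.xval_eq rfl, hF6.xval_eq rfl, hF5.xval_eq rfl, e4.2.1]
  · rw [hF7.set_eq rfl, hR6]
  · rw [h87, e4.2.2]

end Spec

/-! ### Correctness of the sweeps -/

section Spec

variable {n : ℕ} {g : Finset (Fin n) → ℝ} {c : Fin n → ℝ} {D q M I t : ℕ} {ω : ℕ → Bool}

/-- The memory holds the parameters of the algorithm, the pairs drawn so far, the fractional
solution `x`, and the numbers `σ` of stages. -/
structure Live (c : Fin n → ℝ) (D q M I t : ℕ) (ω : ℕ → Bool) (x : Fin n → ℝ) (σ : ℕ → ℕ)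
    (s : CState) : Prop extends Base c D q M I t s where
  tape : Tape q ω (s.1.ivar 6 * M) s
  x_eq : xval n s = x
  len : ∀ i < M, s.1.iarr 3 i = σ i * D
  pow : ∀ i < M, s.1.rarr 2 i = (9 / 10) ^ σ i

theorem Live.frame {P : Cmd} {s s' : CState} {x : Fin n → ℝ} {σ : ℕ → ℕ}
    (h : Live c D q M I t ω x σ s) (hF : Frame P s s')
    (hP : ∀ l ∈ [Loc.iv 0, .iv 1, .iv 2, .iv 3, .iv 4, .iv 5, .iv 6, .iv 7, .ra 0, .ra 1, .ra 2,
      .ia 1, .ia 2, .ia 3, .coin], P.writes l = false) : Live c D q M I t ω x σ s' where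
  toBase := h.toBase.frame hF fun l hl => hP l (by simp at hl ⊢; tauto)
  tape := by
    have : s'.1.ivar 6 = s.1.ivar 6 := hF (.iv 6) (hP _ (by simp))
    rw [this]
    exact h.tape.frame hF fun l hl => hP l (by simp at hl ⊢; tauto)
  x_eq := (hF.xval_eq (hP _ (by simp))).trans h.x_eq
  len := fun i hi => (congrFun (hF (.ia 3) (hP _ (by simp))) i).trans (h.len i hi)
  pow := fun i hi => (congrFun (hF (.ra 2) (hP _ (by simp))) i).trans (h.pow i hi)

/-- A path leaves the state unchanged exactly if it causes no update and gets no stage. This is what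
the program can detect. -/
theorem sweepStep_ne_iff {w : ℕ → ℕ → ℕ × ℕ} {i : ℕ} {st : RunState n} :
    sweepStep g c D t w i st ≠ st ↔ (pass g c D st.x (w i) (st.s i * D)).cnt ≠ 0 ∨
      Small g c t (st.s i) (pass g c D st.x (w i) (st.s i * D)).R := by
  rw [← not_iff_not, not_not, not_or, not_not]
  constructor
  · intro h
    have h1 := congrFun (congrArg RunState.cnt h) i
    have h2 := congrFun (congrArg RunState.s h) i
    simp only [sweepStep] at h1 h2
    refine ⟨by simpa using h1, fun hS => ?_⟩
    rw [if_pos hS] at h2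
    simp at h2
  · rintro ⟨h1, h2⟩
    exact (sweepStep_eq_self (by simp [sweepStep, h2]) (by simp [sweepStep, h1])).1

theorem passTime_mono {m m' : ℕ} (h : m ≤ m') : passTime n M q m ≤ passTime n M q m' := by
  simp only [passTime]
  gcongr

/-- Processing a path in the program corresponds to `sweepStep`. -/
theorem sweepStep_spec {s : CState} {st : RunState n} (h : Live c D q M I t ω st.x st.s s)
    (h6 : s.1.rvar 6 = maxSingle g) {i : ℕ} (hi : i < M) (h9 : s.1.ivar 9 = i) {Sm : ℕ}
    (hSm : st.s i ≤ Sm) :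
    Ends g (.seq passCmd extendCmd) (passTime n M q (Sm * D) + 8) s fun s' =>
      Live c D q M I t ω (sweepStep g c D t (streamPath q M ω) i st).x
        (sweepStep g c D t (streamPath q M ω) i st).s s' ∧
      (s'.1.ivar 8 ≠ 0 ↔ s.1.ivar 8 ≠ 0 ∨ sweepStep g c D t (streamPath q M ω) i st ≠ st) := by
  rw [sweepStep_ne_iff]
  set p := pass g c D st.x (streamPath q M ω i) (st.s i * D) with hp
  refine Ends.mono (k := passTime n M q (st.s i * D) + 7 + 1)
    ((passCmd_spec h.toBase h.tape hi h9 (h.len i hi) (h.pow i hi) h6 h.x_eq hp.symm).seq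
      fun s₁ e hF => ?_) (Nat.add_le_add_right (passTime_mono (Nat.mul_le_mul_right _ hSm)) 8)
      fun _ h => h
  obtain ⟨e1, e2, -, -, e5, e6⟩ := e
  have hb1 := h.toBase.frame hF (by decide)
  have a9 : s₁.1.ivar 9 = i := Eq.trans (hF (.iv 9) rfl) h9
  have alen : ∀ j < M, s₁.1.iarr 3 j = st.s j * D :=
    fun j hj => (congrFun (hF (.ia 3) rfl) j).trans (h.len j hj)
  have apow : ∀ j < M, s₁.1.rarr 2 j = (9 / 10) ^ st.s j :=
    fun j hj => (congrFun (hF (.ra 2) rfl) j).trans (h.pow j hj)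
  have hext : Ends g extendCmd 7 s₁ fun s' => s' = exec g extendCmd s₁ :=
    Ends.of_exec (P := extendCmd) rfl rfl
  refine hext.frame.mono le_rfl ?_
  rintro s₂ ⟨he, hF2⟩
  have hb2 := hb1.frame hF2 (by decide)
  have a6 : s₂.1.ivar 6 = s₁.1.ivar 6 := hF2 (.iv 6) rfl
  have hω2 : Tape q ω (s₂.1.ivar 6 * M) s₂ := by
    rw [a6]
    exact e1.frame hF2 (by decide)
  have hx2 : xval n s₂ = p.x := (hF2.xval_eq rfl).trans e2
  simp only [sweepStep]
  rw [← hp]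
  by_cases hS : Small g c t (st.s i) p.R
  · have h16 : 0 < s₁.1.ivar 16 := Nat.pos_of_ne_zero (e5.2 hS)
    have key : exec g extendCmd s₁ = (((s₁.1.putI 3 i (s₁.1.iarr 3 i + D)).putR 2 i
        (s₁.1.rarr 2 i * (9 / 10))).setI 8 1, s₁.2) := by
      simp [extendCmd, exec, Test.Holds, IExp.eval, RExp.eval, rc, h16, a9, hb1.res,
        Store.putI_ivar, Store.putI_rarr]
    rw [if_pos hS]
    refine ⟨⟨hb2, hω2, hx2, fun j hj => ?_, fun j hj => ?_⟩, ?_⟩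
    · rw [he, key]
      simp only [Store.setI_iarr, Store.putR_iarr, Store.putI_iarr, true_and,
        Function.update_apply]
      split_ifs with hji
      · rw [alen i hi]; ring
      · exact alen j hj
    · rw [he, key]
      simp only [Store.setI_rarr, Store.putR_rarr, true_and, Function.update_apply]
      split_ifs with hji
      · rw [apow i hi]; ring
      · exact apow j hj
    · simp [he, key, Store.setI_ivar, hS]
  · have h16 : ¬ 0 < s₁.1.ivar 16 := by
      have := mt e5.1 hS
      omega
    have key : exec g extendCmd s₁ = s₁ := by
      simp only [extendCmd, exec, Test.Holds, IExp.eval]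
      exact if_neg h16
    rw [key] at he
    subst he
    rw [if_neg hS]
    exact ⟨⟨hb2, hω2, hx2, alen, apow⟩, by simp [e6, hS]⟩

theorem Frame.setI (v z : ℕ) (s : CState) :
    Frame (.iset v (.const z)) s (s.1.setI v z, s.2) := by
  intro l hl
  cases l with
  | iv x =>
    have : x ≠ v := by simpa [Cmd.writes] using hl
    simp [Agree, Store.setI_ivar, this]
  | _ => rfl

/-- Changes made by different paths never cancel, as the counters only grow. -/
theorem sweepTo_succ_ne_iff {w : ℕ → ℕ → ℕ × ℕ} {i : ℕ} {st : RunState n} :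
    sweepTo g c D t w (i + 1) st ≠ st ↔ sweepTo g c D t w i st ≠ st ∨
      sweepStep g c D t w i (sweepTo g c D t w i st) ≠ sweepTo g c D t w i st := by
  rw [← not_iff_not, not_not, not_or, not_not, not_not]
  constructor
  · intro h
    have h1 : sweepTo g c D t w i st = st := by
      refine (sweepTo_eq_self fun j _ => ?_).1
      have h1 := sweepTo_le (f := g) (c := c) (D := D) (t := t) (w := w) (Nat.le_succ i) st j
      have h2 := sweepTo_le (f := g) (c := c) (D := D) (t := t) (w := w) (Nat.zero_le i) st j
      rw [Nat.succ_eq_add_one, h] at h1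
      exact ⟨le_antisymm h1.1 h2.1, le_antisymm h1.2 h2.2⟩
    refine ⟨h1, ?_⟩
    rw [h1]
    rwa [sweepTo, h1] at h
  · rintro ⟨h1, h2⟩
    rw [sweepTo, h2, h1]

/-- The time for `sweepCmd`, if no path has more than `Sm` stages. -/
def sweepTime (n D M q Sm : ℕ) : ℕ := M * (passTime n M q (Sm * D) + 11) + 5

/-- `sweepCmd` computes `sweep`, and whether it has changed anything. -/
theorem sweepCmd_spec {s : CState} {st : RunState n} (h : Live c D q M I t ω st.x st.s s)
    (h6 : s.1.rvar 6 = maxSingle g) {Sm : ℕ}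
    (hSm : ∀ j, (sweep g c D M t (streamPath q M ω) st).s j ≤ Sm) :
    Ends g sweepCmd (sweepTime n D M q Sm) s fun s' =>
      Live c D q M I t ω (sweep g c D M t (streamPath q M ω) st).x
        (sweep g c D M t (streamPath q M ω) st).s s' ∧
      (s'.1.ivar 8 ≠ 0 ↔ sweep g c D M t (streamPath q M ω) st ≠ st) := by
  have h1 : Ends g (.iset 8 (.const 0)) 1 s fun s' => s'.1.ivar 8 = 0 :=
    Ends.of_exec (P := .iset 8 (.const 0)) rfl (by simp [exec, IExp.eval, Store.setI_ivar])
  refine Ends.mono (k := 1 + (M * (passTime n M q (Sm * D) + 8 + 3) + 3) + 1)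
    (h1.seq fun s₁ e1 hF1 => ?_) (le_of_eq (by simp only [sweepTime]; ring)) fun _ h => h
  have hl1 := h.frame hF1 (by decide)
  refine Ends.for M (fun i s' =>
    Live c D q M I t ω (sweepTo g c D t (streamPath q M ω) i st).x
        (sweepTo g c D t (streamPath q M ω) i st).s s' ∧
      (s'.1.ivar 8 ≠ 0 ↔ sweepTo g c D t (streamPath q M ω) i st ≠ st)) rfl
    (fun i s' z h => ?_) ⟨hl1, by simp [e1, sweepTo]⟩ (fun s' hF => ?_)
    (fun i s' hi hI hv hF => ?_)
  · exact ⟨h.1.frame (Frame.setI 9 z s') (by simp [Cmd.writes]),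
      by simpa [Store.setI_ivar] using h.2⟩
  · exact Eq.trans (hF (.iv 3) rfl) hl1.paths
  · have h6' : s'.1.rvar 6 = maxSingle g :=
      Eq.trans (hF (.rv 6) rfl) (Eq.trans (hF1 (.rv 6) rfl) h6)
    refine (sweepStep_spec hI.1 h6' hi hv (Sm := Sm) ((sweepTo_le hi.le st i).1.trans
      (hSm i))).mono le_rfl fun s'' h => ⟨h.1, ?_⟩
    rw [h.2, hI.2, sweepTo_succ_ne_iff]

/-- The time for `settleCmd`, if the effort never exceeds `K`. -/
def settleTime (n D M q Sm K : ℕ) : ℕ := (K + 1) * (sweepTime n D M q Sm + 1) + 3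

/-- `settleCmd` computes `settle`. The loop ends because the effort grows with each sweep that changes
anything; the last sweep changes nothing. -/
theorem settleCmd_spec {s : CState} {st : RunState n} (h : Live c D q M I t ω st.x st.s s)
    (h6 : s.1.rvar 6 = maxSingle g) {Sm K : ℕ}
    (hSm : ∀ v j, ((sweep g c D M t (streamPath q M ω))^[v] st).s j ≤ Sm)
    (hK : ∀ v, effort M ((sweep g c D M t (streamPath q M ω))^[v] st) ≤ K) :
    Ends g settleCmd (settleTime n D M q Sm K) s fun s' =>
      Live c D q M I t ω (settle g c D M t (streamPath q M ω) st).x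
        (settle g c D M t (streamPath q M ω) st).s s' := by
  have h1 : Ends g (.iset 8 (.const 1)) 1 s fun s' => s'.1.ivar 8 = 1 :=
    Ends.of_exec (P := .iset 8 (.const 1)) rfl (by simp [exec, IExp.eval, Store.setI_ivar])
  refine Ends.mono (k := 1 + ((K + 1) * (sweepTime n D M q Sm + 1) + 1) + 1)
    (h1.seq fun s₁ e1 hF1 => ?_) (by simp only [settleTime]; omega) fun _ h => h
  have hl1 := h.frame hF1 (by decide)
  have h61 : s₁.1.rvar 6 = maxSingle g := Eq.trans (hF1 (.rv 6) rfl) h6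
  set W := sweep g c D M t (streamPath q M ω) with hW
  have key := Ends.while (f := g) (b := .ilt (.const 0) (.var 8)) (P := sweepCmd)
    (k := sweepTime n D M q Sm)
    (fun i s' => ∃ v, Live c D q M I t ω (W^[v] st).x (W^[v] st).s s' ∧
      s'.1.rvar 6 = maxSingle g ∧ (s'.1.ivar 8 = 0 → W^[v + 1] st = W^[v] st) ∧
      (s'.1.ivar 8 ≠ 0 → K + 1 - effort M (W^[v] st) ≤ i))
    (fun s' h hlt => by
      obtain ⟨v, -, -, -, hv⟩ := h
      simp only [Test.Holds, IExp.eval] at hlt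
      have := hv hlt.ne'
      have := hK v
      omega)
    (fun i s' h hlt => by
      obtain ⟨v, hl, h6', -, hv⟩ := h
      simp only [Test.Holds, IExp.eval] at hlt
      have hv := hv hlt.ne'
      have hSm' := hSm (v + 1)
      simp only [Function.iterate_succ_apply'] at hSm'
      refine ((sweepCmd_spec hl h6' hSm').frame).mono le_rfl ?_
      rintro s'' ⟨⟨e1, e2⟩, hF⟩
      refine ⟨i, le_rfl, v + 1, ?_, Eq.trans (hF (.rv 6) rfl) h6', fun h0 => ?_, fun h0 => ?_⟩
      · rw [Function.iterate_succ_apply']; exact e1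
      · have : W (W^[v] st) = W^[v] st := by
          by_contra hne
          exact (e2.2 hne) h0
        rw [Function.iterate_succ_apply' W (v + 1), Function.iterate_succ_apply' W v, this, this]
      · have : effort M (W^[v] st) < effort M (W (W^[v] st)) := effort_lt (e2.1 h0)
        rw [Function.iterate_succ_apply']
        omega)
    (K + 1) s₁ ⟨0, hl1, h61, fun h0 => by simp [e1] at h0, fun _ => by omega⟩
  refine key.mono le_rfl ?_
  rintro s' ⟨⟨j, v, hl, -, hv, -⟩, hlt⟩
  simp only [Test.Holds, IExp.eval] at hlt
  rw [← settle_eq (hv (by omega)) le_rfl]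
  exact hl

theorem maxCmd_spec {s : CState} (hs : Ctx c s) :
    Ends g maxCmd (n * 16 + 12) s fun s' => s'.1.rvar 6 = maxSingle g := by
  have h1 : Ends g (.for 14 (.var 0) (.iput 5 (.var 14) (.const 0))) (n * (1 + 3) + 3) s
      fun s' => ∀ j : Fin n, s'.1.iarr 5 j = 0 := by
    refine (Ends.forAll (n := n) rfl hs.size rfl rfl
      (fun A s' => ∀ j ∈ A, s'.1.iarr 5 j = 0) (fun _ _ _ h => h) (by simp)
      (fun A j s' hj hI hv hF => ?_)).mono le_rfl fun s' h j => h j (Finset.mem_univ j)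
    intro h hh
    simp only [exec, IExp.eval, Store.putI_iarr, hv]
    split_ifs with hc
    · rfl
    · exact hI h ((Finset.mem_insert.1 hh).resolve_left fun e => hc ⟨trivial, by rw [e]⟩)
  refine Ends.mono (k := (n * (1 + 3) + 3) + (1 + (1 + (n * (9 + 3) + 3) + 1) + 1) + 1)
    (h1.seq fun s₁ e1 hF1 => ?_) (by omega) fun _ h => h
  have hs1 := hs.frame hF1 rfl rfl
  have h2 : Ends g (.query 1 5) 1 s₁ fun s' => s'.1.rvar 1 = g ∅ :=
    Ends.of_exec (P := .query 1 5) rfl (by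
      have : s₁.1.set n 5 = ∅ := by ext j; simp [Store.mem_set, e1 j]
      simp [exec, Store.setR_rvar, this])
  refine h2.seq fun s₂ e2 hF2 => ?_
  have hs2 := hs1.frame hF2 rfl rfl
  have h3 : Ends g (.rset 6 (rc 0)) 1 s₂ fun s' => s'.1.rvar 6 = 0 :=
    Ends.of_exec (P := .rset 6 (rc 0)) rfl (by simp [exec, rc, RExp.eval, IExp.eval, Store.setR_rvar])
  refine h3.seq fun s₃ e3 hF3 => ?_
  have hs3 := hs2.frame hF3 rfl rfl
  refine (Ends.forAll (n := n) rfl hs3.size rfl rfl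
    (fun A s' => (∀ j : Fin n, s'.1.iarr 5 j = 0) ∧ s'.1.rvar 1 = g ∅ ∧
      s'.1.rvar 6 = A.fold max 0 fun j => marginal g j ∅) (fun _ _ _ h => h) ?_
      (fun A j s' hj hI hv hF => ?_)).mono le_rfl fun s' h => h.2.2
  · refine ⟨fun j => ?_, Eq.trans (hF3 (.rv 1) rfl) e2, by simp [e3]⟩
    have : s₃.1.iarr 5 = s₁.1.iarr 5 := Eq.trans (hF3 (.ia 5) rfl) (hF2 (.ia 5) rfl)
    rw [this, e1]
  · obtain ⟨i1, i2, i3⟩ := hI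
    have hset : (s'.1.putI 5 j 1).set n 5 = {j} := by
      ext h
      simp [Store.mem_set, Store.putI_iarr, i1, Fin.ext_iff]
    have hm : g {j} - g ∅ = marginal g j ∅ := by simp [marginal]
    rw [Finset.fold_insert hj]
    by_cases hlt : s'.1.rvar 6 < marginal g j ∅
    · have hlt' := hlt
      rw [i3] at hlt'
      rw [max_eq_left hlt'.le]
      simp [-sub_pos, exec, IExp.eval, RExp.eval, Test.Holds, hv, hset, hm,
        i2, hlt, Store.setR_rvar, Store.putI_rvar, Store.setR_ivar, Store.putI_ivar,
        Store.putI_iarr, Store.setR_iarr, i1]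
    · have hlt' := hlt
      rw [i3] at hlt'
      rw [max_eq_right (not_lt.1 hlt'), ← i3]
      simp [-sub_pos, exec, IExp.eval, RExp.eval, Test.Holds, hv, hset, hm,
        i2, hlt, Store.setR_rvar, Store.putI_rvar, Store.setR_ivar, Store.putI_ivar,
        Store.putI_iarr, Store.setR_iarr, i1]

/-- At a standstill, another pass along the secret path changes nothing but the scratch memory. It
leaves the rounded solution and its completion there. -/
theorem buyCmd_spec {s : CState} {st : RunState n} (h : Live c D q M I t ω st.x st.s s)
    (h6 : s.1.rvar 6 = maxSingle g) (hI : I < M) {Sm : ℕ} (hSm : st.s I ≤ Sm)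
    (hst : sweep g c D M t (streamPath q M ω) st = st) :
    Ends g buyCmd (passTime n M q (Sm * D) + n * 10 + 6) s fun s' =>
      Live c D q M I t ω st.x st.s s' ∧
      s'.1.set n 0 = s.1.set n 0 ∪ (rounded D (streamPath q M ω) I st ∪
        fill g c (rounded D (streamPath q M ω) I st)) := by
  obtain ⟨p1, p2, -⟩ := pass_of_cnt_eq_zero (standstill hst hI).1
  have h1 : Ends g (.iset 9 (.var 4)) 1 s fun s' => s'.1.ivar 9 = I :=
    Ends.of_exec (P := .iset 9 (.var 4)) rfl
      (by simpa [exec, IExp.eval, Store.setI_ivar] using h.secret)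
  refine Ends.mono (k := 1 + (passTime n M q (st.s I * D) + (n * (7 + 3) + 3) + 1) + 1)
    (h1.seq fun s₁ e1 hF1 => ?_) ?_ fun _ h => h
  swap
  · have := passTime_mono (n := n) (M := M) (q := q) (Nat.mul_le_mul_right D hSm)
    omega
  have hl1 := h.frame hF1 (by decide)
  have h61 : s₁.1.rvar 6 = maxSingle g := Eq.trans (hF1 (.rv 6) rfl) h6
  refine (passCmd_spec hl1.toBase hl1.tape hI e1 (hl1.len I hI) (hl1.pow I hI) h61 hl1.x_eq
    rfl).seq fun s₂ e2 hF2 => ?_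
  obtain ⟨f1, f2, f3, f4, -⟩ := e2
  rw [p1] at f2
  rw [p2] at f3 f4
  have hl2 : Live c D q M I t ω st.x st.s s₂ := ⟨hl1.toBase.frame hF2 (by decide), f1, f2,
    fun j hj => (congrFun (hF2 (.ia 3) rfl) j).trans (hl1.len j hj),
    fun j hj => (congrFun (hF2 (.ra 2) rfl) j).trans (hl1.pow j hj)⟩
  refine ((Ends.forAll (n := n) rfl hl2.size rfl rfl (fun A s' => ∀ h : Fin n,
    s'.1.iarr 0 h ≠ 0 ↔ h ∈ s₂.1.set n 0 ∨ (h ∈ A ∧ (h ∈ s₂.1.set n 4 ∨ h ∈ s₂.1.set n 6)))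
    (fun _ _ _ h => h) (by simp [Store.mem_set])
    (fun A j s' hj hI hv hF => ?_)).frame).mono le_rfl ?_
  · have a4 : s'.1.iarr 4 = s₂.1.iarr 4 := hF (.ia 4) rfl
    have a6 : s'.1.iarr 6 = s₂.1.iarr 6 := hF (.ia 6) rfl
    have b4 : j ∈ s₂.1.set n 4 ↔ 0 < s₂.1.iarr 4 j := by
      rw [Store.mem_set, Nat.pos_iff_ne_zero]
    have b6 : j ∈ s₂.1.set n 6 ↔ 0 < s₂.1.iarr 6 j := by
      rw [Store.mem_set, Nat.pos_iff_ne_zero]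
    intro h
    have := hI h
    have hne : h.val = j.val ↔ h = j := Fin.ext_iff.symm
    by_cases c4 : 0 < s₂.1.iarr 4 j <;> by_cases c6 : 0 < s₂.1.iarr 6 j <;>
      simp only [exec, Test.Holds, IExp.eval, hv, a4, a6, c4, c6, if_true, if_false,
        Store.putI_ivar, Store.putI_iarr, true_and, Finset.mem_insert, hne] <;>
      by_cases hh : h = j <;> simp_all [Store.putI_iarr]
  · rintro s₃ ⟨e3, hF3⟩
    refine ⟨hl2.frame hF3 (by decide), ?_⟩
    have hset : s₂.1.set n 0 = s.1.set n 0 := by rw [hF2.set_eq rfl, hF1.set_eq rfl]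
    ext j
    rw [Store.mem_set, e3 j, hset, f3, f4, rounded]
    simp

end Spec

/-! ### Correctness of the online algorithm -/

/-- The number of bits of the resolution. -/
def bits (n : ℕ) : ℕ := max 2 (Nat.clog 2 (4 * n))

/-- The resolution. -/
def resolution (n : ℕ) : ℕ := 2 ^ bits n

/-- The number of paths. -/
def numPaths (n : ℕ) : ℕ := 2 ^ (bits n + bits n + bits n)

/-- The secret path, if `ω` is the coin stream. -/
def secretPath (n : ℕ) (ω : ℕ → Bool) : ℕ := coinNum (bits n + bits n + bits n) 0 ω

/-- The stream from which the paths are read off, if `ω` is the coin stream. -/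
def pathStream (n : ℕ) (ω : ℕ → Bool) : ℕ → Bool := dropCoins (bits n + bits n + bits n) ω

theorem secretPath_lt (n : ℕ) (ω : ℕ → Bool) : secretPath n ω < numPaths n := coinNum_lt _ _

theorem four_mul_le_resolution (n : ℕ) : 4 * n ≤ resolution n :=
  (Nat.le_pow_clog (by norm_num) _).trans (Nat.pow_le_pow_right (by norm_num) (le_max_right _ _))

theorem four_le_resolution (n : ℕ) : 4 ≤ resolution n :=
  Nat.pow_le_pow_right (n := 2) (by norm_num) (le_max_left 2 (Nat.clog 2 (4 * n)))

theorem resolution_le (n : ℕ) : resolution n ≤ 8 * n + 4 := by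
  rw [resolution, bits]
  rcases le_total (Nat.clog 2 (4 * n)) 2 with h | h
  · rw [max_eq_left h]
    omega
  · rw [max_eq_right h]
    have hn : 1 < 4 * n := by
      by_contra hcon
      rw [Nat.clog_of_right_le_one (by omega)] at h
      omega
    have h1 := Nat.pow_pred_clog_lt_self (b := 2) (by norm_num) hn
    have h2 : 2 ^ Nat.clog 2 (4 * n) = 2 ^ (Nat.clog 2 (4 * n)).pred * 2 := by
      rw [← pow_succ]
      congr 1
      have : (Nat.clog 2 (4 * n)).pred = Nat.clog 2 (4 * n) - 1 := rfl
      omega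
    omega

theorem numPaths_eq (n : ℕ) : numPaths n = resolution n * resolution n * resolution n := by
  rw [numPaths, pow_add, pow_add, resolution]

theorem bits_add_two_le_resolution (n : ℕ) : bits n + 2 ≤ resolution n := by
  have h : ∀ q, 2 ≤ q → q + 2 ≤ 2 ^ q := by
    intro q hq
    induction q, hq using Nat.le_induction with
    | base => norm_num
    | succ q _ ih => rw [pow_succ]; omega
  exact h _ (le_max_left _ _)

section Spec

variable {n : ℕ} {g : Finset (Fin n) → ℝ} {c : Fin n → ℝ} {t : ℕ}

/-- Doubling finds the smallest power of two that is at least `4` and at least `4 * n`. -/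
theorem resolutionCmd_spec {s : CState} (hs : s.1.ivar 0 = n) :
    Ends g resolutionCmd (bits n * 4 + 5) s fun s' =>
      s'.1.ivar 2 = resolution n ∧ s'.1.ivar 5 = bits n := by
  have h1 : Ends g (.iset 2 (.const 4)) 1 s fun s' => s'.1.ivar 2 = 4 :=
    Ends.of_exec (P := .iset 2 (.const 4)) rfl (by simp [exec, IExp.eval, Store.setI_ivar])
  refine Ends.mono (k := 1 + (1 + (bits n * (3 + 1) + 1) + 1) + 1)
    (h1.seq fun s₁ e1 hF1 => ?_) (by omega) fun _ h => h
  have h2 : Ends g (.iset 5 (.const 2)) 1 s₁ fun s' => s'.1.ivar 5 = 2 :=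
    Ends.of_exec (P := .iset 5 (.const 2)) rfl (by simp [exec, IExp.eval, Store.setI_ivar])
  refine h2.seq fun s₂ e2 hF2 => ?_
  have hs2 : s₂.1.ivar 0 = n := Eq.trans (hF2 (.iv 0) rfl) (Eq.trans (hF1 (.iv 0) rfl) hs)
  have e12 : s₂.1.ivar 2 = 4 := Eq.trans (hF2 (.iv 2) rfl) e1
  -- the doubling goes on exactly as long as the number of bits is below the final one
  have hlog : ∀ q, 2 ^ q < 4 * n ↔ q < Nat.clog 2 (4 * n) :=
    fun q => (Nat.lt_clog_iff_pow_lt (by norm_num)).symm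
  have key := Ends.while (f := g)
    (b := .ilt (.var 2) (.add (.add (.var 0) (.var 0)) (.add (.var 0) (.var 0))))
    (P := .seq (.iset 2 (.add (.var 2) (.var 2))) (.iset 5 (.add (.var 5) (.const 1)))) (k := 3)
    (fun i s' => s'.1.ivar 0 = n ∧ ∃ q, 2 ≤ q ∧ s'.1.ivar 2 = 2 ^ q ∧ s'.1.ivar 5 = q ∧
      q ≤ bits n ∧ bits n ≤ q + i)
    (fun s' h hlt => by
      obtain ⟨h0, q, h1, h2, -, -, h3⟩ := h
      simp only [Test.Holds, IExp.eval, h0, h2] at hlt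
      have := (hlog q).1 (by omega)
      have := le_max_right 2 (Nat.clog 2 (4 * n))
      simp only [bits] at h3
      omega)
    (fun i s' h hlt => by
      obtain ⟨h0, q, h1, h2, h3, h4, h5⟩ := h
      simp only [Test.Holds, IExp.eval, h0, h2] at hlt
      have h6 := (hlog q).1 (by omega)
      have h7 : Nat.clog 2 (4 * n) ≤ bits n := le_max_right _ _
      refine Ends.of_exec (P := .seq (.iset 2 (.add (.var 2) (.var 2)))
        (.iset 5 (.add (.var 5) (.const 1)))) rfl ?_
      refine ⟨i, le_rfl, ?_, q + 1, by omega, ?_, ?_, by omega, by omega⟩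
      · simp [exec, IExp.eval, Store.setI_ivar, h0]
      · simp [exec, IExp.eval, Store.setI_ivar, h2, pow_succ, mul_two]
      · simp [exec, IExp.eval, Store.setI_ivar, h3])
    (bits n) s₂ ⟨hs2, 2, le_rfl, e12, e2, le_max_left _ _, by omega⟩
  refine key.mono le_rfl ?_
  rintro s' ⟨⟨j, h0, q, h1, h2, h3, h4, -⟩, hlt⟩
  simp only [Test.Holds, IExp.eval, h0, h2] at hlt
  have hq : q = bits n := by
    have := mt (hlog q).2 (by omega)
    simp only [bits] at h4 ⊢
    omega
  exact ⟨by rw [h2, hq]; rfl, by rw [h3, hq]⟩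

/-- `secretCmd` reads the secret path off the first coins; the stream that remains is `pathStream`. -/
theorem secretCmd_spec {s : CState} (hq : s.1.ivar 5 = bits n) :
    Ends g secretCmd (bits n * 24 + 7) s fun s' => s'.1.ivar 3 = numPaths n ∧
      s'.1.ivar 4 = secretPath n s.2 ∧ s'.2 = pathStream n s.2 := by
  have h1 : Ends g (.iset 3 (.const 1)) 1 s fun s' => s'.1.ivar 3 = 1 :=
    Ends.of_exec (P := .iset 3 (.const 1)) rfl (by simp [exec, IExp.eval, Store.setI_ivar])
  refine Ends.mono (k := 1 + (1 + ((bits n + bits n + bits n) * (5 + 3) + 3) + 1) + 1)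
    (h1.seq fun s₁ e1 hF1 => ?_) (by omega) fun _ h => h
  have h2 : Ends g (.iset 4 (.const 0)) 1 s₁ fun s' => s'.1.ivar 4 = 0 :=
    Ends.of_exec (P := .iset 4 (.const 0)) rfl (by simp [exec, IExp.eval, Store.setI_ivar])
  refine h2.seq fun s₂ e2 hF2 => ?_
  have ec : s₂.2 = s.2 := Eq.trans (hF2 .coin rfl) (hF1 .coin rfl)
  have eq2 : s₂.1.ivar 5 = bits n := Eq.trans (hF2 (.iv 5) rfl) (Eq.trans (hF1 (.iv 5) rfl) hq)
  refine Ends.for (bits n + bits n + bits n) (fun i s' => s'.1.ivar 3 = 2 ^ i ∧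
    s'.1.ivar 4 = coinNum i 0 s.2 ∧ s'.2 = dropCoins i s.2) rfl
    (fun i s' z h => ?_) ⟨Eq.trans (hF2 (.iv 3) rfl) e1, e2, ec⟩ (fun s' hF => ?_)
    (fun i s' hi hI hv hF => ?_)
  · simpa [Store.setI_ivar] using h
  · have : s'.1.ivar 5 = bits n := Eq.trans (hF (.iv 5) rfl) eq2
    simp [IExp.eval, this]
  · refine Ends.of_exec
      (P := .seq (.flip 17) (.seq (.iset 4 (.add (.add (.var 4) (.var 4)) (.var 17)))
        (.iset 3 (.add (.var 3) (.var 3))))) rfl ?_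
    rw [coinNum_succ, dropCoins_succ]
    obtain ⟨h1, h2, h3⟩ := hI
    refine ⟨?_, ?_, ?_⟩
    · simp [exec, IExp.eval, Store.setI_ivar, h1, pow_succ, mul_two]
    · simp only [exec, IExp.eval, Store.setI_ivar, h2, h3, if_true, Nat.reduceEqDiff, if_false]
      cases dropCoins i s.2 0 <;> simp
    · simp [exec, h3]

/-- The time for `initCmd`. -/
def initTime (n : ℕ) : ℕ := bits n * 28 + numPaths n * 4 + n * 6 + 21

/-- `initCmd` turns the blank memory into the memory of the initial state. -/
theorem initCmd_spec {s : CState} (hs : Ctx c s) (ht : s.1.ivar 1 = t) (h6 : s.1.ivar 6 = 0)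
    (h7 : s.1.ivar 7 = 0) (h3 : ∀ i, s.1.iarr 3 i = 0) :
    Ends g initCmd (initTime n) s fun s' =>
      Live c (resolution n) (bits n) (numPaths n) (secretPath n s.2) t (pathStream n s.2)
        (startState c).x (fun _ => 0) s' := by
  refine Ends.mono (k := (bits n * 4 + 5) + ((bits n * 24 + 7) + ((n * (3 + 3) + 3) +
    (numPaths n * (1 + 3) + 3) + 1) + 1) + 1)
    ((resolutionCmd_spec hs.size).seq fun s₁ e1 hF1 => ?_) (by simp only [initTime]; omega)
    fun _ h => h
  have hs1 := hs.frame hF1 rfl rfl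
  refine (secretCmd_spec e1.2).seq fun s₂ e2 hF2 => ?_
  have ec : s₁.2 = s.2 := hF1 .coin rfl
  rw [ec] at e2
  have hb2 : Base c (resolution n) (bits n) (numPaths n) (secretPath n s.2) t s₂ :=
    ⟨hs1.frame hF2 rfl rfl, Eq.trans (hF2 (.iv 1) rfl) (Eq.trans (hF1 (.iv 1) rfl) ht),
      Eq.trans (hF2 (.iv 2) rfl) e1.1, e2.1, e2.2.1, Eq.trans (hF2 (.iv 5) rfl) e1.2⟩
  have a6 : s₂.1.ivar 6 = 0 := Eq.trans (hF2 (.iv 6) rfl) (Eq.trans (hF1 (.iv 6) rfl) h6)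
  have hω2 : Tape (bits n) (pathStream n s.2) 0 s₂ :=
    ⟨Eq.trans (hF2 (.iv 7) rfl) (Eq.trans (hF1 (.iv 7) rfl) h7),
      by rw [e2.2.2, Nat.zero_mul]; rfl, fun y hy => absurd hy (by omega)⟩
  have h5 : Ends g (.for 14 (.var 0) (.ite (.rlt (rc 0) (.get 0 (.var 14))) (.rput 1 (.var 14)
      (rc 0)) (.rput 1 (.var 14) (rc 1)))) (n * (3 + 3) + 3) s₂ fun s' =>
      xval n s' = (startState c).x := by
    refine (Ends.forAll (n := n) rfl hb2.size rfl rfl (fun A s' => ∀ j ∈ A,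
      xval n s' j = (startState c).x j) (fun _ _ _ h => h) (by simp)
      (fun A j s' hj hI hv hF => ?_)).mono le_rfl fun s' h => funext fun j =>
        h j (Finset.mem_univ j)
    have hcj : s'.1.rarr 0 j = c j := (hb2.toCtx.frame hF rfl rfl).cost j
    intro h hh
    have hne : h.val = j.val ↔ h = j := Fin.ext_iff.symm
    have key : exec g (.ite (.rlt (rc 0) (.get 0 (.var 14))) (.rput 1 (.var 14) (rc 0))
        (.rput 1 (.var 14) (rc 1))) s' = (s'.1.putR 1 j ((startState c).x j), s'.2) := by
      simp only [exec, Test.Holds, RExp.eval, IExp.eval, rc, hv, hcj, startState]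
      push_cast
      split_ifs <;> rfl
    rw [key]
    simp only [xval, Store.putR_rarr, true_and, hne]
    split_ifs with hhj
    · rw [hhj]
    · exact hI h ((Finset.mem_insert.1 hh).resolve_left hhj)
  refine h5.seq fun s₃ e3 hF3 => ?_
  have hb3 := hb2.frame hF3 (by decide)
  refine ((Ends.for (f := g) (v := 9) (N := .var 3) (P := .rput 2 (.var 9) (rc 1)) (k := 1)
    (s₀ := s₃) (numPaths n) (fun i s' => ∀ k < i, s'.1.rarr 2 k = 1) rfl
    (fun _ _ _ h => h) (by simp) (fun s' hF => Eq.trans (hF (.iv 3) rfl) hb3.paths)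
    (fun i s' hi hI hv hF => ?_)).frame).mono le_rfl ?_
  · refine Ends.of_exec (P := .rput 2 (.var 9) (rc 1)) rfl fun k hk => ?_
    simp only [exec, IExp.eval, RExp.eval, rc, hv, Store.putR_rarr, true_and]
    split_ifs with hki
    · simp
    · exact hI k (by omega)
  · rintro s₄ ⟨e4, hF4⟩
    have b6 : s₄.1.ivar 6 = 0 := Eq.trans (hF4 (.iv 6) rfl) (Eq.trans (hF3 (.iv 6) rfl) a6)
    refine ⟨hb3.frame hF4 (by decide), ?_, (hF4.xval_eq rfl).trans e3, fun i hi => ?_,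
      fun i hi => ?_⟩
    · rw [b6, Nat.zero_mul]
      exact (hω2.frame hF3 (by decide)).frame hF4 (by decide)
    · have : s₄.1.iarr 3 = s.1.iarr 3 := Eq.trans (hF4 (.ia 3) rfl) (Eq.trans (hF3 (.ia 3) rfl)
        (Eq.trans (hF2 (.ia 3) rfl) (hF1 (.ia 3) rfl)))
      rw [this, h3, Nat.zero_mul]
    · simp [e4 i hi]

end Spec

section Online

variable {n : ℕ} {c : Fin n → ℝ} {f : ℕ → Finset (Fin n) → ℝ} {T Sm t : ℕ}

/-- The paths, if `ω` is the coin stream. -/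
def pathsOf (n : ℕ) (ω : ℕ → Bool) : ℕ → ℕ → ℕ × ℕ :=
  streamPath (bits n) (numPaths n) (pathStream n ω)

/-- The solution of the algorithm, if `ω` is the coin stream. -/
noncomputable def coinSolution (f : ℕ → Finset (Fin n) → ℝ) (c : Fin n → ℝ) (ω : ℕ → Bool)
    (t : ℕ) : Finset (Fin n) :=
  solution f c (resolution n) (numPaths n) (pathsOf n ω) (secretPath n ω) t

/-- The contents of the memory after time `t`, if `ω` is the coin stream. -/
def Snapshot (f : ℕ → Finset (Fin n) → ℝ) (c : Fin n → ℝ) (ω : ℕ → Bool) (t : ℕ)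
    (s : CState) : Prop :=
  if t = 0 then s = (Store.init c, ω) else
    Live c (resolution n) (bits n) (numPaths n) (secretPath n ω) t (pathStream n ω)
      (run f c (resolution n) (numPaths n) (pathsOf n ω) t).x
      (run f c (resolution n) (numPaths n) (pathsOf n ω) t).s s ∧
    s.1.sol n = coinSolution f c ω t

theorem Snapshot.sol {ω : ℕ → Bool} {s : CState} (h : Snapshot f c ω t s) :
    s.1.sol n = coinSolution f c ω t := by
  by_cases ht : t = 0
  · subst ht
    rw [Snapshot, if_pos rfl] at h
    subst h
    ext j
    simp [Store.sol, Store.mem_set, Store.init, coinSolution, solution]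
  · rw [Snapshot, if_neg ht] at h
    exact h.2

/-- The number of steps at a time when no path has more than `Sm` stages. -/
def coverTime (n Sm : ℕ) : ℕ :=
  initTime n + settleTime n (resolution n) (numPaths n) (bits n) Sm
    (numPaths n * Sm + n * (bits n + 2)) +
    passTime n (numPaths n) (bits n) (Sm * resolution n) + n * 26 + 24

theorem admissible (hf : IsInstance c f T) (h3 : ∀ t, 1 ≤ t → t ≤ T → IsIncreasing 3 (f t)) :
    Admissible c f T (resolution n) :=
  ⟨hf, h3, four_mul_le_resolution n, le_trans (by norm_num) (four_le_resolution n)⟩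

/-- One time step of the program corresponds to one time step of the algorithm. -/
theorem coverProgram_spec (h : Admissible c f T (resolution n)) (hS : StageBound f c T Sm)
    (ht : t + 1 ≤ T) {ω : ℕ → Bool} {s : CState} (hs : Snapshot f c ω t s) :
    Ends (f (t + 1)) coverProgram (coverTime n Sm) s (Snapshot f c ω (t + 1)) := by
  set q := bits n
  set D := resolution n with hD
  set M := numPaths n
  set I := secretPath n ω with hI
  set w := pathsOf n ω with hw
  set K := M * Sm + n * (q + 2)
  have hsol := hs.sol
  have htime : coverTime n Sm = initTime n + settleTime n D M q Sm K + passTime n M q (Sm * D) +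
    n * 26 + 24 := rfl
  have h1 : Ends (f (t + 1)) (.ite (.ilt (.const 0) (.var 1)) .skip initCmd) (initTime n + 1) s
      fun s' => Live c D q M I t (pathStream n ω) (run f c D M w t).x (run f c D M w t).s s' := by
    by_cases h0 : t = 0
    · subst h0
      rw [Snapshot, if_pos rfl] at hs
      subst hs
      refine Ends.ite (fun hlt => ?_) fun _ => ?_
      · simp [Test.Holds, IExp.eval, Store.init] at hlt
      · refine initCmd_spec (s := (Store.init c, ω)) ⟨?_, fun j => ?_⟩ ?_ ?_ ?_ fun i => ?_ <;>
          simp [Store.init]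
    · rw [Snapshot, if_neg h0] at hs
      refine Ends.ite (fun _ => ?_) fun hlt => ?_
      · exact (Ends.of_exec (P := .skip) rfl hs.1).mono (by simp [Cmd.size, initTime])
          fun _ h => h
      · simp only [Test.Holds, IExp.eval, hs.1.time] at hlt
        omega
  refine Ends.mono (k := (initTime n + 1) + (1 + ((n * 16 + 12) + (settleTime n D M q Sm K +
    (passTime n M q (Sm * D) + n * 10 + 6) + 1) + 1) + 1) + 1)
    (h1.seq fun s₁ e1 hF1 => ?_) (by omega) fun _ h => h
  have h2 : Ends (f (t + 1)) (.iset 1 (.add (.var 1) (.const 1))) 1 s₁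
      fun s' => s'.1.ivar 1 = t + 1 := Ends.of_exec (P := .iset 1 (.add (.var 1) (.const 1))) rfl
        (by simpa [exec, IExp.eval, Store.setI_ivar] using e1.time)
  refine h2.seq fun s₂ e2 hF2 => ?_
  have hl2 : Live c D q M I (t + 1) (pathStream n ω) (run f c D M w t).x (run f c D M w t).s
      s₂ := by
    refine ⟨⟨e1.toCtx.frame hF2 rfl rfl, e2, Eq.trans (hF2 (.iv 2) rfl) e1.res,
      Eq.trans (hF2 (.iv 3) rfl) e1.paths, Eq.trans (hF2 (.iv 4) rfl) e1.secret,
      Eq.trans (hF2 (.iv 5) rfl) e1.bits⟩, ?_, (hF2.xval_eq rfl).trans e1.x_eq,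
      fun i hi => (congrFun (hF2 (.ia 3) rfl) i).trans (e1.len i hi),
      fun i hi => (congrFun (hF2 (.ra 2) rfl) i).trans (e1.pow i hi)⟩
    have : s₂.1.ivar 6 = s₁.1.ivar 6 := hF2 (.iv 6) rfl
    rw [this]
    exact e1.tape.frame hF2 (by decide)
  refine (maxCmd_spec hl2.toCtx).seq fun s₃ e3 hF3 => ?_
  have hl3 := hl2.frame hF3 (by decide)
  have hinv := run_inv (w := w) (M := M) h hS hD (Nat.le_of_succ_le ht)
  refine (settleCmd_spec hl3 e3 (Sm := Sm) (K := K)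
    (fun v j => (hinv.iterate h hS ht v).stages j)
    (fun v => (hinv.iterate h hS ht v).effort_le hD)).seq fun s₄ e4 hF4 => ?_
  have hinv' := run_inv (w := w) (M := M) h hS hD ht
  have h64 : s₄.1.rvar 6 = maxSingle (f (t + 1)) := Eq.trans (hF4 (.rv 6) rfl) e3
  refine (buyCmd_spec (st := run f c D M w (t + 1)) e4 h64 (secretPath_lt n ω)
    (hinv'.stages I) (sweep_settle (run_settles h hS hD ht))).mono le_rfl fun s₅ e5 => ?_
  rw [Snapshot, if_neg (Nat.succ_ne_zero t)]
  refine ⟨e5.1, e5.2.trans ?_⟩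
  have : s₄.1.set n 0 = coinSolution f c ω t := by
    rw [hF4.set_eq rfl, hF3.set_eq rfl, hF2.set_eq rfl, hF1.set_eq rfl]
    exact hsol
  rw [this]
  rfl

end Online

/-! ### The time bound -/

/-- With `Z = 12 * (n + Sm + 1)`, the resolution is at most `Z` and the number of paths at most
`Z ^ 3`. A pass takes time `O(Z ^ 6)`, a sweep `O(Z ^ 9)`, and there are `O(Z ^ 4)` sweeps. -/
theorem coverTime_le (n Sm : ℕ) : coverTime n Sm ≤ 1691 * (12 * (n + Sm + 1)) ^ 13 := by
  set Z := 12 * (n + Sm + 1) with hZ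
  have hn : n ≤ Z := by omega
  have hSm : Sm ≤ Z := by omega
  have hD : resolution n ≤ Z := (resolution_le n).trans (by omega)
  have hq : bits n + 2 ≤ Z := (bits_add_two_le_resolution n).trans hD
  have hM : numPaths n ≤ Z ^ 3 := by
    rw [numPaths_eq, pow_succ, pow_two]
    gcongr
  have hp : ∀ k, 1 ≤ Z ^ k := fun k => Nat.one_le_pow _ _ (by omega)
  have hle : ∀ {i j}, i ≤ j → Z ^ i ≤ Z ^ j := fun h => Nat.pow_le_pow_right (by omega) h
  have e1 : residTime n ≤ 45 * Z ^ 2 := by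
    have h1 : n * (n * 12 + 26) ≤ Z * (Z * 38) := Nat.mul_le_mul hn (by omega)
    have h2 := hp 2
    simp only [residTime]
    linarith
  have e2 : checkTime n ≤ 137 * Z ^ 3 := by
    have h1 : n * (residTime n + 13) ≤ Z * (58 * Z ^ 2) :=
      Nat.mul_le_mul hn (by have := hp 2; omega)
    have h2 : Z ^ 2 ≤ Z ^ 3 := hle (by omega)
    have h3 : Z ^ 1 ≤ Z ^ 3 := hle (by omega)
    have h4 := hp 3
    simp only [checkTime, gainTime]
    linarith
  have e3 : drawTime (numPaths n) (bits n) ≤ 37 * Z ^ 4 := by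
    have h1 : numPaths n * (bits n * 12 + 20) ≤ Z ^ 3 * (Z * 32) :=
      Nat.mul_le_mul hM (by omega)
    have h2 := hp 4
    simp only [drawTime]
    linarith
  have e4 : passTime n (numPaths n) (bits n) (Sm * resolution n) ≤ 249 * Z ^ 6 := by
    have h1 : Sm * resolution n * (drawTime (numPaths n) (bits n) + checkTime n + 10) ≤
        (Z * Z) * (184 * Z ^ 4) := by
      have h2 : Z ^ 3 ≤ Z ^ 4 := hle (by omega)
      have h3 := hp 4
      exact Nat.mul_le_mul (Nat.mul_le_mul hSm hD) (by omega)
    have h2 : Z ^ 2 ≤ Z ^ 6 := hle (by omega)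
    have h3 : Z ^ 1 ≤ Z ^ 6 := hle (by omega)
    have h4 := hp 6
    simp only [passTime]
    linarith
  have e5 : sweepTime n (resolution n) (numPaths n) (bits n) Sm ≤ 265 * Z ^ 9 := by
    have h1 : numPaths n * (passTime n (numPaths n) (bits n) (Sm * resolution n) + 11) ≤
        Z ^ 3 * (260 * Z ^ 6) := Nat.mul_le_mul hM (by have := hp 6; omega)
    have h2 := hp 9
    simp only [sweepTime]
    linarith
  have e6 : settleTime n (resolution n) (numPaths n) (bits n) Sm
      (numPaths n * Sm + n * (bits n + 2)) ≤ 1333 * Z ^ 13 := by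
    have h1 : numPaths n * Sm ≤ Z ^ 3 * Z := Nat.mul_le_mul hM hSm
    have h2 : n * (bits n + 2) ≤ Z * Z := Nat.mul_le_mul hn hq
    have h3 : Z ^ 2 ≤ Z ^ 4 := hle (by omega)
    have h4 := hp 4
    have h5 : (numPaths n * Sm + n * (bits n + 2) + 1) *
        (sweepTime n (resolution n) (numPaths n) (bits n) Sm + 1) ≤
        (5 * Z ^ 4) * (266 * Z ^ 9) :=
      Nat.mul_le_mul (by linarith) (by have := hp 9; omega)
    have h6 := hp 13
    simp only [settleTime]
    linarith
  have h1 : Z ^ 3 ≤ Z ^ 13 := hle (by omega)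
  have h2 : Z ^ 1 ≤ Z ^ 13 := hle (by omega)
  have h3 : Z ^ 6 ≤ Z ^ 13 := hle (by omega)
  have h4 := hp 13
  simp only [coverTime, initTime]
  linarith

/-! ### The average over the coins -/

section Expectation

variable {n : ℕ} {c : Fin n → ℝ} {f : ℕ → Finset (Fin n) → ℝ} {T D M q Sm : ℕ}
  {w w' : ℕ → ℕ → ℕ × ℕ}

/-- A sweep looks only at the layers in the first `Sm` stages of the paths. -/
theorem sweepTo_congr {g : Finset (Fin n) → ℝ} {t : ℕ}
    (hw : ∀ i < M, ∀ k < Sm * D, w i k = w' i k) {st : RunState n} {m : ℕ} (hm : m ≤ M)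
    (hs : ∀ j, (sweepTo g c D t w m st).s j ≤ Sm) :
    sweepTo g c D t w m st = sweepTo g c D t w' m st := by
  induction m with
  | zero => rfl
  | succ m ih =>
    have hs' : ∀ j, (sweepTo g c D t w m st).s j ≤ Sm := fun j =>
      (sweepTo_le (Nat.le_succ m) st j).1.trans (hs j)
    have hp := fun x => pass_congr (f := g) (c := c) (D := D) (x := x) (y := w m) (y' := w' m)
      (k := (sweepTo g c D t w m st).s m * D) fun k hk =>
        hw m hm k (hk.trans_le (Nat.mul_le_mul_right _ (hs' m)))
    rw [sweepTo, sweepTo, ← ih (by omega) hs']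
    simp only [sweepStep]
    rw [hp]

/-- Only the first `Sm * D` layers of the first `M` paths matter. -/
theorem run_congr (h : Admissible c f T D) (hS : StageBound f c T Sm) (hD : D = 2 ^ q)
    (hw : ∀ i < M, ∀ k < Sm * D, w i k = w' i k) {t : ℕ} (ht : t ≤ T) :
    run f c D M w t = run f c D M w' t := by
  induction t with
  | zero => rfl
  | succ t ih =>
    have ih := ih (by omega)
    obtain ⟨v, hv⟩ := run_settles (w := w) (M := M) h hS hD ht
    obtain ⟨v', hv'⟩ := run_settles (w := w') (M := M) h hS hD ht
    rw [run, run, ← settle_eq hv (le_max_left v v'), ← settle_eq hv' (le_max_right v v'), ← ih]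
    have hinv := run_inv (w := w) (M := M) h hS hD (Nat.le_of_succ_le ht)
    generalize max v v' = u
    induction u with
    | zero => rfl
    | succ u ihu =>
      have hst := (hinv.iterate h hS ht (u + 1) (w := w)).stages
      simp only [Function.iterate_succ_apply', ← ihu] at hst ⊢
      exact sweepTo_congr hw le_rfl hst

theorem solution_congr (h : Admissible c f T D) (hS : StageBound f c T Sm) (hD : D = 2 ^ q)
    (hw : ∀ i < M, ∀ k < Sm * D, w i k = w' i k) {i t : ℕ} (hi : i < M) (ht : t ≤ T) :
    solution f c D M w i t = solution f c D M w' i t := by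
  induction t with
  | zero => rfl
  | succ t ih =>
    have hr : rounded D w i (run f c D M w (t + 1)) = rounded D w' i (run f c D M w' (t + 1)) := by
      rw [rounded, rounded, run_congr h hS hD hw ht]
      refine layers_congr fun k hk => hw i hi k (hk.trans_le (Nat.mul_le_mul_right _ ?_))
      exact (run_inv h hS hD ht).stages i
    rw [solution, solution, ih (by omega), hr]

/-- Sequences of `K * M` layers, seen as `M` paths with `K` layers. -/
def splitPaths (Y : Type*) (K M : ℕ) : (Fin (K * M) → Y) ≃ (Fin M → Fin K → Y) where
  toFun p i k := p (finProdFinEquiv (k, i))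
  invFun W z := W (finProdFinEquiv.symm z).2 (finProdFinEquiv.symm z).1
  left_inv p := by
    funext z
    exact congrArg p (finProdFinEquiv.apply_symm_apply z)
  right_inv W := by
    funext i k
    simp

/-- The first `m` coins encode the secret path, and the following ones the paths. The last `b` coins are
not used. -/
theorem coinAvg_cost_solution_le {m : ℕ} (h : Admissible c f T (2 ^ q))
    (hS : StageBound f c T Sm) {O : Finset (Fin n)}
    (hO : ∀ t, 1 ≤ t → t ≤ T → IsCover (f t) O) (hm : n * (q + 2) * 2 ^ q ≤ 2 ^ m) (b : ℕ) :
    coinAvg (m + (Sm * 2 ^ q * 2 ^ m * (q + q) + b)) (fun ω => cost c (solution f c (2 ^ q) (2 ^ m)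
      (streamPath q (2 ^ m) (dropCoins m ω)) (coinNum m 0 ω) T)) ≤
      (2 + Sm) * (2 * Real.log (4 * (2 ^ q : ℕ)) * cost c O) + 19 * cost c O := by
  set K := Sm * 2 ^ q with hK
  set M := 2 ^ m with hM
  let Y := Fin (2 ^ q) × Fin (2 ^ q)
  have key : ∀ i : Fin M, coinAvg (K * M * (q + q) + b) (fun ω =>
      cost c (solution f c (2 ^ q) M (streamPath q M ω) i T)) =
      (∑ W : Fin M → Fin K → Y, cost c (solution f c (2 ^ q) M (extPaths W) i T)) /
        ((2 ^ q) ^ 2) ^ (K * M) := by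
    intro i
    rw [← (splitPaths Y K M).sum_comp]
    have := coinAvg_coinPair q (K * M) b fun p =>
      cost c (solution f c (2 ^ q) M (extPaths (splitPaths Y K M p)) i T)
    refine Eq.trans ?_ this
    congr 1
    funext ω
    congr 1
    refine solution_congr h hS rfl (fun j hj k hk => ?_) i.2 le_rfl
    simp only [extPaths, extPath, dif_pos hj, splitPaths, toLayer, streamPath,
      coinPair, Equiv.coe_fn_mk, finProdFinEquiv_apply_val]
    have e : k * M + j = j + M * k := by ring
    rw [e]
    rw [dif_pos (show k < K from hk)]
  have hsum := sum_cost_solution_le h hS rfl hO hm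
  rw [Finset.sum_comm] at hsum
  have hcard : (Fintype.card (Fin M → Fin K → Y) : ℝ) = ((2 ^ q) ^ 2) ^ (K * M) := by
    simp only [Fintype.card_pi, Fintype.card_prod, Fintype.card_fin, Finset.prod_const,
      Finset.card_univ, Y]
    push_cast
    rw [← pow_two, ← pow_mul]
  have hMpos : (0 : ℝ) < 2 ^ m := by positivity
  have hMcast : ((M : ℕ) : ℝ) = 2 ^ m := by rw [hM]; push_cast; rfl
  rw [coinAvg_coinNum m (K * M * (q + q) + b) fun v ω =>
    cost c (solution f c (2 ^ q) M (streamPath q M ω) v T), Finset.sum_range]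
  simp only [key]
  rw [← Finset.sum_div, ← hcard, div_div]
  have hcpos : (0 : ℝ) < Fintype.card (Fin M → Fin K → Y) := by rw [hcard]; positivity
  rw [div_le_iff₀ (by positivity)]
  refine hsum.trans (le_of_eq ?_)
  rw [hMcast]
  ring

end Expectation

/-! ### The bounds in terms of the marginals -/

section Bounds

variable {n : ℕ} {c : Fin n → ℝ} {f : ℕ → Finset (Fin n) → ℝ} {T : ℕ}

/-- The memory follows the algorithm, as long as the program does so in each time step. -/
theorem snapshot_detOnline {B : ℕ → ℕ}
    (hB : ∀ t < T, ∀ ω s, Snapshot f c ω t s →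
      Ends (f (t + 1)) coverProgram (B t) s (Snapshot f c ω (t + 1)))
    {t : ℕ} (ht : t ≤ T) (ω : ℕ → Bool) :
    Snapshot f c ω t (detOnline coverProgram c f B t ω) := by
  induction t with
  | zero => simp [Snapshot, detOnline]
  | succ t ih => exact (hB t ht ω _ (ih (by omega))).iterate.2

theorem coinSolution_subset_succ (ω : ℕ → Bool) (t : ℕ) :
    coinSolution f c ω t ⊆ coinSolution f c ω (t + 1) := Finset.subset_union_left

/-- The completed rounded solution is a cover at each time. -/
theorem isCover_coinSolution (hf : IsInstance c f T) {t : ℕ} (ht : t + 1 ≤ T) (ω : ℕ → Bool) :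
    IsCover (f (t + 1)) (coinSolution f c ω (t + 1)) := by
  have hm := hf.mono (t + 1) (by omega) ht
  have h := isCover_union_fill hm (hf.submodular (t + 1) (by omega) ht) c
    (rounded (resolution n) (pathsOf n ω) (secretPath n ω)
      (run f c (resolution n) (numPaths n) (pathsOf n ω) (t + 1)))
  refine le_antisymm (hm (Finset.subset_univ _)) (h.symm.le.trans (hm ?_))
  exact Finset.subset_union_right

/-- The factor in front of the optimum, in terms of the size of the ground set and of the logarithm
of the ratio of the marginals. -/
theorem factor_le {O : ℝ} (hO : 0 ≤ O) (hn : 1 ≤ n) {S ℓ : ℝ} (hℓ : 0 ≤ ℓ)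
    (hS : S ≤ 1 + 20 * ℓ) :
    (2 + S) * (2 * Real.log (4 * resolution n) * O) + 19 * O ≤
      260 * (1 + Real.log n) * (1 + ℓ) * O := by
  have hn' : (1 : ℝ) ≤ n := by exact_mod_cast hn
  have hlogn : 0 ≤ Real.log n := Real.log_nonneg hn'
  have hD : (resolution n : ℝ) ≤ 8 * n + 4 := by exact_mod_cast resolution_le n
  have hD4 : (4 : ℝ) ≤ resolution n := by exact_mod_cast four_le_resolution n
  have hlog0 : 0 ≤ Real.log (4 * resolution n) := Real.log_nonneg (by linarith)
  -- `4 * (8 * n + 4) ≤ 2 ^ 6 * n`, and `log 2 ≤ 1`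
  have hlog : Real.log (4 * resolution n) ≤ 6 * (1 + Real.log n) := by
    have h1 : Real.log (4 * resolution n) ≤ Real.log (2 ^ 6 * n) :=
      Real.log_le_log (by linarith) (by linarith)
    rw [Real.log_mul (show (2 : ℝ) ^ 6 ≠ 0 by norm_num) (by linarith), Real.log_pow] at h1
    have h2 := Real.log_two_lt_d9
    push_cast at h1
    linarith
  have h1 : (2 + S) * Real.log (4 * resolution n) ≤ (20 * (1 + ℓ)) * (6 * (1 + Real.log n)) :=
    mul_le_mul (by linarith) hlog hlog0 (by linarith)
  have h2 : 1 ≤ (1 + Real.log n) * (1 + ℓ) := by nlinarith [mul_nonneg hlogn hℓ]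
  have h3 : (2 + S) * (2 * Real.log (4 * resolution n)) + 19 ≤
      260 * ((1 + Real.log n) * (1 + ℓ)) := by linarith
  calc _ = ((2 + S) * (2 * Real.log (4 * resolution n)) + 19) * O := by ring
    _ ≤ 260 * ((1 + Real.log n) * (1 + ℓ)) * O := mul_le_mul_of_nonneg_right h3 hO
    _ = _ := by ring

/-- The number of stages is linear in the time and in the logarithm of the ratio of the marginals. -/
theorem time_le {t : ℕ} (hf : IsInstance c f (t + 1)) :
    (coverTime n (maxStages f (t + 1)) : ℝ) ≤ (1691 * 276 ^ 13 : ℕ) *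
      (n + (t + 1) + Real.log (fmax f (t + 1) / fmin f (t + 1))) ^ 13 := by
  have h0 := log_ratio_nonneg hf
  have h1 := log_mul_ratio_le hf (Nat.succ_pos t)
  have h2 := maxStages_le hf (Nat.succ_pos t)
  have hn : (0 : ℝ) ≤ n := Nat.cast_nonneg n
  have ht0 : (0 : ℝ) ≤ t := Nat.cast_nonneg t
  set X : ℝ := n + (t + 1) + Real.log (fmax f (t + 1) / fmin f (t + 1)) with hX
  have h3 : (coverTime n (maxStages f (t + 1)) : ℝ) ≤
      1691 * (12 * (n + maxStages f (t + 1) + 1)) ^ 13 := by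
    exact_mod_cast coverTime_le n (maxStages f (t + 1))
  have h4 : (12 : ℝ) * (n + maxStages f (t + 1) + 1) ≤ 276 * X := by
    push_cast at h1 h2
    linarith
  calc _ ≤ _ := h3
    _ ≤ 1691 * (276 * X) ^ 13 := by gcongr
    _ = _ := by
      rw [mul_pow, ← mul_assoc, Nat.cast_mul, Nat.cast_pow, Nat.cast_ofNat, Nat.cast_ofNat]

end Bounds

end OnlineCover

theorem theorem1p2 :
    ∃ (P : OnlineCover.Cmd) (C : ℝ) (a d : ℕ),
      ∀ (n : ℕ) (c : Fin n → ℝ) (f : ℕ → Finset (Fin n) → ℝ) (T : ℕ),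
        1 ≤ T → IsInstance c f T → (∀ t, 1 ≤ t → t ≤ T → IsIncreasing 3 (f t)) →
        (∀ t < T, ∀ σ ∈ (onlineRun P c f t).support,
          (∃ k : ℕ, HaltsWithin (f (t + 1)) P σ k ∧
            (k : ℝ) ≤ a * (n + (t + 1) + Real.log (fmax f (t + 1) / fmin f (t + 1))) ^ d) ∧
          ∀ σ' ∈ (runToEnd (f (t + 1)) P σ).support,
            σ.sol n ⊆ σ'.sol n ∧ IsCover (f (t + 1)) (σ'.sol n)) ∧
        expectedCost P c f T ≤
          C * (1 + Real.log n) * (1 + Real.log (T * fmax f T / fmin f T)) * optCost c (f T) := by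
  refine ⟨coverProgram, 260, 1691 * 276 ^ 13, 13, fun n c f T hT hf h3 => ?_⟩
  have hadm := admissible hf h3
  set B : ℕ → ℕ := fun t => coverTime n (maxStages f (t + 1)) with hBdef
  have hB : ∀ t < T, ∀ ω s, Snapshot f c ω t s →
      Ends (f (t + 1)) coverProgram (B t) s (Snapshot f c ω (t + 1)) := fun t ht ω s hs =>
    coverProgram_spec (hadm.mono ht) (stageBound (hadm.mono ht).inst) le_rfl hs
  have hdet : ∀ t ≤ T, ∀ ω, ((detOnline coverProgram c f B t ω).1).sol n = coinSolution f c ω t :=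
    fun t ht ω => (snapshot_detOnline hB ht ω).sol
  have hends : ∀ t < T, ∀ ω, Ends (f (t + 1)) coverProgram (B t)
      (detOnline coverProgram c f B t ω) fun _ => True := fun t ht ω =>
    (hB t ht ω _ (snapshot_detOnline hB ht.le ω)).mono le_rfl fun _ _ => trivial
  refine ⟨fun t ht σ hσ => ?_, ?_⟩
  · obtain ⟨h1, h2⟩ := support_onlineRun hends ht hσ
    refine ⟨⟨B t, h1, time_le (hadm.mono ht).inst⟩, fun σ' hσ' => ?_⟩
    obtain ⟨ω, rfl, rfl⟩ := h2 σ' hσ'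
    rw [hdet t ht.le, hdet (t + 1) ht]
    exact ⟨coinSolution_subset_succ ω t, isCover_coinSolution hf ht ω⟩
  · obtain ⟨O, hO, hcO⟩ := exists_optCost c (f T)
    have hOt : ∀ t, 1 ≤ t → t ≤ T → IsCover (f t) O := fun t h1 h2 =>
      hf.isCover_of_le h1 h2 le_rfl hO
    -- each path causes few updates on average, as there are `D ^ 3` paths
    have hM : n * (bits n + 2) * 2 ^ bits n ≤ 2 ^ (bits n + bits n + bits n) := by
      have h1 := numPaths_eq n
      rw [numPaths] at h1
      rw [h1]
      have h2 : n ≤ resolution n := le_trans (by omega) (four_mul_le_resolution n)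
      exact Nat.mul_le_mul_right _ (Nat.mul_le_mul h2 (bits_add_two_le_resolution n))
    have havg := coinAvg_cost_solution_le hadm (stageBound hf) hOt hM
      (∑ i ∈ Finset.range T, B i)
    set L := bits n + bits n + bits n + (maxStages f T * 2 ^ bits n *
      2 ^ (bits n + bits n + bits n) * (bits n + bits n) + ∑ i ∈ Finset.range T, B i)
    have hexp : expectedCost coverProgram c f T =
        coinAvg L fun ω => cost c (coinSolution f c ω T) := by
      rw [expectedCost, onlineRun_eq_coins (L := L) hends le_rfl (by omega), PMF.map_comp,
        sum_coins_map]
      simp only [Function.comp_apply, hdet T le_rfl]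
    rw [← hcO]
    refine (hexp.le.trans havg).trans ?_
    rcases Nat.eq_zero_or_pos n with rfl | hn
    -- without elements both sides vanish
    · have : cost c O = 0 := by simp [cost, Finset.eq_empty_of_isEmpty O]
      simp [this]
    · exact factor_le (cost_nonneg hf.cost_nonneg O) hn (log_mul_ratio_nonneg hf hT)
        (maxStages_le hf hT)
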